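/- Let $M\subset\mathbb C^{n+1}$ be a real hypersurface that is smooth near $p\in M$. All coordinates $(z,w)$, $z=(z_1,\dots,z_n)$, $w=u+iv$, are local holomorphic coordinates centered at $p$ in which $\{v=0\}$ is tangent to $M$ at $p$, so that $M$ is near $p$ a graph $v=F(z,\bar z,u)$ with $F$ smooth and real-valued. A weight is a tuple $\Lambda=(\lambda_1,\dots,\lambda_n)$ of rational numbers with $\frac12\ge\lambda_1\ge\dots\ge\lambda_n\ge0$ such that for each $k$ either $\lambda_k=0$ or $\sum_{j\le k}a_j\lambda_j=1$ for some nonnegative integers $a_1,\dots,a_k$ with $a_k>0$. The variables $z_i,\bar z_i$ have weight $\lambda_i$, and $w,u$ have weight $1$; $|\alpha|_\Lambda=\sum_i\alpha_i\lambda_i$. Let $o_\Lambda(1)$ denote a smooth function all of whose derivatives in $z,\bar z,u$ of weighted order $\le1$ vanish at $0$. A monomial $z^\alpha\bar z^\beta$ is pluriharmonic if $\alpha=0$ or $\beta=0$. Coordinates are $\Lambda$-adapted if in them $M$ is given by $$v=P(z,\bar z)+o_\Lambda(1),\qquad(*)$$ where $P$ is a nonzero $\Lambda$-homogeneous polynomial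 of weighted degree one without pluriharmonic terms. They are $\Lambda$-adapted up to pluriharmonic terms if $(*)$ holds with a $\Lambda$-homogeneous $P$ of weighted degree one which may contain pluriharmonic terms but contains at least one term that is not pluriharmonic. A weight $\Lambda$ is distinguished if $\Lambda$-adapted coordinates exist. The multitype weight $\Lambda_M=(\mu_1,\dots,\mu_n)$ of $M$ at $p$ is the infimum of the distinguished weights in the lexicographic ordering; $M$ has finite multitype at $p$ if all $\mu_i>0$. Let $z_i^*=z_i+f_i(z,w)$, $w^*=w+g(z,w)$ be a biholomorphic transformation near the origin that fixes the origin. It is $\Lambda_M$-superhomogeneous if its differential at the origin maps $\{v=0\}$ to $\{v^*=0\}$, the Taylor expansion of each $f_i$ at $0$ consists of terms of weighted degree $\ge\mu_i$, and that of $g$ consists of terms of weighted degree $\ge1$. Proposition. Let $M$ be of finite multitype at $p$, with multitype weight $\Lambda_M$. (1) If the coordinates $(z,w)$ are $\Lambda_M$-adapted up to pluriharmonic terms, then $(z^*,w^*)$ are $\Lambda_M$-adapted up to pluriharmonic terms if and only if the transformation is $\Lambda_M$-superhomogeneous. (2) If the coordinates $(z,w)$ are $\Lambda_M$-adapted, then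 $(z^*,w^*)$ are $\Lambda_M$-adapted if and only if the transformation is $\Lambda_M$-superhomogeneous and the Taylor expansion of $g$ contains no term $D_\alpha z^\alpha$ with $|\alpha|_{\Lambda_M}=1$. -/

import Mathlib

open Filter
open scoped ContDiff Topology

namespace CatlinMultitype

/-- Complex space of dimension `n + 1`, with points written `(z, w)`. -/
abbrev Space (n : ℕ) : Type := (Fin n → ℂ) × ℂ

/-- `M` is, near its point `p`, a smooth real hypersurface. -/
def IsSmoothHypersurfaceAt {n : ℕ} (M : Set (Space n)) (p : Space n) : Prop :=
  p ∈ M ∧ ∃ ρ : Space n → ℝ,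
    (∀ᶠ q in 𝓝 p, ContDiffAt ℝ ∞ ρ q) ∧ fderiv ℝ ρ p ≠ 0 ∧ ∀ᶠ q in 𝓝 p, (q ∈ M ↔ ρ q = 0)

/-- `T` is holomorphic near `p` with nonsingular complex Jacobian at `p`, that is, a biholomorphism
from a neighbourhood of `p` onto a neighbourhood of `T p`. -/
def IsBiholomorphicAt {n : ℕ} (T : Space n → Space n) (p : Space n) : Prop :=
  AnalyticAt ℂ T p ∧ ∃ L : Space n ≃L[ℂ] Space n, HasFDerivAt T (L : Space n →L[ℂ] Space n) p

/-- Local holomorphic coordinates `(z, w) = Φ` centered at `p`. -/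
def IsCoordinatesAt {n : ℕ} (p : Space n) (Φ : Space n → Space n) : Prop :=
  IsBiholomorphicAt Φ p ∧ Φ p = 0

/-- In the coordinates `Φ` at `p`, the hyperplane `v = 0` is tangent to `M` at `p`, and `M` is near
`p` the graph `v = F (z, u)` of the smooth real function `F`, where `w = u + i v`. -/
def IsGraphIn {n : ℕ} (M : Set (Space n)) (p : Space n) (Φ : Space n → Space n)
    (F : (Fin n → ℂ) × ℝ → ℝ) : Prop :=
  (∀ᶠ x in 𝓝 (0 : (Fin n → ℂ) × ℝ), ContDiffAt ℝ ∞ F x) ∧ F 0 = 0 ∧ fderiv ℝ F 0 = 0 ∧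
    ∀ᶠ q in 𝓝 p, (q ∈ M ↔ (Φ q).2.im = F ((Φ q).1, (Φ q).2.re))

/-- Weights: `1/2 ≥ λ₁ ≥ … ≥ λₙ ≥ 0`, and for each `k` with `λ_k ≠ 0` there are nonnegative integers
`a₁, …, a_k` with `a_k > 0` and `a₁ λ₁ + … + a_k λ_k = 1`. -/
def IsWeight {n : ℕ} (Λ : Fin n → ℚ) : Prop :=
  (∀ i, 0 ≤ Λ i ∧ Λ i ≤ 1 / 2) ∧ Antitone Λ ∧
    ∀ k, Λ k = 0 ∨ ∃ a : Fin n → ℕ, 0 < a k ∧ ∑ j ∈ Finset.Iic k, (a j : ℚ) * Λ j = 1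

/-- The weight of a variable: `some i` stands for the `i`-th tangential variable, of weight `λᵢ`,
and `none` for the nontangential variable (`w`, or `u`), of weight one. -/
def varWeight {n : ℕ} (Λ : Fin n → ℚ) : Option (Fin n) → ℚ
  | some i => Λ i
  | none => 1

/-- Coordinate vectors of the `(z, w)`-space. -/
def cdir {n : ℕ} : Option (Fin n) → Space n
  | some i => (Pi.single i 1, 0)
  | none => (0, 1)

/-- Real directions in the `(z, u)`-space: `(some i, c)` is the direction `c` in the `zᵢ`-plane
(`∂/∂xᵢ` for `c = 1` and `∂/∂yᵢ` for `c = i`), and `(none, c)` is a multiple of `∂/∂u`. -/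
def rdir {n : ℕ} : Option (Fin n) × ℂ → (Fin n → ℂ) × ℝ
  | (some i, c) => (Pi.single i c, 0)
  | (none, c) => (0, c.re)

/-- `R` is `o_Λ(1)`: all derivatives of `R` at the origin of weighted order at most one vanish.
As `zᵢ` and its conjugate have the same weight, and the Wirtinger derivatives in `zᵢ` have the same
complex span as the derivatives in `xᵢ` and `yᵢ`, this is expressed by real derivatives. -/
def IsLittleO {n : ℕ} (Λ : Fin n → ℚ) (R : (Fin n → ℂ) × ℝ → ℂ) : Prop :=
  ∀ (k : ℕ) (s : Fin k → Option (Fin n) × ℂ), ∑ j, varWeight Λ (s j).1 ≤ 1 →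
    iteratedFDeriv ℝ k R 0 (fun j => rdir (s j)) = 0

/-- Polynomials in `z` (variables `inl i`) and the conjugate of `z` (variables `inr i`). -/
abbrev ZPoly (n : ℕ) : Type := MvPolynomial (Fin n ⊕ Fin n) ℂ

/-- The value of such a polynomial at `z`. -/
noncomputable def ZPoly.value {n : ℕ} (P : ZPoly n) (z : Fin n → ℂ) : ℂ :=
  MvPolynomial.eval (Sum.elim z (fun i => (starRingEnd ℂ) (z i))) P

/-- `P` is `Λ`-homogeneous of weighted degree one. -/
def IsHomogeneousOne {n : ℕ} (Λ : Fin n → ℚ) (P : ZPoly n) : Prop :=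
  MvPolynomial.IsWeightedHomogeneous (Sum.elim Λ Λ) P 1

/-- A monomial is mixed, that is, not pluriharmonic, if it contains some `zᵢ` and some conjugate
of a `zⱼ`. -/
def IsMixed {n : ℕ} (d : Fin n ⊕ Fin n →₀ ℕ) : Prop :=
  (∃ i, d (Sum.inl i) ≠ 0) ∧ ∃ j, d (Sum.inr j) ≠ 0

/-- In the coordinates `Φ` at `p`, the hypersurface `M` is given by `v = P(z, z̄) + o_Λ(1)`.
(As `v` is real, a `P` that is `Λ`-homogeneous of weighted degree one is then real-valued.) -/
def HasLeadingPart {n : ℕ} (M : Set (Space n)) (p : Space n) (Λ : Fin n → ℚ)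
    (Φ : Space n → Space n) (P : ZPoly n) : Prop :=
  IsCoordinatesAt p Φ ∧ ∃ F : (Fin n → ℂ) × ℝ → ℝ, IsGraphIn M p Φ F ∧
    IsLittleO Λ (fun x => (F x : ℂ) - P.value x.1)

/-- `Φ` are `Λ`-adapted coordinates for `M` at `p`: `Λ` is a weight and `M` is given by
`v = P(z, z̄) + o_Λ(1)` with `P` nonzero, `Λ`-homogeneous of weighted degree one and without
pluriharmonic terms. -/
def IsAdapted {n : ℕ} (M : Set (Space n)) (p : Space n) (Λ : Fin n → ℚ)
    (Φ : Space n → Space n) : Prop :=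
  IsWeight Λ ∧ ∃ P : ZPoly n, IsHomogeneousOne Λ P ∧ P ≠ 0 ∧ (∀ d ∈ P.support, IsMixed d) ∧
    HasLeadingPart M p Λ Φ P

/-- `Φ` are `Λ`-adapted up to pluriharmonic terms: as above, but `P` may contain pluriharmonic
terms besides at least one that is not. -/
def IsAdaptedModPluriharmonic {n : ℕ} (M : Set (Space n)) (p : Space n) (Λ : Fin n → ℚ)
    (Φ : Space n → Space n) : Prop :=
  IsWeight Λ ∧ ∃ P : ZPoly n, IsHomogeneousOne Λ P ∧ (∃ d ∈ P.support, IsMixed d) ∧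
    HasLeadingPart M p Λ Φ P

/-- The weight `Λ` is distinguished for `M` at `p`. -/
def IsDistinguished {n : ℕ} (M : Set (Space n)) (p : Space n) (Λ : Fin n → ℚ) : Prop :=
  ∃ Φ : Space n → Space n, IsAdapted M p Λ Φ

/-- `Λ` is the multitype weight of `M` at `p`: the infimum of the distinguished weights for the
lexicographic ordering. -/
def IsMultitypeWeight {n : ℕ} (M : Set (Space n)) (p : Space n) (Λ : Fin n → ℚ) : Prop :=
  IsGLB {L : Lex (Fin n → ℚ) | IsDistinguished M p (ofLex L)} (toLex Λ)

/-- `M` has finite multitype at `p`, with multitype weight `Λ`: no multitype entry `1 / λᵢ` is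
infinite. -/
def HasFiniteMultitype {n : ℕ} (M : Set (Space n)) (p : Space n) (Λ : Fin n → ℚ) : Prop :=
  IsMultitypeWeight M p Λ ∧ ∀ i, 0 < Λ i

/-- The Taylor expansion at the origin of the holomorphic function `h` of `(z, w)` consists of
terms of weighted degree at least `κ`: all partial derivatives of smaller weighted order vanish. -/
def WeightedOrderGE {n : ℕ} (Λ : Fin n → ℚ) (κ : ℚ) (h : Space n → ℂ) : Prop :=
  ∀ (k : ℕ) (s : Fin k → Option (Fin n)), ∑ j, varWeight Λ (s j) < κ →
    iteratedFDeriv ℂ k h 0 (fun j => cdir (s j)) = 0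

/-- The function `fᵢ` in `zᵢ* = zᵢ + fᵢ(z, w)`. -/
def fPart {n : ℕ} (T : Space n → Space n) (i : Fin n) : Space n → ℂ :=
  fun x => (T x).1 i - x.1 i

/-- The function `g` in `w* = w + g(z, w)`. -/
def gPart {n : ℕ} (T : Space n → Space n) : Space n → ℂ :=
  fun x => (T x).2 - x.2

/-- `T` preserves the form `v = Ψ(z, z̄, u)` with tangent hyperplane `v = 0`: its differential
at the origin maps the hyperplane `v = 0` to the hyperplane `v* = 0`. -/
def PreservesTangent {n : ℕ} (T : Space n → Space n) : Prop :=
  ∀ ξ : Space n, ξ.2.im = 0 → (fderiv ℂ T 0 ξ).2.im = 0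

/-- `Λ`-superhomogeneous transformations. -/
def IsSuperhomogeneous {n : ℕ} (Λ : Fin n → ℚ) (T : Space n → Space n) : Prop :=
  PreservesTangent T ∧ (∀ i, WeightedOrderGE Λ (Λ i) (fPart T i)) ∧ WeightedOrderGE Λ 1 (gPart T)

/-- The Taylor expansion of `g` contains no term `D_α z^α` with `|α|_Λ = 1`. -/
def NoHolomorphicTermsOfWeightOne {n : ℕ} (Λ : Fin n → ℚ) (T : Space n → Space n) : Prop :=
  ∀ (k : ℕ) (s : Fin k → Fin n), ∑ j, Λ (s j) = 1 →
    iteratedFDeriv ℂ k (gPart T) 0 (fun j => cdir (some (s j))) = 0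

end CatlinMultitype

open CatlinMultitype

/-! As all weights are positive, weighted orders can be measured by the gauge `wgauge` = |w| + Σ
|z_i|^(1/λ_i). A remainder is o_Λ(1) iff it is o(gauge), a holomorphic function has weighted order
at least κ iff it is O(gauge^κ), and T is superhomogeneous iff it preserves the tangent hyperplane
and gauge ∘ T = O(gauge) (`isSuperhomogeneous_iff`). Such maps are closed under composition and,
less obviously, under inversion (`isBigO_wgauge_image`).

Sufficiency: if the inverse of T has leading terms k(z) in the tangential and c w + D(z) in the
transverse components, the leading part P becomes c⁻¹ (P ∘ k - Im D) (`isLittleO_graph_transfer`).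
Its mixed part is c⁻¹ times the mixed part of P composed with the invertible map k, hence nonzero if
that of P is; D affects only pluriharmonic terms, which gives the extra condition on g for adapted
coordinates.

Necessity rests on two ideas. (a) Minimality of the multitype makes P nondegenerate. Freeze the
conjugate variables in P at values that vanish in the variables of weight below λ_m, and take the
span of all iterated derivatives of these slices in the variables of weight at least λ_m
(`derivSpan`). After superhomogeneous shears this span contains z_m, for every m
(`exists_normalization`). Otherwise, for some m, P restricted to the variables of weight at least
λ_m is constant along a direction c lying in the variables of weight λ_m. A linear change turns c
into the last coordinate of that weight; once pluriharmonic terms are removed to high order, that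
weight and all later ones can be replaced by a smaller common value, and a lexicographically smaller
distinguished weight results (`false_of_degenerate`).

(b) Let the target coordinates be normalized in this way, and cut the weights off below at s, so
that λ_i becomes max(λ_i, s). For s = 1/2 all weights are equal and T is bounded for the gauge. At a
value s where T is bounded, the leading parts without the variables of weight below s are related by
the leading terms h of T. Hence a vector field with coefficients ∂h_m/∂z_j, λ_j < s, annihilates all
slices; as z_m lies in the span of their derivatives, the field is zero
(`pderiv_component_eq_zero`). So the leading terms of components of weight at least s do not involve
the variables of weight below s, and s can be lowered a little. The set of good s is closed, so the
descent ends with the cut-off inactive (`isBigO_wgauge_of_leadingPart`). The transverse component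
follows from the tangential ones, because its imaginary part is controlled by the defining function
(`isBigO_transverse`). -/

namespace CatlinMultitype
open Asymptotics

/-! ### Reading off derivatives from anisotropic growth. -/

section FiniteDifferences

variable {𝕜 E F : Type*} [RCLike 𝕜] [NormedAddCommGroup E] [NormedSpace 𝕜 E]
  [NormedAddCommGroup F] [NormedSpace 𝕜 F]

/-- Iterated finite differences of `f` with increments `v 0, …, v (k - 1)`. -/
def iteratedDifference : (k : ℕ) → (E → F) → (Fin k → E) → E → F
  | 0, f, _, x => f x
  | k + 1, f, v, x => iteratedDifference k (fun y => f (y + v 0) - f y) (fun j => v j.succ) x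

theorem norm_iteratedDifference_le {k : ℕ} (f : E → F) (v : Fin k → E) (x : E) (B : ℝ)
    (h : ∀ S : Finset (Fin k), ‖f (x + ∑ j ∈ S, v j)‖ ≤ B) :
    ‖iteratedDifference k f v x‖ ≤ 2 ^ k * B := by
  induction k generalizing f B with
  | zero => simpa [iteratedDifference] using h ∅
  | succ k ih =>
    have := ih (fun y => f (y + v 0) - f y) (fun j => v j.succ) (2 * B) (fun S => by
      have h1 := h (insert 0 (S.map (Fin.succEmb k)))
      have h2 := h (S.map (Fin.succEmb k))
      rw [Finset.sum_insert (by simp [Fin.succ_ne_zero]), Finset.sum_map] at h1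
      rw [Finset.sum_map] at h2
      have h3 : x + (v 0 + ∑ j ∈ S, v (Fin.succEmb k j)) = x + ∑ j ∈ S, v j.succ + v 0 := by
        simp only [Fin.coe_succEmb]; abel
      rw [h3] at h1
      refine (norm_sub_le _ _).trans ?_
      simp only [Fin.coe_succEmb] at h1 h2
      linarith)
    simp only [iteratedDifference]
    calc _ ≤ _ := this
      _ = _ := by ring

/-- By the mean value inequality, the difference in direction `v 0` has k-th derivatives within ε‖v
0‖ of `A.curryLeft (v 0)` on the ball shrunk by ‖v 0‖, so the estimate follows by induction. -/
theorem norm_iteratedDifference_sub_le {k : ℕ} (f : E → F)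
    (A : ContinuousMultilinearMap 𝕜 (fun _ : Fin k => E) F) (r ε : ℝ)
    (hf : ∀ y, ‖y‖ < r → ContDiffAt 𝕜 k f y ∧ ‖iteratedFDeriv 𝕜 k f y - A‖ ≤ ε)
    (v : Fin k → E) (x : E) (hx : ‖x‖ + ∑ j, ‖v j‖ < r) :
    ‖iteratedDifference k f v x - A v‖ ≤ ε * ∏ j, ‖v j‖ := by
  induction k generalizing f r ε with
  | zero =>
    have := (hf x (by simpa using hx)).2
    have h2 := (iteratedFDeriv 𝕜 0 f x - A).le_opNorm v
    simp only [Finset.univ_eq_empty, Finset.prod_empty, mul_one] at h2 ⊢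
    rw [iteratedDifference]
    simpa using h2.trans this
  | succ k ih =>
    rw [Fin.sum_univ_succ] at hx
    let _ : NormedSpace ℝ E := NormedSpace.restrictScalars ℝ 𝕜 E
    let _ : NormedSpace ℝ F := NormedSpace.restrictScalars ℝ 𝕜 F
    have key := ih (fun y => f (y + v 0) - f y) (A.curryLeft (v 0)) (r - ‖v 0‖) (ε * ‖v 0‖)
      (fun y hy => by
        have hy1 : ‖y‖ < r := by linarith [norm_nonneg (v 0)]
        have hy2 : ‖y + v 0‖ < r := lt_of_le_of_lt (norm_add_le _ _) (by linarith)
        have hs : (k : WithTop ℕ∞) ≤ ((k + 1 : ℕ) : WithTop ℕ∞) := by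
          exact_mod_cast Nat.le_succ k
        have c1 : ContDiffAt 𝕜 k (fun y => f (y + v 0)) y := by
          have : ContDiffAt 𝕜 k f (y + v 0) := (hf _ hy2).1.of_le hs
          exact this.comp y (contDiffAt_id.add contDiffAt_const)
        have c2 : ContDiffAt 𝕜 k f y := (hf _ hy1).1.of_le hs
        refine ⟨c1.sub c2, ?_⟩
        have e : iteratedFDeriv 𝕜 k (fun y => f (y + v 0) - f y) y =
            iteratedFDeriv 𝕜 k f (y + v 0) - iteratedFDeriv 𝕜 k f y := by
          have := iteratedFDeriv_sub_apply c1 c2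
          rw [← iteratedFDeriv_comp_add_right k (v 0) y (f := f)]
          exact this
        rw [e]
        set φ : E → ContinuousMultilinearMap 𝕜 (fun _ : Fin k => E) F :=
          fun y => iteratedFDeriv 𝕜 k f y - A.curryLeft y with hφ
        have hd : ∀ z ∈ Metric.ball (0 : E) r, HasFDerivWithinAt φ
            ((continuousMultilinearCurryLeftEquiv 𝕜 (fun _ : Fin (k+1) => E) F
              (iteratedFDeriv 𝕜 (k+1) f z - A) : E →L[𝕜] _)) (Metric.ball (0 : E) r) z := by
          intro z hz
          rw [mem_ball_zero_iff] at hz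
          have h1 : DifferentiableAt 𝕜 (iteratedFDeriv 𝕜 k f) z :=
            (hf z hz).1.differentiableAt_iteratedFDeriv (by exact_mod_cast Nat.lt_succ_self k)
          have h2 := h1.hasFDerivAt.sub (A.curryLeft.hasFDerivAt (x := z))
          refine (h2.congr_fderiv ?_).hasFDerivWithinAt
          ext a b
          simp [iteratedFDeriv_succ_apply_left, Fin.tail_def]
        have hb := Convex.norm_image_sub_le_of_norm_hasFDerivWithin_le (𝕜 := 𝕜)
          (f := φ) (C := ε) (s := Metric.ball (0 : E) r) (x := y) (y := y + v 0) hd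
          (fun z hz => by
            rw [mem_ball_zero_iff] at hz
            rw [LinearIsometryEquiv.norm_map]
            exact (hf z hz).2) (convex_ball 0 r)
            (by rwa [mem_ball_zero_iff]) (by rwa [mem_ball_zero_iff])
        rw [add_sub_cancel_left] at hb
        have e2 : φ (y + v 0) - φ y = iteratedFDeriv 𝕜 k f (y + v 0) - iteratedFDeriv 𝕜 k f y -
            A.curryLeft (v 0) := by
          change (_ - A.curryLeft (y + v 0)) - (_ - A.curryLeft y) = _
          rw [map_add]; abel
        rwa [e2] at hb)
      (fun j => v j.succ) (by linarith)
    rw [Fin.prod_univ_succ, ← mul_assoc]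
    have e3 : A v = A.curryLeft (v 0) (fun j => v j.succ) := by
      rw [ContinuousMultilinearMap.curryLeft_apply]
      exact congrArg A (Fin.cons_self_tail v).symm
    rw [e3]
    exact key

/-- The k-fold difference with increments t^(w j) v_j is t^(Σ w) times the derivative along v, up to
o(t^(Σ w)). It is also a signed sum of 2^k values of f at partial sums, all of which are o(t^(Σ w)).
-/
theorem iteratedFDeriv_eq_zero_of_isLittleO {k : ℕ} {f : E → F} (hf : ContDiffAt 𝕜 k f 0)
    (v : Fin k → E) (w : Fin k → ℝ) (hw : ∀ j, 0 < w j)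
    (h : ∀ S : Finset (Fin k), (fun t : ℝ => f (∑ j ∈ S, ((t ^ w j : ℝ) : 𝕜) • v j))
      =o[𝓝[>] 0] fun t => t ^ ∑ j, w j) :
    iteratedFDeriv 𝕜 k f 0 v = 0 := by
  set A := iteratedFDeriv 𝕜 k f 0
  set V : ℝ := ∏ j, ‖v j‖
  have hV : 0 ≤ V := Finset.prod_nonneg fun _ _ => norm_nonneg _
  have ht0 : ∀ j, Tendsto (fun t : ℝ => t ^ w j) (𝓝[>] 0) (𝓝 0) := fun j => by
    have := (Real.continuousAt_rpow_const 0 (w j) (Or.inr (hw j).le)).tendsto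
    rw [Real.zero_rpow (hw j).ne'] at this
    exact this.mono_left nhdsWithin_le_nhds
  have main : ∀ ε > 0, ‖A v‖ ≤ ε * (V + 2 ^ k) := by
    intro ε hε
    have hc : ∀ᶠ y in 𝓝 (0 : E), ContDiffAt 𝕜 k f y ∧ ‖iteratedFDeriv 𝕜 k f y - A‖ ≤ ε := by
      refine (hf.eventually (by simp)).and ?_
      have h1 : ContinuousAt (iteratedFDeriv 𝕜 k f) 0 :=
        (hf.iteratedFDeriv_right (i := k) (m := 0) (by simp)).continuousAt
      have := (tendsto_iff_norm_sub_tendsto_zero.1 h1.tendsto).eventually (ge_mem_nhds hε)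
      exact this
    obtain ⟨r, hr, hball⟩ := Metric.eventually_nhds_iff.1 hc
    have hsmall : ∀ᶠ t in 𝓝[>] (0 : ℝ), ∑ j, ‖((t ^ w j : ℝ) : 𝕜) • v j‖ < r := by
      have : Tendsto (fun t : ℝ => ∑ j, ‖((t ^ w j : ℝ) : 𝕜) • v j‖) (𝓝[>] 0) (𝓝 0) := by
        have : Tendsto (fun t : ℝ => ∑ j, ‖t ^ w j‖ * ‖v j‖) (𝓝[>] 0) (𝓝 (∑ j, ‖(0:ℝ)‖ * ‖v j‖)) :=
          tendsto_finsetSum _ fun j _ => (ht0 j).norm.mul_const _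
        simpa [norm_smul] using this
      exact this.eventually (gt_mem_nhds hr)
    have hS : ∀ᶠ t in 𝓝[>] (0 : ℝ), ∀ S : Finset (Fin k),
        ‖f (∑ j ∈ S, ((t ^ w j : ℝ) : 𝕜) • v j)‖ ≤ ε * ‖t ^ ∑ j, w j‖ :=
      eventually_all.2 fun S => (h S).bound hε
    obtain ⟨t, ⟨ht1, ht2⟩, ht3⟩ := ((hsmall.and hS).and self_mem_nhdsWithin).exists
    have htpos : (0 : ℝ) < t := ht3
    set T : ℝ := t ^ ∑ j, w j
    have hT : 0 < T := Real.rpow_pos_of_pos htpos _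
    have hTp : T = ∏ j, t ^ w j := Real.rpow_sum_of_pos htpos _ _
    have b1 := norm_iteratedDifference_le f (fun j => ((t ^ w j : ℝ) : 𝕜) • v j) 0 (ε * T)
      (fun S => by simpa [abs_of_pos hT] using ht2 S)
    have b2 := norm_iteratedDifference_sub_le (𝕜 := 𝕜) f A r ε
      (fun y hy => hball (by simpa using hy))
      (fun j => ((t ^ w j : ℝ) : 𝕜) • v j) 0 (by simpa using ht1)
    have e1 : A (fun j => ((t ^ w j : ℝ) : 𝕜) • v j) = ((T : ℝ) : 𝕜) • A v := by
      rw [A.map_smul_univ, hTp]; simp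
    have e2 : ∏ j, ‖((t ^ w j : ℝ) : 𝕜) • v j‖ = T * V := by
      rw [hTp, ← Finset.prod_mul_distrib]
      refine Finset.prod_congr rfl fun j _ => ?_
      rw [norm_smul, RCLike.norm_ofReal, abs_of_pos (Real.rpow_pos_of_pos htpos _)]
    rw [e1, e2] at b2
    have b3 : ‖((T : ℝ) : 𝕜) • A v‖ ≤ ε * (T * V) + 2 ^ k * (ε * T) := by
      have := norm_sub_norm_le (((T : ℝ) : 𝕜) • A v)
        (iteratedDifference k f (fun j => ((t ^ w j : ℝ) : 𝕜) • v j) 0)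
      rw [norm_sub_rev] at this
      linarith
    rw [norm_smul, RCLike.norm_ofReal, abs_of_pos hT] at b3
    have : T * ‖A v‖ ≤ T * (ε * (V + 2 ^ k)) := by linarith
    exact le_of_mul_le_mul_left this hT
  have hz : ‖A v‖ ≤ 0 := by
    by_contra hcon
    push Not at hcon
    have hp : 0 < V + 2 ^ k := by positivity
    have := main (‖A v‖ / (2 * (V + 2 ^ k))) (by positivity)
    have e : ‖A v‖ / (2 * (V + 2 ^ k)) * (V + 2 ^ k) = ‖A v‖ / 2 := by field_simp
    rw [e] at this
    linarith
  simpa using hz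

end FiniteDifferences

/-! ### Comparison of powers of a small nonnegative function. -/

section PowerComparison

variable {X : Type*} {l : Filter X} {ρ : X → ℝ}

theorem isBigO_rpow_of_le (h0 : ∀ x, 0 ≤ ρ x) (hρ : Tendsto ρ l (𝓝 0)) {a b : ℝ} (ha : 0 < a)
    (hab : a ≤ b) : (fun x => ρ x ^ b) =O[l] fun x => ρ x ^ a := by
  refine IsBigO.of_bound 1 ?_
  filter_upwards [hρ.eventually (ge_mem_nhds one_pos)] with x hx
  rw [one_mul, Real.norm_of_nonneg (Real.rpow_nonneg (h0 x) _),
    Real.norm_of_nonneg (Real.rpow_nonneg (h0 x) _)]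
  rcases (h0 x).eq_or_lt with h | h
  · rw [← h, Real.zero_rpow ha.ne', Real.zero_rpow (ha.trans_le hab).ne']
  · exact Real.rpow_le_rpow_of_exponent_ge h hx hab

theorem isLittleO_rpow_of_lt (h0 : ∀ x, 0 ≤ ρ x) (hρ : Tendsto ρ l (𝓝 0)) {a b : ℝ} (ha : 0 < a)
    (hab : a < b) : (fun x => ρ x ^ b) =o[l] fun x => ρ x ^ a := by
  have e : (fun x => ρ x ^ b) = fun x => ρ x ^ (b - a) * ρ x ^ a := by
    funext x
    rcases (h0 x).eq_or_lt with h | h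
    · rw [← h, Real.zero_rpow ha.ne', Real.zero_rpow (ha.trans hab).ne', mul_zero]
    · rw [← Real.rpow_add h]; ring_nf
  rw [e]
  have h1 : (fun x => ρ x ^ (b - a)) =o[l] fun _ => (1 : ℝ) := by
    rw [isLittleO_one_iff]
    have := ((Real.continuousAt_rpow_const 0 (b - a) (Or.inr (sub_pos.2 hab).le)).tendsto).comp hρ
    rwa [Real.zero_rpow (sub_pos.2 hab).ne'] at this
  simpa using h1.mul_isBigO (isBigO_refl (fun x => ρ x ^ a) l)

theorem isBigO_prod_rpow {ι : Type*} (s : Finset ι) (h0 : ∀ x, 0 ≤ ρ x) {R : Type*}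
    [NormedField R] (f : ι → X → R) (w : ι → ℝ)
    (hw : ∀ i ∈ s, 0 ≤ w i) (h : ∀ i ∈ s, f i =O[l] fun x => ρ x ^ w i) :
    (fun x => ∏ i ∈ s, f i x) =O[l] fun x => ρ x ^ ∑ i ∈ s, w i := by
  have := IsBigO.finsetProd (g := fun i x => ρ x ^ w i) h
  refine this.congr_right fun x => ?_
  exact (Real.rpow_sum_of_nonneg (h0 x) hw).symm

end PowerComparison

/-! ### Taylor expansion with anisotropic estimates. -/

section Taylor

variable {𝕜 E F : Type*} [RCLike 𝕜] [NormedAddCommGroup E] [NormedSpace 𝕜 E]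
  [NormedAddCommGroup F] [NormedSpace 𝕜 F]

/-- `f` has a Taylor expansion at the origin, with the usual bound for the remainder of order
`M`. -/
def HasTaylorBound (𝕜 : Type*) [RCLike 𝕜] [NormedSpace 𝕜 E] [NormedSpace 𝕜 F]
    (f : E → F) (M : ℕ) : Prop :=
  (fun x => f x - ∑ m ∈ Finset.range M,
    ((m.factorial : 𝕜)⁻¹) • iteratedFDeriv 𝕜 m f 0 (fun _ => x)) =O[𝓝 0] fun x => ‖x‖ ^ M

theorem _root_.AnalyticAt.hasTaylorBound [CompleteSpace F] {f : E → F} (hf : AnalyticAt 𝕜 f 0)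
    (M : ℕ) : HasTaylorBound 𝕜 f M := by
  obtain ⟨p, r, hp⟩ := hf
  have := hp.hasFPowerSeriesAt.isBigO_sub_partialSum_pow M
  refine this.congr_left fun x => ?_
  rw [zero_add, FormalMultilinearSeries.partialSum]
  congr 1
  refine Finset.sum_congr rfl fun m _ => ?_
  rw [← hp.factorial_smul x m, ← Nat.cast_smul_eq_nsmul 𝕜, smul_smul,
    inv_mul_cancel₀ (Nat.cast_ne_zero.2 m.factorial_ne_zero), one_smul]

theorem _root_.ContDiffAt.hasTaylorBound {E F : Type*} [NormedAddCommGroup E] [NormedSpace ℝ E]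
    [NormedAddCommGroup F] [NormedSpace ℝ F] [CompleteSpace F] {f : E → F}
    (hf : ContDiffAt ℝ ∞ f 0) (n : ℕ) : HasTaylorBound ℝ f (n + 1) := by
  have hn : ContDiffAt ℝ ((n + 1 : ℕ) : WithTop ℕ∞) f 0 := hf.of_le (by exact_mod_cast le_top)
  have hc : ContinuousAt (iteratedFDeriv ℝ (n + 1) f) 0 :=
    (hn.iteratedFDeriv_right (i := n + 1) (m := 0) (by simp)).continuousAt
  have hb : ∀ᶠ y in 𝓝 (0 : E), ContDiffAt ℝ ((n + 1 : ℕ) : WithTop ℕ∞) f y ∧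
      ‖iteratedFDeriv ℝ (n + 1) f y‖ ≤ ‖iteratedFDeriv ℝ (n + 1) f 0‖ + 1 :=
    (hn.eventually (by simp)).and
      (hc.norm.tendsto.eventually (ge_mem_nhds (lt_add_one _)))
  obtain ⟨r, hr, hball⟩ := Metric.eventually_nhds_iff.1 hb
  set C := ‖iteratedFDeriv ℝ (n + 1) f 0‖ + 1
  refine IsBigO.of_bound ((n.factorial : ℝ)⁻¹ * C) ?_
  filter_upwards [Metric.ball_mem_nhds (0 : E) hr] with y hy
  have hseg : ∀ t ∈ Set.Icc (0 : ℝ) 1, dist ((0 : E) + t • y) 0 < r := fun t ht => by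
    rw [zero_add, dist_zero_right, norm_smul, Real.norm_of_nonneg ht.1]
    rw [mem_ball_zero_iff] at hy
    exact lt_of_le_of_lt (mul_le_of_le_one_left (norm_nonneg _) ht.2) hy
  have key := map_add_eq_sum_add_integral_iteratedFDeriv (f := f) (x := 0) (y := y) (n := n)
    (fun t ht => by exact_mod_cast (hball (hseg t ht)).1)
  rw [zero_add] at key
  rw [key]
  rw [add_sub_cancel_left, norm_smul, mul_assoc]
  refine mul_le_mul (by simp) ?_ (norm_nonneg _) (by positivity)
  have := intervalIntegral.norm_integral_le_of_norm_le_const (a := (0 : ℝ)) (b := 1)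
    (C := C * ‖y‖ ^ (n + 1))
    (f := fun t : ℝ => (1 - t) ^ n • iteratedFDeriv ℝ (n + 1) f (0 + t • y) (fun _ => y))
    (fun t ht => by
      rw [Set.uIoc_of_le zero_le_one] at ht
      have ht' : t ∈ Set.Icc (0 : ℝ) 1 := ⟨ht.1.le, ht.2⟩
      rw [norm_smul]
      have h1 : ‖(1 - t) ^ n‖ ≤ 1 := by
        rw [norm_pow, Real.norm_of_nonneg (by linarith [ht.2])]
        exact pow_le_one₀ (by linarith [ht.2]) (by linarith [ht.1])
      have h2 : ‖iteratedFDeriv ℝ (n + 1) f (0 + t • y) (fun _ => y)‖ ≤ C * ‖y‖ ^ (n + 1) := by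
        refine (ContinuousMultilinearMap.le_opNorm _ _).trans ?_
        simp only [Finset.prod_const, Finset.card_univ, Fintype.card_fin]
        exact mul_le_mul_of_nonneg_right (hball (hseg t ht')).2 (by positivity)
      calc _ ≤ 1 * (C * ‖y‖ ^ (n + 1)) := mul_le_mul h1 h2 (norm_nonneg _) zero_le_one
        _ = _ := one_mul _)
  simpa using this

theorem isBigO_taylor_term {X ι : Type*} {l : Filter X} {ρ : X → ℝ} (h0 : ∀ a, 0 ≤ ρ a) {m : ℕ}
    (A : ContinuousMultilinearMap 𝕜 (fun _ : Fin m => E) F) (y : ι → X → E) (w : ι → ℝ)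
    (hw : ∀ j, 0 < w j) (hy : ∀ j, y j =O[l] fun a => ρ a ^ w j) (s : Fin m → ι) :
    (fun a => A (fun i => y (s i) a)) =O[l] fun a => ρ a ^ ∑ i, w (s i) := by
  have h1 : (fun a => A (fun i => y (s i) a)) =O[l] fun a => ∏ i, ‖y (s i) a‖ := by
    refine IsBigO.of_bound ‖A‖ (Eventually.of_forall fun a => ?_)
    rw [Real.norm_of_nonneg (Finset.prod_nonneg fun _ _ => norm_nonneg _)]
    exact A.le_opNorm _
  exact h1.trans (isBigO_prod_rpow Finset.univ h0 (fun i a => ‖y (s i) a‖) (fun i => w (s i))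
    (fun i _ => (hw _).le) fun i _ => (hy (s i)).norm_left)

variable {X ι : Type*} [Fintype ι] {l : Filter X} {ρ : X → ℝ}

/-- Expanding each Taylor term multilinearly along x = Σ y_j gives terms of size ρ^(Σ w (s i)).
Those of weight below κ vanish by `hv`, and `hM` takes care of the remainder. -/
theorem isBigO_of_hasTaylorBound {f : E → F} {M : ℕ} (hf : HasTaylorBound 𝕜 f M)
    (h0 : ∀ a, 0 ≤ ρ a) (hρ : Tendsto ρ l (𝓝 0)) (x : X → E) (hx : Tendsto x l (𝓝 0))
    (y : ι → X → E) (hxy : ∀ a, x a = ∑ j, y j a) (w : ι → ℝ) (hw : ∀ j, 0 < w j)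
    (hy : ∀ j, y j =O[l] fun a => ρ a ^ w j) {κ : ℝ} (hκ : 0 < κ)
    (hM : (fun a => ‖x a‖ ^ M) =O[l] fun a => ρ a ^ κ)
    (hv : ∀ (m : ℕ) (s : Fin m → ι), ∑ i, w (s i) < κ → ∀ a,
      iteratedFDeriv 𝕜 m f 0 (fun i => y (s i) a) = 0) :
    (fun a => f (x a)) =O[l] fun a => ρ a ^ κ := by
  classical
  have h1 : (fun a => f (x a) - ∑ m ∈ Finset.range M,
      ((m.factorial : 𝕜)⁻¹) • iteratedFDeriv 𝕜 m f 0 (fun _ => x a)) =O[l] fun a => ρ a ^ κ :=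
    (hf.comp_tendsto hx).trans hM
  have h2 : (fun a => ∑ m ∈ Finset.range M,
      ((m.factorial : 𝕜)⁻¹) • iteratedFDeriv 𝕜 m f 0 (fun _ => x a)) =O[l] fun a => ρ a ^ κ := by
    refine IsBigO.fun_sum fun m _ => IsBigO.const_smul_left ?_ _
    have e : ∀ a, iteratedFDeriv 𝕜 m f 0 (fun _ => x a) =
        ∑ s : Fin m → ι, iteratedFDeriv 𝕜 m f 0 (fun i => y (s i) a) := fun a => by
      rw [show (fun _ : Fin m => x a) = fun _ => ∑ j, y j a from funext fun _ => hxy a,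
        ContinuousMultilinearMap.map_sum]
    simp_rw [e]
    refine IsBigO.fun_sum fun s _ => ?_
    by_cases hs : ∑ i, w (s i) < κ
    · simp only [hv m s hs]; exact isBigO_zero _ _
    · exact (isBigO_taylor_term h0 _ y w hw hy s).trans
        (isBigO_rpow_of_le h0 hρ hκ (not_lt.1 hs))
  simpa using h1.add h2

theorem isLittleO_of_hasTaylorBound {f : E → F} {M : ℕ} (hf : HasTaylorBound 𝕜 f M)
    (h0 : ∀ a, 0 ≤ ρ a) (hρ : Tendsto ρ l (𝓝 0)) (x : X → E) (hx : Tendsto x l (𝓝 0))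
    (y : ι → X → E) (hxy : ∀ a, x a = ∑ j, y j a) (w : ι → ℝ) (hw : ∀ j, 0 < w j)
    (hy : ∀ j, y j =O[l] fun a => ρ a ^ w j) {κ : ℝ} (hκ : 0 < κ)
    (hM : (fun a => ‖x a‖ ^ M) =o[l] fun a => ρ a ^ κ)
    (hv : ∀ (m : ℕ) (s : Fin m → ι), ∑ i, w (s i) ≤ κ → ∀ a,
      iteratedFDeriv 𝕜 m f 0 (fun i => y (s i) a) = 0) :
    (fun a => f (x a)) =o[l] fun a => ρ a ^ κ := by
  classical
  have h1 : (fun a => f (x a) - ∑ m ∈ Finset.range M,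
      ((m.factorial : 𝕜)⁻¹) • iteratedFDeriv 𝕜 m f 0 (fun _ => x a)) =o[l] fun a => ρ a ^ κ :=
    (hf.comp_tendsto hx).trans_isLittleO hM
  have h2 : (fun a => ∑ m ∈ Finset.range M,
      ((m.factorial : 𝕜)⁻¹) • iteratedFDeriv 𝕜 m f 0 (fun _ => x a)) =o[l] fun a => ρ a ^ κ := by
    refine IsLittleO.fun_sum fun m _ => IsLittleO.const_smul_left ?_ _
    have e : ∀ a, iteratedFDeriv 𝕜 m f 0 (fun _ => x a) =
        ∑ s : Fin m → ι, iteratedFDeriv 𝕜 m f 0 (fun i => y (s i) a) := fun a => by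
      rw [show (fun _ : Fin m => x a) = fun _ => ∑ j, y j a from funext fun _ => hxy a,
        ContinuousMultilinearMap.map_sum]
    simp_rw [e]
    refine IsLittleO.fun_sum fun s _ => ?_
    by_cases hs : ∑ i, w (s i) ≤ κ
    · simp only [hv m s hs]; exact isLittleO_zero _ _
    · exact (isBigO_taylor_term h0 _ y w hw hy s).trans_isLittleO
        (isLittleO_rpow_of_lt h0 hρ hκ (not_le.1 hs))
  simpa using h1.add h2

end Taylor

/-! ### The weighted gauge and its dilations. -/

section Gauge

variable {n : ℕ}

/-- The `μ`-homogeneous wgauge on the `z`-space. -/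
noncomputable def zgauge (μ : Fin n → ℝ) (z : Fin n → ℂ) : ℝ := ∑ i, ‖z i‖ ^ (μ i)⁻¹

/-- The `μ`-homogeneous wgauge when the last variable has weight one. -/
noncomputable def wgauge (μ : Fin n → ℝ) {K : Type*} [NormedAddCommGroup K]
    (x : (Fin n → ℂ) × K) : ℝ := ‖x.2‖ + zgauge μ x.1

/-- The anisotropic dilation with weights `μ`. -/
noncomputable def dil (μ : Fin n → ℝ) (t : ℝ) (z : Fin n → ℂ) : Fin n → ℂ :=
  fun i => ((t ^ μ i : ℝ) : ℂ) * z i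

variable {μ : Fin n → ℝ} {K : Type*} [NormedAddCommGroup K]

theorem zgauge_nonneg (z : Fin n → ℂ) : 0 ≤ zgauge μ z :=
  Finset.sum_nonneg fun _ _ => Real.rpow_nonneg (norm_nonneg _) _

theorem gauge_nonneg (x : (Fin n → ℂ) × K) : 0 ≤ wgauge μ x :=
  add_nonneg (norm_nonneg _) (zgauge_nonneg _)

theorem zgauge_le_gauge (x : (Fin n → ℂ) × K) : zgauge μ x.1 ≤ wgauge μ x :=
  le_add_of_nonneg_left (norm_nonneg _)

theorem norm_snd_le_gauge (x : (Fin n → ℂ) × K) : ‖x.2‖ ≤ wgauge μ x :=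
  le_add_of_nonneg_right (zgauge_nonneg _)

theorem gauge_zero_right (z : Fin n → ℂ) : wgauge μ (z, (0 : K)) = zgauge μ z := by
  simp [wgauge]

theorem norm_le_zgauge_rpow (hμ : ∀ i, 0 < μ i) (z : Fin n → ℂ) (i : Fin n) :
    ‖z i‖ ≤ zgauge μ z ^ μ i := by
  have h : ‖z i‖ ^ (μ i)⁻¹ ≤ zgauge μ z :=
    Finset.single_le_sum (f := fun i => ‖z i‖ ^ (μ i)⁻¹)
      (fun _ _ => Real.rpow_nonneg (norm_nonneg _) _) (Finset.mem_univ i)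
  have := Real.rpow_le_rpow (Real.rpow_nonneg (norm_nonneg _) _) h (hμ i).le
  rwa [← Real.rpow_mul (norm_nonneg _), inv_mul_cancel₀ (hμ i).ne', Real.rpow_one] at this

theorem norm_le_gauge_rpow (hμ : ∀ i, 0 < μ i) (x : (Fin n → ℂ) × K) (i : Fin n) :
    ‖x.1 i‖ ≤ wgauge μ x ^ μ i :=
  (norm_le_zgauge_rpow hμ x.1 i).trans
    (Real.rpow_le_rpow (zgauge_nonneg _) (zgauge_le_gauge x) (hμ i).le)

theorem continuous_zgauge (hμ : ∀ i, 0 < μ i) : Continuous (zgauge μ) :=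
  continuous_finsetSum _ fun i _ => Continuous.rpow_const (by fun_prop)
    fun _ => Or.inr (inv_nonneg.2 (hμ i).le)

theorem continuous_gauge (hμ : ∀ i, 0 < μ i) :
    Continuous (wgauge μ : (Fin n → ℂ) × K → ℝ) :=
  continuous_snd.norm.add ((continuous_zgauge hμ).comp continuous_fst)

theorem zgauge_zero (hμ : ∀ i, 0 < μ i) : zgauge μ 0 = 0 := by
  simp only [zgauge, Pi.zero_apply, norm_zero]
  exact Finset.sum_eq_zero fun i _ => Real.zero_rpow (inv_ne_zero (hμ i).ne')

theorem tendsto_zgauge (hμ : ∀ i, 0 < μ i) : Tendsto (zgauge μ) (𝓝 0) (𝓝 0) := by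
  have := (continuous_zgauge hμ).tendsto 0
  rwa [zgauge_zero hμ] at this

theorem tendsto_gauge (hμ : ∀ i, 0 < μ i) :
    Tendsto (wgauge μ : (Fin n → ℂ) × K → ℝ) (𝓝 0) (𝓝 0) := by
  have := (continuous_gauge hμ (K := K)).tendsto 0
  rwa [show wgauge μ (0 : (Fin n → ℂ) × K) = 0 by simp [wgauge, zgauge_zero hμ]] at this

theorem zgauge_dil (hμ : ∀ i, 0 < μ i) {t : ℝ} (ht : 0 ≤ t) (z : Fin n → ℂ) :
    zgauge μ (dil μ t z) = t * zgauge μ z := by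
  rw [zgauge, zgauge, Finset.mul_sum]
  refine Finset.sum_congr rfl fun i _ => ?_
  have h := Real.rpow_nonneg ht (μ i)
  rw [dil, norm_mul, Complex.norm_real, Real.norm_of_nonneg h,
    Real.mul_rpow h (norm_nonneg _), ← Real.rpow_mul ht, mul_inv_cancel₀ (hμ i).ne', Real.rpow_one]

theorem tendsto_dil (hμ : ∀ i, 0 < μ i) (z : Fin n → ℂ) :
    Tendsto (fun t => dil μ t z) (𝓝[>] 0) (𝓝 0) := by
  rw [tendsto_pi_nhds]
  intro i
  have h : Tendsto (fun t : ℝ => t ^ μ i) (𝓝[>] 0) (𝓝 0) := by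
    have := (Real.continuousAt_rpow_const 0 (μ i) (Or.inr (hμ i).le)).tendsto
    rw [Real.zero_rpow (hμ i).ne'] at this
    exact this.mono_left nhdsWithin_le_nhds
  have := ((Complex.continuous_ofReal.tendsto 0).comp h).mul_const (z i)
  simpa [dil] using this

variable {X : Type*} {l : Filter X} {ρ : X → ℝ}

theorem isBigO_zgauge (hμ : ∀ i, 0 < μ i) (h0 : ∀ a, 0 ≤ ρ a) {y : X → Fin n → ℂ}
    (hy : ∀ i, (fun a => y a i) =O[l] fun a => ρ a ^ μ i) :
    (fun a => zgauge μ (y a)) =O[l] ρ := by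
  refine IsBigO.fun_sum fun i _ => ?_
  have := (hy i).norm_left.rpow (inv_nonneg.2 (hμ i).le)
    (Eventually.of_forall fun a => Real.rpow_nonneg (h0 a) _)
  refine this.congr_right fun a => ?_
  rw [← Real.rpow_mul (h0 a), mul_inv_cancel₀ (hμ i).ne', Real.rpow_one]

theorem isBigO_gauge (hμ : ∀ i, 0 < μ i) (h0 : ∀ a, 0 ≤ ρ a) {y : X → (Fin n → ℂ) × K}
    (hy : ∀ i, (fun a => (y a).1 i) =O[l] fun a => ρ a ^ μ i)
    (hy2 : (fun a => (y a).2) =O[l] ρ) :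
    (fun a => wgauge μ (y a)) =O[l] ρ :=
  hy2.norm_left.add (isBigO_zgauge hμ h0 hy)

theorem isBigO_norm_pow (h0 : ∀ a, 0 ≤ ρ a) (hρ : Tendsto ρ l (𝓝 0)) {E : Type*}
    [NormedAddCommGroup E] {x : X → E} {m : ℝ}
    (hx : x =O[l] fun a => ρ a ^ m) (M : ℕ) {κ : ℝ} (hκ : 0 < κ) (hM : κ ≤ m * M) :
    (fun a => ‖x a‖ ^ M) =O[l] fun a => ρ a ^ κ := by
  have := (hx.norm_left.pow M).congr_right (g₂ := fun a => ρ a ^ (m * M)) fun a => by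
    rw [Real.rpow_mul (h0 a), Real.rpow_natCast]
  exact this.trans (isBigO_rpow_of_le h0 hρ hκ hM)

theorem isLittleO_norm_pow (h0 : ∀ a, 0 ≤ ρ a) (hρ : Tendsto ρ l (𝓝 0)) {E : Type*}
    [NormedAddCommGroup E] {x : X → E} {m : ℝ}
    (hx : x =O[l] fun a => ρ a ^ m) (M : ℕ) {κ : ℝ} (hκ : 0 < κ) (hM : κ < m * M) :
    (fun a => ‖x a‖ ^ M) =o[l] fun a => ρ a ^ κ :=
  (isBigO_norm_pow h0 hρ hx M (hκ.trans hM) le_rfl).trans_isLittleO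
    (isLittleO_rpow_of_lt h0 hρ hκ hM)

theorem isBigO_zvec (h0 : ∀ a, 0 ≤ ρ a) (hρ : Tendsto ρ l (𝓝 0)) {m : ℝ} (hm : 0 < m)
    (hmμ : ∀ i, m ≤ μ i) {y : X → Fin n → ℂ}
    (hy : ∀ i, (fun a => y a i) =O[l] fun a => ρ a ^ μ i) :
    y =O[l] fun a => ρ a ^ m :=
  isBigO_pi.2 fun i => (hy i).trans (isBigO_rpow_of_le h0 hρ hm (hmμ i))

theorem isBigO_vec (h0 : ∀ a, 0 ≤ ρ a) (hρ : Tendsto ρ l (𝓝 0)) {m : ℝ} (hm : 0 < m)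
    (hmμ : ∀ i, m ≤ μ i) (hm1 : m ≤ 1) {y : X → (Fin n → ℂ) × K}
    (hy : ∀ i, (fun a => (y a).1 i) =O[l] fun a => ρ a ^ μ i)
    (hy2 : (fun a => (y a).2) =O[l] ρ) :
    y =O[l] fun a => ρ a ^ m := by
  have h1 := isBigO_zvec h0 hρ hm hmμ hy
  have h2 : (fun a => (y a).2) =O[l] fun a => ρ a ^ m :=
    (hy2.congr_right fun a => (Real.rpow_one _).symm).trans (isBigO_rpow_of_le h0 hρ hm hm1)
  have := h1.prod_left h2
  exact this

/-- With such an m the norm is O(gauge^m), so a Taylor remainder of order M > κ / m is negligible at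
weight κ. -/
theorem exists_weight_bound (hμ : ∀ i, 0 < μ i) : ∃ m : ℝ, 0 < m ∧ m ≤ 1 ∧ ∀ i, m ≤ μ i := by
  obtain ⟨m, hm, h⟩ : ∃ m : ℝ, 0 < m ∧ ∀ i, m ≤ μ i := by
    rcases isEmpty_or_nonempty (Fin n) with h | h
    · exact ⟨1, one_pos, fun i => h.elim i⟩
    · obtain ⟨i, hi⟩ := Finite.exists_min μ
      exact ⟨μ i, hμ i, hi⟩
  exact ⟨min m 1, lt_min hm one_pos, min_le_right _ _, fun i => (min_le_left _ _).trans (h i)⟩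

/-- Weights of the variables `(z, w)` as real numbers. -/
noncomputable def realWeight (μ : Fin n → ℝ) : Option (Fin n) → ℝ
  | some i => μ i
  | none => 1

theorem realWeight_pos (hμ : ∀ i, 0 < μ i) : ∀ j, 0 < realWeight μ j
  | some i => hμ i
  | none => one_pos

theorem realWeight_cast (Λ : Fin n → ℚ) (j : Option (Fin n)) :
    realWeight (fun i => (Λ i : ℝ)) j = (varWeight Λ j : ℝ) := by
  cases j <;> simp [realWeight, varWeight]

theorem gauge_sum_smul [NormedSpace ℝ K] (hμ : ∀ i, 0 < μ i) {k : ℕ}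
    (v : Fin k → (Fin n → ℂ) × K) (s : Fin k → Option (Fin n))
    (h1 : ∀ j i, s j ≠ some i → (v j).1 i = 0) (h2 : ∀ j, s j ≠ none → (v j).2 = 0)
    (S : Finset (Fin k)) {t : ℝ} (ht : 0 ≤ t) :
    wgauge μ (∑ j ∈ S, (t ^ realWeight μ (s j)) • v j) = t * wgauge μ (∑ j ∈ S, v j) := by
  have e1 : (∑ j ∈ S, (t ^ realWeight μ (s j)) • v j).1 = dil μ t (∑ j ∈ S, v j).1 := by
    funext i
    simp only [Prod.fst_sum, Finset.sum_apply, dil, Finset.mul_sum, Prod.smul_fst, Pi.smul_apply]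
    refine Finset.sum_congr rfl fun j _ => ?_
    by_cases h : s j = some i
    · rw [h]; simp [realWeight]
    · rw [h1 j i h]; simp
  have e2 : (∑ j ∈ S, (t ^ realWeight μ (s j)) • v j).2 = t • (∑ j ∈ S, v j).2 := by
    simp only [Prod.snd_sum, Finset.smul_sum, Prod.smul_snd]
    refine Finset.sum_congr rfl fun j _ => ?_
    by_cases h : s j = none
    · rw [h]; simp [realWeight]
    · rw [h2 j h]; simp
  rw [wgauge, e1, e2, zgauge_dil hμ ht, norm_smul, Real.norm_of_nonneg ht, wgauge]
  ring

theorem tendsto_sum_rpow_smul {E : Type*} [NormedAddCommGroup E] [NormedSpace ℝ E] {k : ℕ}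
    (v : Fin k → E) (w : Fin k → ℝ) (hw : ∀ j, 0 < w j) (S : Finset (Fin k)) :
    Tendsto (fun t : ℝ => ∑ j ∈ S, (t ^ w j) • v j) (𝓝[>] 0) (𝓝 0) := by
  have : Tendsto (fun t : ℝ => ∑ j ∈ S, (t ^ w j) • v j) (𝓝[>] 0) (𝓝 (∑ j ∈ S, (0 : ℝ) • v j)) := by
    refine tendsto_finsetSum _ fun j _ => Tendsto.smul_const ?_ _
    have := (Real.continuousAt_rpow_const 0 (w j) (Or.inr (hw j).le)).tendsto
    rw [Real.zero_rpow (hw j).ne'] at this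
    exact this.mono_left nhdsWithin_le_nhds
  simpa using this

theorem isBigO_rpow_nhdsGT {a b : ℝ} (hab : a ≤ b) :
    (fun t : ℝ => t ^ b) =O[𝓝[>] 0] fun t => t ^ a := by
  refine IsBigO.of_bound 1 ?_
  filter_upwards [Ioc_mem_nhdsGT one_pos] with t ht
  rw [one_mul, Real.norm_of_nonneg (Real.rpow_nonneg ht.1.le _),
    Real.norm_of_nonneg (Real.rpow_nonneg ht.1.le _)]
  exact Real.rpow_le_rpow_of_exponent_ge ht.1 ht.2 hab

theorem isLittleO_rpow_nhdsGT {a b : ℝ} (hab : a < b) :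
    (fun t : ℝ => t ^ b) =o[𝓝[>] 0] fun t => t ^ a := by
  have h1 : (fun t : ℝ => t ^ (b - a)) =o[𝓝[>] 0] fun _ => (1 : ℝ) := by
    rw [isLittleO_one_iff]
    have := (Real.continuousAt_rpow_const 0 (b - a) (Or.inr (sub_pos.2 hab).le)).tendsto
    rw [Real.zero_rpow (sub_pos.2 hab).ne'] at this
    exact this.mono_left nhdsWithin_le_nhds
  refine (h1.mul_isBigO (isBigO_refl (fun t : ℝ => t ^ a) _)).congr' ?_ ?_
  · filter_upwards [self_mem_nhdsWithin] with t ht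
    rw [← Real.rpow_add ht]; ring_nf
  · exact Eventually.of_forall fun t => one_mul _

end Gauge

/-! ### Translation between weighted derivatives and growth against the gauge. -/

section Interface

variable {n : ℕ} {Λ : Fin n → ℚ}

/-- Together with its converse below, this replaces a condition on individual derivatives by a
growth condition, which behaves well under composition. -/
theorem isLittleO_gauge_of_isLittleO (hΛ : ∀ i, 0 < Λ i) {R : (Fin n → ℂ) × ℝ → ℂ}
    (hR : ContDiffAt ℝ ∞ R 0) (h : IsLittleO Λ R) :
    R =o[𝓝 0] (wgauge fun i => (Λ i : ℝ)) := by
  set μ : Fin n → ℝ := fun i => (Λ i : ℝ)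
  have hμ : ∀ i, 0 < μ i := fun i => Rat.cast_pos.2 (hΛ i)
  obtain ⟨m, hm, hm1, hmμ⟩ := exists_weight_bound hμ
  obtain ⟨M, hM⟩ := exists_nat_gt (1 / m)
  have hM' : (1 : ℝ) < m * (M + 1 : ℕ) := by
    rw [div_lt_iff₀ hm] at hM; push_cast; nlinarith
  have hc : ∀ i, (fun a : (Fin n → ℂ) × ℝ => a.1 i) =O[𝓝 0] fun a => wgauge μ a ^ μ i := fun i =>
    IsBigO.of_norm_le fun a => norm_le_gauge_rpow hμ a i
  have hc2 : (fun a : (Fin n → ℂ) × ℝ => a.2) =O[𝓝 0] fun a => wgauge μ a :=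
    IsBigO.of_norm_le fun a => norm_snd_le_gauge a
  have := isLittleO_of_hasTaylorBound (ι := Option (Fin n)) (ρ := wgauge μ) (l := 𝓝 0)
    (hR.hasTaylorBound M)
    gauge_nonneg (tendsto_gauge hμ) (fun a => a) tendsto_id
    -- One summand per variable is enough, because the vanishing hypothesis covers every complex
    -- direction in a coordinate plane.
    (fun j a => rdir (j, match j with | some i => a.1 i | none => (a.2 : ℂ)))
    (fun a => by
      rw [Fintype.sum_option]
      ext i
      · simp [rdir, Prod.fst_sum, Finset.univ_sum_single]
      · simp [rdir, Prod.snd_sum])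
    (realWeight μ) (realWeight_pos hμ)
    (by
      rintro (_ | i)
      · simp only [realWeight, Real.rpow_one]
        refine (IsBigO.of_norm_le fun a => ?_ : _ =O[_] fun a : (Fin n → ℂ) × ℝ => ‖a.2‖).trans hc2.norm_left
        simp [rdir]
      · refine (IsBigO.of_norm_le fun a => ?_ :
          _ =O[_] fun a : (Fin n → ℂ) × ℝ => ‖a.1 i‖).trans (hc i).norm_left
        simp [rdir, Prod.norm_def, Pi.norm_single])
    one_pos (isLittleO_norm_pow gauge_nonneg (tendsto_gauge hμ)
      (isBigO_vec gauge_nonneg (tendsto_gauge hμ) hm hmμ hm1 hc hc2) _ one_pos hM')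
    (fun k s hs a => h k (fun i => (s i, _)) (by
      have : ((∑ j, varWeight Λ (s j) : ℚ) : ℝ) ≤ 1 := by
        push_cast
        simpa only [realWeight_cast, μ] using hs
      exact_mod_cast this))
  simpa using this

/-- R is tested on sums of the vectors t^(weight) `rdir (s j)`, on which the gauge is a constant
multiple of t; finite differences then give the derivative. -/
theorem isLittleO_of_isLittleO_gauge (hΛ : ∀ i, 0 < Λ i) {R : (Fin n → ℂ) × ℝ → ℂ}
    (hR : ContDiffAt ℝ ∞ R 0) (h : R =o[𝓝 0] (wgauge fun i => (Λ i : ℝ))) :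
    IsLittleO Λ R := by
  set μ : Fin n → ℝ := fun i => (Λ i : ℝ)
  have hμ : ∀ i, 0 < μ i := fun i => Rat.cast_pos.2 (hΛ i)
  intro k s hs
  have hs' : ∑ j, realWeight μ (s j).1 ≤ 1 := by
    have : ((∑ j, varWeight Λ (s j).1 : ℚ) : ℝ) ≤ 1 := by exact_mod_cast hs
    push_cast at this
    simpa only [realWeight_cast, μ] using this
  refine iteratedFDeriv_eq_zero_of_isLittleO (hR.of_le (by exact_mod_cast le_top)) _
    (fun j => realWeight μ (s j).1) (fun j => realWeight_pos hμ _) fun S => ?_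
  have ht := tendsto_sum_rpow_smul (fun j => rdir (s j)) (fun j => realWeight μ (s j).1)
    (fun j => realWeight_pos hμ _) S
  have h1 := h.comp_tendsto ht
  have h2 : (fun t : ℝ => wgauge μ (∑ j ∈ S, (t ^ realWeight μ (s j).1) • rdir (s j)))
      =O[𝓝[>] 0] fun t => t ^ (1 : ℝ) := by
    refine IsBigO.of_bound (wgauge μ (∑ j ∈ S, rdir (s j))) ?_
    filter_upwards [self_mem_nhdsWithin] with t ht
    rw [gauge_sum_smul hμ (fun j => rdir (s j)) (fun j => (s j).1) ?_ ?_ S (le_of_lt ht),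
      Real.rpow_one, norm_mul, Real.norm_of_nonneg (gauge_nonneg _), mul_comm]
    · intro j i hj
      rcases hsj : s j with ⟨_ | i', c⟩
      · simp [rdir]
      · rw [hsj] at hj
        have : i ≠ i' := fun h => hj (by rw [h])
        simp [rdir, this]
    · intro j hj
      rcases hsj : s j with ⟨_ | i', c⟩
      · rw [hsj] at hj; simp at hj
      · simp [rdir]
  simpa [Function.comp_def] using (h1.trans_isBigO h2).trans_isBigO (isBigO_rpow_nhdsGT hs')

theorem isBigO_gauge_of_weightedOrderGE (hΛ : ∀ i, 0 < Λ i) {f : Space n → ℂ}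
    (hf : AnalyticAt ℂ f 0) {κ : ℚ} (hκ : 0 < κ) (h : WeightedOrderGE Λ κ f) :
    f =O[𝓝 0] fun x => wgauge (fun i => (Λ i : ℝ)) x ^ (κ : ℝ) := by
  set μ : Fin n → ℝ := fun i => (Λ i : ℝ)
  have hμ : ∀ i, 0 < μ i := fun i => Rat.cast_pos.2 (hΛ i)
  obtain ⟨m, hm, hm1, hmμ⟩ := exists_weight_bound hμ
  obtain ⟨M, hM⟩ := exists_nat_gt ((κ : ℝ) / m)
  have hM' : (κ : ℝ) ≤ m * M := by
    rw [div_lt_iff₀ hm] at hM; linarith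
  have hκ' : (0 : ℝ) < κ := by exact_mod_cast hκ
  have hc : ∀ i, (fun a : Space n => a.1 i) =O[𝓝 0] fun a => wgauge μ a ^ μ i := fun i =>
    IsBigO.of_norm_le fun a => norm_le_gauge_rpow hμ a i
  have hc2 : (fun a : Space n => a.2) =O[𝓝 0] fun a => wgauge μ a :=
    IsBigO.of_norm_le fun a => norm_snd_le_gauge a
  exact isBigO_of_hasTaylorBound (ι := Option (Fin n)) (ρ := wgauge μ) (l := 𝓝 0)
    (hf.hasTaylorBound M)
    gauge_nonneg (tendsto_gauge hμ) (fun a => a) tendsto_id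
    (fun j a => (match j with | some i => a.1 i | none => a.2 : ℂ) • cdir j)
    (fun a => by
      rw [Fintype.sum_option]
      ext i
      · simp [cdir, Prod.fst_sum, Finset.sum_apply, Pi.single_apply]
      · simp [cdir, Prod.snd_sum])
    (realWeight μ) (realWeight_pos hμ)
    (by
      rintro (_ | i)
      · simp only [realWeight, Real.rpow_one]
        refine (IsBigO.of_norm_le fun a => ?_ : _ =O[_] fun a : Space n => ‖a.2‖).trans
          hc2.norm_left
        simp [cdir]
      · refine (IsBigO.of_norm_le fun a => ?_ :
          _ =O[_] fun a : Space n => ‖a.1 i‖).trans (hc i).norm_left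
        simp [cdir, norm_smul, Prod.norm_def, Pi.norm_single])
    hκ' (isBigO_norm_pow gauge_nonneg (tendsto_gauge hμ)
      (isBigO_vec gauge_nonneg (tendsto_gauge hμ) hm hmμ hm1 hc hc2) _ hκ' hM')
    (fun k s hs a => by
      rw [ContinuousMultilinearMap.map_smul_univ, h k s, smul_zero]
      have : ((∑ j, varWeight Λ (s j) : ℚ) : ℝ) < κ := by
        push_cast
        simpa only [realWeight_cast, μ] using hs
      exact_mod_cast this)

theorem gauge_sum_smul_cdir {μ : Fin n → ℝ} (hμ : ∀ i, 0 < μ i) {k : ℕ}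
    (s : Fin k → Option (Fin n)) (S : Finset (Fin k)) {t : ℝ} (ht : 0 ≤ t) :
    wgauge μ (∑ j ∈ S, (t ^ realWeight μ (s j)) • (cdir (s j) : Space n)) =
      t * wgauge μ (∑ j ∈ S, (cdir (s j) : Space n)) := by
  refine gauge_sum_smul hμ (fun j => cdir (s j)) s ?_ ?_ S ht
  · intro j i hj
    rcases hsj : s j with _ | i'
    · simp [cdir]
    · rw [hsj] at hj
      have : i ≠ i' := fun h => hj (by rw [h])
      simp [cdir, this]
  · intro j hj
    rcases hsj : s j with _ | i'
    · rw [hsj] at hj; simp at hj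
    · simp [cdir]

theorem weightedOrderGE_of_isBigO_gauge (hΛ : ∀ i, 0 < Λ i) {f : Space n → ℂ}
    (hf : AnalyticAt ℂ f 0) {κ : ℚ} (hκ : 0 < κ)
    (h : f =O[𝓝 0] fun x => wgauge (fun i => (Λ i : ℝ)) x ^ (κ : ℝ)) : WeightedOrderGE Λ κ f := by
  set μ : Fin n → ℝ := fun i => (Λ i : ℝ)
  have hμ : ∀ i, 0 < μ i := fun i => Rat.cast_pos.2 (hΛ i)
  intro k s hs
  have hs' : ∑ j, realWeight μ (s j) < κ := by
    have : ((∑ j, varWeight Λ (s j) : ℚ) : ℝ) < κ := by exact_mod_cast hs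
    push_cast at this
    simpa only [realWeight_cast, μ] using this
  have hκ' : (0 : ℝ) < κ := by exact_mod_cast hκ
  refine iteratedFDeriv_eq_zero_of_isLittleO (hf.contDiffAt) _
    (fun j => realWeight μ (s j)) (fun j => realWeight_pos hμ _) fun S => ?_
  have ht := tendsto_sum_rpow_smul (fun j => (cdir (s j) : Space n)) (fun j => realWeight μ (s j))
    (fun j => realWeight_pos hμ _) S
  have h1 := h.comp_tendsto ht
  have h2 : (fun t : ℝ => wgauge μ (∑ j ∈ S, (t ^ realWeight μ (s j)) • (cdir (s j) : Space n))
      ^ (κ : ℝ)) =O[𝓝[>] 0] fun t => t ^ (κ : ℝ) := by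
    refine IsBigO.of_bound (wgauge μ (∑ j ∈ S, (cdir (s j) : Space n)) ^ (κ : ℝ)) ?_
    filter_upwards [self_mem_nhdsWithin] with t ht
    have ht' : (0 : ℝ) < t := ht
    rw [gauge_sum_smul_cdir hμ s S ht'.le, Real.mul_rpow ht'.le (gauge_nonneg _), norm_mul,
      Real.norm_of_nonneg (Real.rpow_nonneg (gauge_nonneg _) _), mul_comm]
  have h3 := (h1.trans h2).trans_isLittleO (isLittleO_rpow_nhdsGT hs')
  simpa [Function.comp_def] using h3

/-- On w = 0 only the terms in z survive; `h` removes those of weight below one and `h1` those of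
weight one. -/
theorem isLittleO_zgauge_of_noHolomorphicTerms (hΛ : ∀ i, 0 < Λ i) {f : Space n → ℂ}
    (hf : AnalyticAt ℂ f 0) (h : WeightedOrderGE Λ 1 f)
    (h1 : ∀ (k : ℕ) (s : Fin k → Fin n), ∑ j, Λ (s j) = 1 →
      iteratedFDeriv ℂ k f 0 (fun j => cdir (some (s j))) = 0) :
    (fun z => f (z, 0)) =o[𝓝 0] zgauge fun i => (Λ i : ℝ) := by
  set μ : Fin n → ℝ := fun i => (Λ i : ℝ)
  have hμ : ∀ i, 0 < μ i := fun i => Rat.cast_pos.2 (hΛ i)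
  obtain ⟨m, hm, hm1, hmμ⟩ := exists_weight_bound hμ
  obtain ⟨M, hM⟩ := exists_nat_gt (1 / m)
  have hM' : (1 : ℝ) < m * M := by
    rw [div_lt_iff₀ hm] at hM; linarith
  have hc : ∀ i, (fun a : Fin n → ℂ => a i) =O[𝓝 0] fun a => zgauge μ a ^ μ i := fun i =>
    IsBigO.of_norm_le fun a => norm_le_zgauge_rpow hμ a i
  have := isLittleO_of_hasTaylorBound (ι := Fin n) (ρ := zgauge μ) (l := 𝓝 0)
    (hf.hasTaylorBound M)
    zgauge_nonneg (tendsto_zgauge hμ) (fun a => (a, 0))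
    ((Continuous.prodMk_left (0 : ℂ)).tendsto' 0 0 rfl)
    (fun j a => (a j) • cdir (some j))
    (fun a => by
      ext i
      · simp [cdir, Prod.fst_sum, Finset.sum_apply, Pi.single_apply]
      · simp [cdir, Prod.snd_sum])
    μ hμ
    (fun i => by
      refine (IsBigO.of_norm_le fun a => ?_ :
          _ =O[_] fun a : Fin n → ℂ => ‖a i‖).trans (hc i).norm_left
      simp [cdir, norm_smul, Prod.norm_def, Pi.norm_single])
    one_pos (isLittleO_norm_pow zgauge_nonneg (tendsto_zgauge hμ)
      (isBigO_vec (K := ℂ) (y := fun a => (a, 0)) zgauge_nonneg (tendsto_zgauge hμ) hm hmμ hm1 hc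
        (isBigO_zero _ _)) _ one_pos hM')
    (fun k s hs a => by
      rw [ContinuousMultilinearMap.map_smul_univ]
      have hs' : ∑ j, Λ (s j) ≤ 1 := by
        have : ((∑ j, Λ (s j) : ℚ) : ℝ) ≤ 1 := by push_cast; exact hs
        exact_mod_cast this
      rcases hs'.lt_or_eq with h' | h'
      · rw [h k (fun j => some (s j)) h', smul_zero]
      · rw [h1 k s h', smul_zero])
  simpa using this

theorem noHolomorphicTerms_of_isLittleO_zgauge (hΛ : ∀ i, 0 < Λ i) {f : Space n → ℂ}
    (hf : AnalyticAt ℂ f 0) (h : (fun z => f (z, 0)) =o[𝓝 0] zgauge fun i => (Λ i : ℝ))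
    (k : ℕ) (s : Fin k → Fin n) (hs : ∑ j, Λ (s j) = 1) :
    iteratedFDeriv ℂ k f 0 (fun j => cdir (some (s j))) = 0 := by
  set μ : Fin n → ℝ := fun i => (Λ i : ℝ)
  have hμ : ∀ i, 0 < μ i := fun i => Rat.cast_pos.2 (hΛ i)
  have hs' : ∑ j, μ (s j) = 1 := by
    have : ((∑ j, Λ (s j) : ℚ) : ℝ) = 1 := by exact_mod_cast hs
    push_cast at this; exact this
  refine iteratedFDeriv_eq_zero_of_isLittleO (hf.contDiffAt) _
    (fun j => μ (s j)) (fun j => hμ _) fun S => ?_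
  have e : ∀ t : ℝ, (∑ j ∈ S, (t ^ μ (s j)) • (cdir (some (s j)) : Space n)) =
      ((∑ j ∈ S, (t ^ μ (s j)) • (cdir (some (s j)) : Space n)).1, 0) := fun t => by
    ext i
    · rfl
    · simp [cdir, Prod.snd_sum]
  have ht := tendsto_sum_rpow_smul (fun j => (cdir (some (s j)) : Space n)) (fun j => μ (s j))
    (fun j => hμ _) S
  have h1 := h.comp_tendsto ((continuous_fst.tendsto (0 : Space n)).comp ht)
  have h2 : (fun t : ℝ => zgauge μ (∑ j ∈ S, (t ^ μ (s j)) • (cdir (some (s j)) : Space n)).1)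
      =O[𝓝[>] 0] fun t => t ^ (1 : ℝ) := by
    refine IsBigO.of_bound (wgauge μ (∑ j ∈ S, (cdir (some (s j)) : Space n))) ?_
    filter_upwards [self_mem_nhdsWithin] with t ht
    have ht' : (0 : ℝ) < t := ht
    have := gauge_sum_smul_cdir hμ (fun j => some (s j)) S ht'.le
    simp only [realWeight] at this
    rw [← gauge_zero_right (K := ℂ), ← e, this, norm_mul, Real.norm_of_nonneg (gauge_nonneg _),
      mul_comm, Real.rpow_one]
  have h3 := h1.trans_isBigO h2
  rw [hs']
  refine h3.congr_left fun t => ?_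
  simp only [Function.comp_apply]
  rw [← e]
  simp

end Interface

open MvPolynomial

/-! ### Growth of weighted homogeneous polynomials. -/

section Growth

variable {σ X : Type*} [Fintype σ] {l : Filter X} {ρ : X → ℝ} {w : σ → ℝ}

theorem weight_eq_sum_mul (w : σ → ℝ) (d : σ →₀ ℕ) :
    Finsupp.weight w d = ∑ i, (d i : ℝ) * w i := by
  rw [Finsupp.weight_eq_sum]; simp

theorem isBigO_prod_pow (h0 : ∀ a, 0 ≤ ρ a) (hw : ∀ j, 0 ≤ w j) {y : X → σ → ℂ}
    (hy : ∀ j, (fun a => y a j) =O[l] fun a => ρ a ^ w j) (d : σ →₀ ℕ) :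
    (fun a => ∏ i, y a i ^ d i) =O[l] fun a => ρ a ^ Finsupp.weight w d := by
  rw [weight_eq_sum_mul]
  refine isBigO_prod_rpow Finset.univ h0 (fun i a => y a i ^ d i) (fun i => (d i : ℝ) * w i)
    (fun i _ => mul_nonneg (Nat.cast_nonneg _) (hw i)) fun i _ => ?_
  refine ((hy i).pow (d i)).congr_right fun a => ?_
  rw [mul_comm, Real.rpow_mul (h0 a), Real.rpow_natCast]

theorem isBigO_eval (h0 : ∀ a, 0 ≤ ρ a) (hρ : Tendsto ρ l (𝓝 0)) (hw : ∀ j, 0 ≤ w j)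
    {y : X → σ → ℂ} (hy : ∀ j, (fun a => y a j) =O[l] fun a => ρ a ^ w j)
    (p : MvPolynomial σ ℂ) {κ : ℝ} (hκ : 0 < κ) (hp : ∀ d ∈ p.support, κ ≤ Finsupp.weight w d) :
    (fun a => eval (y a) p) =O[l] fun a => ρ a ^ κ := by
  simp_rw [eval_eq']
  exact IsBigO.fun_sum fun d hd => (((isBigO_prod_pow h0 hw hy d).trans
    (isBigO_rpow_of_le h0 hρ hκ (hp d hd))).const_mul_left _)

theorem isLittleO_eval (h0 : ∀ a, 0 ≤ ρ a) (hρ : Tendsto ρ l (𝓝 0)) (hw : ∀ j, 0 ≤ w j)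
    {y : X → σ → ℂ} (hy : ∀ j, (fun a => y a j) =O[l] fun a => ρ a ^ w j)
    (p : MvPolynomial σ ℂ) {κ : ℝ} (hκ : 0 < κ) (hp : ∀ d ∈ p.support, κ < Finsupp.weight w d) :
    (fun a => eval (y a) p) =o[l] fun a => ρ a ^ κ := by
  simp_rw [eval_eq']
  exact IsLittleO.fun_sum fun d hd => (((isBigO_prod_pow h0 hw hy d).trans_isLittleO
    (isLittleO_rpow_of_lt h0 hρ hκ (hp d hd))).const_mul_left _)

theorem isLittleO_mul_sub_mul {f f' g g' : X → ℂ} {A B : X → ℝ} (hf : f =O[l] A) (hg : g =O[l] B)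
    (hf' : (fun a => f a - f' a) =o[l] A) (hg' : (fun a => g a - g' a) =o[l] B) :
    (fun a => f a * g a - f' a * g' a) =o[l] fun a => A a * B a := by
  have hf2 : f' =O[l] A := (hf.sub hf'.isBigO).congr_left fun a => by simp
  have := (hf'.mul_isBigO hg).add (hf2.mul_isLittleO hg')
  refine this.congr_left fun a => ?_
  ring

theorem isLittleO_pow_sub_pow {f f' : X → ℂ} {A : X → ℝ} (hf : f =O[l] A)
    (hf' : (fun a => f a - f' a) =o[l] A) (k : ℕ) :
    (fun a => f a ^ k - f' a ^ k) =o[l] fun a => A a ^ k := by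
  induction k with
  | zero => simpa using tendsto_const_nhds
  | succ k ih =>
    simp_rw [pow_succ]
    exact isLittleO_mul_sub_mul (hf.pow k) hf ih hf'

theorem isLittleO_prod_sub_prod {ι : Type*} (s : Finset ι) {f f' : ι → X → ℂ} {A : ι → X → ℝ}
    (hf : ∀ i, f i =O[l] A i) (hf' : ∀ i, (fun a => f i a - f' i a) =o[l] A i) :
    (fun a => ∏ i ∈ s, f i a - ∏ i ∈ s, f' i a) =o[l] fun a => ∏ i ∈ s, A i a := by
  classical
  induction s using Finset.induction_on with
  | empty => simpa using tendsto_const_nhds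
  | insert i s hi ih =>
    simp_rw [Finset.prod_insert hi]
    exact isLittleO_mul_sub_mul (hf i) (IsBigO.finsetProd fun i _ => hf i) (hf' i) ih

/-- Every monomial of p has size O(ρ^κ), and telescoping its product shows that errors o(ρ^(w j)) in
the factors change it by o(ρ^κ). This permits replacing a map by its leading terms inside p. -/
theorem isLittleO_eval_sub_eval (h0 : ∀ a, 0 ≤ ρ a) (hw : ∀ j, 0 ≤ w j) {y y' : X → σ → ℂ}
    (hy : ∀ j, (fun a => y a j) =O[l] fun a => ρ a ^ w j)
    (hy' : ∀ j, (fun a => y a j - y' a j) =o[l] fun a => ρ a ^ w j)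
    {p : MvPolynomial σ ℂ} {κ : ℝ} (hp : IsWeightedHomogeneous w p κ) :
    (fun a => eval (y a) p - eval (y' a) p) =o[l] fun a => ρ a ^ κ := by
  simp_rw [eval_eq', ← Finset.sum_sub_distrib, ← mul_sub]
  refine IsLittleO.fun_sum fun d hd => IsLittleO.const_mul_left ?_ _
  have hd' : Finsupp.weight w d = κ := hp (mem_support_iff.1 hd)
  have := isLittleO_prod_sub_prod Finset.univ (f := fun i a => y a i ^ d i)
    (f' := fun i a => y' a i ^ d i) (A := fun i a => (ρ a ^ w i) ^ d i)
    (fun i => (hy i).pow _) (fun i => isLittleO_pow_sub_pow (hy i) (hy' i) _)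
  refine this.congr_right fun a => ?_
  rw [← hd', weight_eq_sum_mul, Real.rpow_sum_of_nonneg (h0 a)
    fun i _ => mul_nonneg (Nat.cast_nonneg _) (hw i)]
  refine Finset.prod_congr rfl fun i _ => ?_
  rw [mul_comm, Real.rpow_mul (h0 a), Real.rpow_natCast]

/-- The smallest exponent with a nonzero coefficient dominates the sum as t tends to 0 from the
right. -/
theorem coeff_eq_zero_of_isLittleO_sum_rpow (W : Finset ℝ) (c : ℝ → ℂ) (κ : ℝ)
    (h : (fun t : ℝ => ∑ k ∈ W, ((t ^ k : ℝ) : ℂ) * c k) =o[𝓝[>] 0] fun t => t ^ κ) :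
    ∀ k ∈ W, k ≤ κ → c k = 0 := by
  by_contra hcon
  push Not at hcon
  obtain ⟨k0, hk0W, hk0κ, hk0⟩ := hcon
  have hne : (W.filter fun k => c k ≠ 0).Nonempty := ⟨k0, by simp [hk0W, hk0]⟩
  obtain ⟨k, hk, hmin⟩ := Finset.exists_min_image _ id hne
  simp only [Finset.mem_filter, id] at hk hmin
  have hkκ : k ≤ κ := (hmin k0 ⟨hk0W, hk0⟩).trans hk0κ
  have h1 := h.trans_isBigO (isBigO_rpow_nhdsGT hkκ)
  have h2 : (fun t : ℝ => ∑ j ∈ W.erase k, ((t ^ j : ℝ) : ℂ) * c j) =o[𝓝[>] 0] fun t => t ^ k := by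
    refine IsLittleO.fun_sum fun j hj => ?_
    rw [Finset.mem_erase] at hj
    by_cases hc : c j = 0
    · simp [hc]
    · have hlt : k < j := lt_of_le_of_ne (hmin j ⟨hj.2, hc⟩) (Ne.symm hj.1)
      have h3 : (fun t : ℝ => ((t ^ j : ℝ) : ℂ) * c j) =O[𝓝[>] 0] fun t : ℝ => t ^ j := by
        refine IsBigO.of_bound ‖c j‖ (Eventually.of_forall fun t => ?_)
        rw [norm_mul, Complex.norm_real, mul_comm]
      exact h3.trans_isLittleO (isLittleO_rpow_nhdsGT hlt)
  have h3 : (fun t : ℝ => ((t ^ k : ℝ) : ℂ) * c k) =o[𝓝[>] 0] fun t => t ^ k := by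
    refine (h1.sub h2).congr_left fun t => ?_
    rw [← Finset.add_sum_erase W _ hk.1]; ring
  have h4 : (fun t : ℝ => t ^ k) =O[𝓝[>] 0] fun t : ℝ => ((t ^ k : ℝ) : ℂ) * c k := by
    refine IsBigO.of_bound ‖c k‖⁻¹ (Eventually.of_forall fun t => ?_)
    rw [norm_mul, Complex.norm_real, mul_comm, mul_assoc,
      mul_inv_cancel₀ (norm_ne_zero_iff.2 hk.2), mul_one]
  have h5 := h4.trans_isLittleO h3
  have h6 := isLittleO_irrefl' (l := 𝓝[>] (0 : ℝ)) (f' := fun t : ℝ => t ^ k)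
    (Eventually.frequently (by
      filter_upwards [self_mem_nhdsWithin] with t ht
      exact norm_ne_zero_iff.2 (Real.rpow_pos_of_pos ht k).ne'))
  exact h6 h5

theorem eval_scaled (w : σ → ℝ) {t : ℝ} (ht : 0 < t) (y : σ → ℂ) (p : MvPolynomial σ ℂ) :
    eval (fun j => ((t ^ w j : ℝ) : ℂ) * y j) p =
      ∑ k ∈ p.support.image (Finsupp.weight w), ((t ^ k : ℝ) : ℂ) *
        eval y (weightedHomogeneousComponent w k p) := by
  classical
  have e : ∀ k, eval y (weightedHomogeneousComponent w k p) =
      ∑ d ∈ p.support with Finsupp.weight w d = k, coeff d p * ∏ i, y i ^ d i := fun k => by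
    rw [weightedHomogeneousComponent_apply, map_sum]
    refine Finset.sum_congr rfl fun d _ => ?_
    rw [eval_monomial, Finsupp.prod_fintype _ _ (by simp)]
  simp_rw [e]
  rw [eval_eq', ← Finset.sum_fiberwise_of_maps_to (s := p.support)
    (t := p.support.image (Finsupp.weight w)) (g := Finsupp.weight w)
    (fun d hd => Finset.mem_image_of_mem _ hd)]
  refine Finset.sum_congr rfl fun k _ => ?_
  rw [Finset.mul_sum]
  refine Finset.sum_congr rfl fun d hd => ?_
  rw [Finset.mem_filter] at hd
  rw [← hd.2, weight_eq_sum_mul, Real.rpow_sum_of_pos ht]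
  simp_rw [mul_pow, Finset.prod_mul_distrib]
  push_cast
  have : ∀ i, ((t ^ ((d i : ℝ) * w i) : ℝ) : ℂ) = (((t ^ w i : ℝ)) : ℂ) ^ d i := fun i => by
    rw [mul_comm, Real.rpow_mul ht.le, Real.rpow_natCast]; push_cast; rfl
  simp_rw [this]
  ring

theorem eval_scaled_of_isWeightedHomogeneous {w : σ → ℝ} {t : ℝ} (ht : 0 < t) (y : σ → ℂ)
    {p : MvPolynomial σ ℂ} {κ : ℝ} (hp : IsWeightedHomogeneous w p κ) :
    eval (fun j => ((t ^ w j : ℝ) : ℂ) * y j) p = ((t ^ κ : ℝ) : ℂ) * eval y p := by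
  rw [eval_eq', eval_eq', Finset.mul_sum]
  refine Finset.sum_congr rfl fun d hd => ?_
  rw [← (hp (mem_support_iff.1 hd) : Finsupp.weight w d = κ), weight_eq_sum_mul,
    Real.rpow_sum_of_pos ht]
  simp_rw [mul_pow, Finset.prod_mul_distrib]
  push_cast
  have : ∀ i, ((t ^ ((d i : ℝ) * w i) : ℝ) : ℂ) = (((t ^ w i : ℝ)) : ℂ) ^ d i := fun i => by
    rw [mul_comm, Real.rpow_mul ht.le, Real.rpow_natCast]; push_cast; rfl
  simp_rw [this]
  ring

theorem eval_component_eq_zero {w : σ → ℝ} {p : MvPolynomial σ ℂ} {y : σ → ℂ} {κ : ℝ}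
    (h : (fun t : ℝ => eval (fun j => ((t ^ w j : ℝ) : ℂ) * y j) p) =o[𝓝[>] 0] fun t => t ^ κ)
    {k : ℝ} (hk : k ≤ κ) : eval y (weightedHomogeneousComponent w k p) = 0 := by
  classical
  by_cases hkW : k ∈ p.support.image (Finsupp.weight w)
  · refine coeff_eq_zero_of_isLittleO_sum_rpow (p.support.image (Finsupp.weight w))
      (fun k => eval y (weightedHomogeneousComponent w k p)) κ ?_ k hkW hk
    refine h.congr' ?_ EventuallyEq.rfl
    filter_upwards [self_mem_nhdsWithin] with t ht
    exact eval_scaled w ht y p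
  · rw [weightedHomogeneousComponent_eq_zero', map_zero]
    intro d hd hdk
    exact hkW (Finset.mem_image.2 ⟨d, hd, hdk⟩)

end Growth

/-! ### Polynomials in z and its conjugate, and their polarisation. -/

section ZPolynomials

variable {n : ℕ}

/-- The polarisation of a polynomial in `z` and its conjugate. -/
noncomputable def ZPoly.polar (P : ZPoly n) (x η : Fin n → ℂ) : ℂ := eval (Sum.elim x η) P

/-- Coordinatewise complex conjugation. -/
noncomputable def conjv (z : Fin n → ℂ) : Fin n → ℂ := fun i => (starRingEnd ℂ) (z i)

theorem conjv_conjv (z : Fin n → ℂ) : conjv (conjv z) = z := by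
  funext i; simp [conjv]

theorem conjv_zero : conjv (0 : Fin n → ℂ) = 0 := by
  funext i; simp [conjv]

theorem ZPoly.value_eq_polar (P : ZPoly n) (z : Fin n → ℂ) : P.value z = P.polar z (conjv z) := rfl

theorem ZPoly.polar_ext {P Q : ZPoly n} (h : ∀ x η, P.polar x η = Q.polar x η) : P = Q :=
  MvPolynomial.funext fun y => by
    have := h (y ∘ Sum.inl) (y ∘ Sum.inr)
    rwa [ZPoly.polar, ZPoly.polar, Sum.elim_comp_inl_inr] at this

/-- With z = a + ib, a polynomial in (a, b) that vanishes for all real a, b is zero. The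
substitution x = a + ib, η = a - ib is invertible over ℂ, so the polarisation vanishes too. -/
theorem ZPoly.eq_of_value_eq {P Q : ZPoly n} (h : ∀ z, P.value z = Q.value z) : P = Q := by
  rw [← sub_eq_zero]
  set R : ZPoly n := P - Q with hR
  have hRv : ∀ z, R.value z = 0 := fun z => by
    have := h z
    simp only [ZPoly.value] at this ⊢
    rw [hR, map_sub, this, sub_self]
  set φ : ZPoly n := bind₁ (Sum.elim
    (fun i => X (Sum.inl i) + C Complex.I * X (Sum.inr i))
    (fun i => X (Sum.inl i) - C Complex.I * X (Sum.inr i))) R with hφ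
  have hφe : ∀ y : Fin n ⊕ Fin n → ℂ, eval y φ =
      R.polar (fun i => y (Sum.inl i) + Complex.I * y (Sum.inr i))
        (fun i => y (Sum.inl i) - Complex.I * y (Sum.inr i)) := fun y => by
    rw [hφ, ZPoly.polar, eval, eval₂Hom_bind₁]
    congr 2
    funext j
    rcases j with j | j <;> simp
  have hφ0 : φ = 0 := by
    refine MvPolynomial.funext_set (fun _ => Set.range ((↑) : ℝ → ℂ))
      (fun _ => Set.infinite_range_of_injective Complex.ofReal_injective) fun y hy => ?_
    rw [hφe, map_zero, ← hRv (fun i => y (Sum.inl i) + Complex.I * y (Sum.inr i)),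
      ZPoly.value_eq_polar]
    congr 1
    funext i
    obtain ⟨a, ha⟩ := hy (Sum.inl i) (Set.mem_univ _)
    obtain ⟨b, hb⟩ := hy (Sum.inr i) (Set.mem_univ _)
    simp [conjv, ← ha, ← hb, sub_eq_add_neg]
  refine ZPoly.polar_ext fun x η => ?_
  have := hφe (Sum.elim (fun i => (x i + η i) / 2) (fun i => (x i - η i) / (2 * Complex.I)))
  rw [hφ0, map_zero] at this
  have e1 : (fun i => (x i + η i) / 2 + Complex.I * ((x i - η i) / (2 * Complex.I))) = x := by
    funext i; field_simp [Complex.I_ne_zero]; ring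
  have e2 : (fun i => (x i + η i) / 2 - Complex.I * ((x i - η i) / (2 * Complex.I))) = η := by
    funext i; field_simp [Complex.I_ne_zero]; ring
  simp only [Sum.elim_inl, Sum.elim_inr, e1, e2] at this
  rw [← this]
  simp [ZPoly.polar]

theorem ZPoly.polar_eq_sum (P : ZPoly n) (x η : Fin n → ℂ) : P.polar x η =
    ∑ d ∈ P.support, coeff d P * ((∏ i, x i ^ d (Sum.inl i)) * ∏ i, η i ^ d (Sum.inr i)) := by
  rw [ZPoly.polar, eval_eq']
  refine Finset.sum_congr rfl fun d _ => ?_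
  rw [Fintype.prod_sum_type]
  rfl

open Classical in
/-- The part of a polynomial consisting of its terms that are not pluriharmonic. -/
noncomputable def ZPoly.mixedPart (P : ZPoly n) : ZPoly n :=
  ∑ d ∈ P.support with IsMixed d, monomial d (coeff d P)

theorem prod_pow_zero_of_ne {f : Fin n → ℕ} (h : ∃ i, f i ≠ 0) :
    ∏ i, (0 : Fin n → ℂ) i ^ f i = 0 := by
  obtain ⟨i, hi⟩ := h
  exact Finset.prod_eq_zero (Finset.mem_univ i) (by simp [hi])

/-- Setting one block of variables to zero isolates the terms in the other block; the constant term
is subtracted twice and has to be restored once. -/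
theorem ZPoly.polar_mixedPart (P : ZPoly n) (x η : Fin n → ℂ) :
    P.mixedPart.polar x η = P.polar x η - P.polar x 0 - P.polar 0 η + P.polar 0 0 := by
  classical
  have e : P.mixedPart.polar x η = ∑ d ∈ P.support with IsMixed d, coeff d P *
      ((∏ i, x i ^ d (Sum.inl i)) * ∏ i, η i ^ d (Sum.inr i)) := by
    rw [ZPoly.polar, ZPoly.mixedPart, map_sum]
    refine Finset.sum_congr (by congr) fun d _ => ?_
    rw [eval_monomial, Finsupp.prod_fintype _ _ (by simp), Fintype.prod_sum_type]
    rfl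
  rw [e, Finset.sum_filter]
  simp only [ZPoly.polar_eq_sum P, ← Finset.sum_sub_distrib, ← Finset.sum_add_distrib]
  refine Finset.sum_congr rfl fun d _ => ?_
  by_cases hd : IsMixed d
  · rw [if_pos hd, prod_pow_zero_of_ne hd.1, prod_pow_zero_of_ne hd.2]
    ring
  · rw [if_neg hd]
    rw [IsMixed, not_and_or] at hd
    push Not at hd
    rcases hd with hd | hd
    · simp only [hd, pow_zero]; ring
    · simp only [hd, pow_zero]; ring

theorem ZPoly.coeff_mixedPart (P : ZPoly n) (d : Fin n ⊕ Fin n →₀ ℕ) [Decidable (IsMixed d)] :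
    coeff d P.mixedPart = if IsMixed d then coeff d P else 0 := by
  classical
  rw [ZPoly.mixedPart, coeff_sum]
  simp only [coeff_monomial]
  rw [Finset.sum_ite_eq']
  by_cases h1 : d ∈ P.support <;> by_cases h2 : IsMixed d <;> simp_all

theorem ZPoly.support_mixedPart {P : ZPoly n} {d : Fin n ⊕ Fin n →₀ ℕ} :
    d ∈ P.mixedPart.support ↔ d ∈ P.support ∧ IsMixed d := by
  classical
  rw [mem_support_iff, mem_support_iff, ZPoly.coeff_mixedPart]
  by_cases h2 : IsMixed d <;> simp [h2]

theorem ZPoly.exists_mixed_iff {P : ZPoly n} :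
    (∃ d ∈ P.support, IsMixed d) ↔ P.mixedPart ≠ 0 := by
  rw [← support_nonempty]
  exact ⟨fun ⟨d, h⟩ => ⟨d, ZPoly.support_mixedPart.2 h⟩,
    fun ⟨d, h⟩ => ⟨d, ZPoly.support_mixedPart.1 h⟩⟩

theorem ZPoly.forall_mixed_iff {P : ZPoly n} :
    (∀ d ∈ P.support, IsMixed d) ↔ P.mixedPart = P := by
  classical
  constructor
  · intro h
    ext d
    rw [ZPoly.coeff_mixedPart]
    by_cases hd : IsMixed d
    · simp [hd]
    · rw [if_neg hd]
      by_contra hc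
      exact hd (h d (mem_support_iff.2 (Ne.symm hc)))
  · intro h d hd
    rw [← h] at hd
    exact (ZPoly.support_mixedPart.1 hd).2

theorem ZPoly.forall_mixed_iff_polar {P : ZPoly n} :
    (∀ d ∈ P.support, IsMixed d) ↔ (∀ x, P.polar x 0 = 0) ∧ ∀ η, P.polar 0 η = 0 := by
  rw [ZPoly.forall_mixed_iff]
  constructor
  · intro h
    constructor
    · intro x; rw [← h, ZPoly.polar_mixedPart]; ring
    · intro x; rw [← h, ZPoly.polar_mixedPart]; ring
  · rintro ⟨h1, h2⟩
    refine ZPoly.polar_ext fun x η => ?_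
    rw [ZPoly.polar_mixedPart, h1, h2, h2]; ring

/-- The polynomial with conjugate coefficients. -/
noncomputable def conjPoly (q : MvPolynomial (Fin n) ℂ) : MvPolynomial (Fin n) ℂ :=
  map (starRingEnd ℂ) q

theorem eval_conjPoly (q : MvPolynomial (Fin n) ℂ) (z : Fin n → ℂ) :
    eval z (conjPoly q) = (starRingEnd ℂ) (eval (conjv z) q) := by
  induction q using MvPolynomial.induction_on with
  | C a => simp [conjPoly]
  | add p q hp hq => simp only [conjPoly, map_add] at *; rw [hp, hq]
  | mul_X p i hp =>
    simp only [conjPoly, map_mul, map_X, eval_X] at *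
    rw [hp]; simp [conjv]

/-- The substitution of `k` for `z` in a polynomial in `z` and its conjugate. -/
noncomputable def ZPoly.subst (k : Fin n → MvPolynomial (Fin n) ℂ) (P : ZPoly n) : ZPoly n :=
  bind₁ (Sum.elim (fun i => rename Sum.inl (k i)) (fun i => rename Sum.inr (conjPoly (k i)))) P

theorem ZPoly.polar_subst (k : Fin n → MvPolynomial (Fin n) ℂ) (P : ZPoly n) (x η : Fin n → ℂ) :
    (P.subst k).polar x η =
      P.polar (fun i => eval x (k i)) (fun i => eval η (conjPoly (k i))) := by
  rw [ZPoly.polar, ZPoly.polar, ZPoly.subst, eval, eval₂Hom_bind₁]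
  congr 2
  funext j
  rcases j with j | j
  · change eval _ (rename _ _) = _
    rw [Sum.elim_inl, eval_rename]; rfl
  · change eval _ (rename _ _) = _
    rw [Sum.elim_inr, eval_rename]; rfl

theorem ZPoly.value_subst (k : Fin n → MvPolynomial (Fin n) ℂ) (P : ZPoly n) (z : Fin n → ℂ) :
    (P.subst k).value z = P.value (fun i => eval z (k i)) := by
  rw [ZPoly.value_eq_polar, ZPoly.polar_subst, ZPoly.value_eq_polar]
  congr 1
  funext i
  rw [eval_conjPoly, conjv_conjv]; rfl

/-- The polynomial in `z` and its conjugate with value `Im q(z)`. -/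
noncomputable def imPart (q : MvPolynomial (Fin n) ℂ) : ZPoly n :=
  C (1 / (2 * Complex.I)) * (rename Sum.inl q - rename Sum.inr (conjPoly q))

theorem polar_imPart (q : MvPolynomial (Fin n) ℂ) (x η : Fin n → ℂ) :
    (imPart q).polar x η = (eval x q - eval η (conjPoly q)) / (2 * Complex.I) := by
  simp only [ZPoly.polar, imPart, map_mul, map_sub, eval_C, eval_rename]
  rw [Sum.elim_comp_inl, Sum.elim_comp_inr]; ring

theorem value_imPart (q : MvPolynomial (Fin n) ℂ) (z : Fin n → ℂ) :
    (imPart q).value z = ((eval z q).im : ℂ) := by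
  rw [ZPoly.value_eq_polar, polar_imPart, eval_conjPoly, conjv_conjv, Complex.sub_conj]
  field_simp [Complex.I_ne_zero]
  push_cast
  rfl

end ZPolynomials

/-! ### Weights of monomials detected along dilation orbits. -/

section Weights

variable {n : ℕ} {μ : Fin n → ℝ}

theorem isBigO_comp_dil {F : Type*} [NormedAddCommGroup F] (hμ : ∀ i, 0 < μ i)
    {f : (Fin n → ℂ) → F} {κ : ℝ}
    (h : f =O[𝓝 0] fun z => zgauge μ z ^ κ) (z : Fin n → ℂ) :
    (fun t => f (dil μ t z)) =O[𝓝[>] 0] fun t : ℝ => t ^ κ := by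
  refine (h.comp_tendsto (tendsto_dil hμ z)).trans ?_
  refine IsBigO.of_bound (zgauge μ z ^ κ) ?_
  filter_upwards [self_mem_nhdsWithin] with t ht
  have ht' : (0 : ℝ) < t := ht
  rw [Function.comp_apply, zgauge_dil hμ ht'.le, Real.mul_rpow ht'.le (zgauge_nonneg _), norm_mul,
    Real.norm_of_nonneg (Real.rpow_nonneg (zgauge_nonneg z) _), mul_comm]

theorem isLittleO_comp_dil {F : Type*} [NormedAddCommGroup F] (hμ : ∀ i, 0 < μ i)
    {f : (Fin n → ℂ) → F} {κ : ℝ}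
    (h : f =o[𝓝 0] fun z => zgauge μ z ^ κ) (z : Fin n → ℂ) :
    (fun t => f (dil μ t z)) =o[𝓝[>] 0] fun t : ℝ => t ^ κ :=
  (h.comp_tendsto (tendsto_dil hμ z)).trans_isBigO
    (isBigO_comp_dil (f := fun z => zgauge μ z ^ κ) hμ (isBigO_refl _ _) z)

/-- Along a dilation orbit Q is a finite sum of powers t^k times its homogeneous components, so
every component of weight at most κ takes only the value zero. -/
theorem lt_weight_of_isLittleO_eval {Q : MvPolynomial (Fin n) ℂ} {κ : ℝ}
    (h : ∀ z, (fun t => eval (dil μ t z) Q) =o[𝓝[>] 0] fun t : ℝ => t ^ κ) :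
    ∀ d ∈ Q.support, κ < Finsupp.weight μ d := by
  classical
  intro d hd
  by_contra hcon
  push Not at hcon
  have h0 : weightedHomogeneousComponent μ (Finsupp.weight μ d) Q = 0 :=
    MvPolynomial.funext fun z => by
      rw [map_zero]; exact eval_component_eq_zero (h z) hcon
  have := congrArg (coeff d) h0
  rw [coeff_weightedHomogeneousComponent, if_pos rfl, coeff_zero] at this
  exact mem_support_iff.1 hd this

theorem ZPoly.value_dil (P : ZPoly n) (t : ℝ) (z : Fin n → ℂ) : P.value (dil μ t z) =
    eval (fun j => ((t ^ (Sum.elim μ μ j) : ℝ) : ℂ) * Sum.elim z (conjv z) j) P := by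
  rw [ZPoly.value]
  congr 2
  funext j
  rcases j with j | j <;> simp [dil, conjv]

theorem ZPoly.lt_weight_of_isLittleO_value {P : ZPoly n} {κ : ℝ}
    (h : ∀ z, (fun t => P.value (dil μ t z)) =o[𝓝[>] 0] fun t : ℝ => t ^ κ) :
    ∀ d ∈ P.support, κ < Finsupp.weight (Sum.elim μ μ) d := by
  classical
  intro d hd
  by_contra hcon
  push Not at hcon
  have h0 : weightedHomogeneousComponent (Sum.elim μ μ) (Finsupp.weight (Sum.elim μ μ) d) P = 0 :=
    ZPoly.eq_of_value_eq fun z => by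
      have := eval_component_eq_zero (y := Sum.elim z (conjv z)) (p := P) (w := Sum.elim μ μ)
        ((h z).congr_left fun t => P.value_dil t z) hcon
      simp only [ZPoly.value, map_zero]
      exact this
  have := congrArg (coeff d) h0
  rw [coeff_weightedHomogeneousComponent, if_pos rfl, coeff_zero] at this
  exact mem_support_iff.1 hd this

theorem le_weight_of_isBigO_eval (hμ : ∀ i, 0 < μ i) {Q : MvPolynomial (Fin n) ℂ} {κ : ℝ}
    (h : (fun z => eval z Q) =O[𝓝 0] fun z => zgauge μ z ^ κ) :
    ∀ d ∈ Q.support, κ ≤ Finsupp.weight μ d := by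
  intro d hd
  by_contra hcon
  push Not at hcon
  exact lt_irrefl _ (lt_weight_of_isLittleO_eval (μ := μ) (κ := Finsupp.weight μ d) (fun z =>
    (isBigO_comp_dil (f := fun z => eval z Q) hμ h z).trans_isLittleO
      (isLittleO_rpow_nhdsGT hcon)) d hd)

theorem eq_zero_of_isLittleO_eval (hμ : ∀ i, 0 < μ i) {Q : MvPolynomial (Fin n) ℂ} {κ : ℝ}
    (hQ : IsWeightedHomogeneous μ Q κ)
    (h : (fun z => eval z Q) =o[𝓝 0] fun z => zgauge μ z ^ κ) : Q = 0 := by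
  by_contra hne
  obtain ⟨d, hd⟩ := support_nonempty.2 hne
  exact (lt_weight_of_isLittleO_eval (fun z =>
    isLittleO_comp_dil (f := fun z => eval z Q) hμ h z) d hd).ne' (hQ (mem_support_iff.1 hd))

theorem ZPoly.eq_zero_of_isLittleO_value (hμ : ∀ i, 0 < μ i) {P : ZPoly n} {κ : ℝ}
    (hP : IsWeightedHomogeneous (Sum.elim μ μ) P κ)
    (h : P.value =o[𝓝 0] fun z => zgauge μ z ^ κ) : P = 0 := by
  by_contra hne
  obtain ⟨d, hd⟩ := support_nonempty.2 hne
  exact (ZPoly.lt_weight_of_isLittleO_value (fun z => isLittleO_comp_dil hμ h z) d hd).ne'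
    (hP (mem_support_iff.1 hd))

section Growth

variable {X : Type*} {l : Filter X} {ρ : X → ℝ}

theorem isBigO_sumElim {y : X → Fin n → ℂ} (hy : ∀ i, (fun a => y a i) =O[l] fun a => ρ a ^ μ i)
    (j : Fin n ⊕ Fin n) : (fun a => Sum.elim (y a) (conjv (y a)) j) =O[l]
      fun a => ρ a ^ (Sum.elim μ μ j) := by
  rcases j with j | j
  · exact hy j
  · refine IsBigO.trans (IsBigO.of_norm_le fun a => ?_) (hy j).norm_left
    simp [conjv]

theorem sumElim_nonneg (hμ : ∀ i, 0 < μ i) (j : Fin n ⊕ Fin n) : 0 ≤ Sum.elim μ μ j := by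
  rcases j with j | j <;> exact (hμ j).le

theorem ZPoly.isBigO_value (hμ : ∀ i, 0 < μ i) (h0 : ∀ a, 0 ≤ ρ a) (hρ : Tendsto ρ l (𝓝 0))
    {y : X → Fin n → ℂ} (hy : ∀ i, (fun a => y a i) =O[l] fun a => ρ a ^ μ i)
    (P : ZPoly n) {κ : ℝ} (hκ : 0 < κ)
    (hp : ∀ d ∈ P.support, κ ≤ Finsupp.weight (Sum.elim μ μ) d) :
    (fun a => P.value (y a)) =O[l] fun a => ρ a ^ κ :=
  isBigO_eval h0 hρ (sumElim_nonneg hμ) (isBigO_sumElim hy) P hκ hp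

theorem ZPoly.isLittleO_value (hμ : ∀ i, 0 < μ i) (h0 : ∀ a, 0 ≤ ρ a) (hρ : Tendsto ρ l (𝓝 0))
    {y : X → Fin n → ℂ} (hy : ∀ i, (fun a => y a i) =O[l] fun a => ρ a ^ μ i)
    (P : ZPoly n) {κ : ℝ} (hκ : 0 < κ)
    (hp : ∀ d ∈ P.support, κ < Finsupp.weight (Sum.elim μ μ) d) :
    (fun a => P.value (y a)) =o[l] fun a => ρ a ^ κ :=
  isLittleO_eval h0 hρ (sumElim_nonneg hμ) (isBigO_sumElim hy) P hκ hp

theorem ZPoly.isLittleO_value_sub_value (hμ : ∀ i, 0 < μ i) (h0 : ∀ a, 0 ≤ ρ a)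
    {y y' : X → Fin n → ℂ} (hy : ∀ i, (fun a => y a i) =O[l] fun a => ρ a ^ μ i)
    (hy' : ∀ i, (fun a => y a i - y' a i) =o[l] fun a => ρ a ^ μ i) {P : ZPoly n} {κ : ℝ}
    (hP : IsWeightedHomogeneous (Sum.elim μ μ) P κ) :
    (fun a => P.value (y a) - P.value (y' a)) =o[l] fun a => ρ a ^ κ := by
  refine isLittleO_eval_sub_eval h0 (sumElim_nonneg hμ) (isBigO_sumElim hy) (fun j => ?_) hP
  rcases j with j | j
  · exact hy' j
  · refine IsBigO.trans_isLittleO (IsBigO.of_norm_le fun a => ?_) (hy' j).norm_left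
    simp only [Sum.elim_inr, conjv]
    rw [← map_sub, RCLike.norm_conj]

end Growth

theorem isBigO_coord_zgauge (hμ : ∀ i, 0 < μ i) (i : Fin n) :
    (fun z : Fin n → ℂ => z i) =O[𝓝 0] fun z => zgauge μ z ^ μ i :=
  IsBigO.of_norm_le fun z => norm_le_zgauge_rpow hμ z i

theorem isBigO_coord_wgauge {K : Type*} [NormedAddCommGroup K] (hμ : ∀ i, 0 < μ i) (i : Fin n)
    (l : Filter ((Fin n → ℂ) × K)) :
    (fun x : (Fin n → ℂ) × K => x.1 i) =O[l] fun x => wgauge μ x ^ μ i :=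
  IsBigO.of_norm_le fun z => norm_le_gauge_rpow hμ z i

theorem isBigO_snd_wgauge {K : Type*} [NormedAddCommGroup K] (l : Filter ((Fin n → ℂ) × K)) :
    (fun x : (Fin n → ℂ) × K => x.2) =O[l] fun x => wgauge μ x :=
  IsBigO.of_norm_le fun z => norm_snd_le_gauge z

theorem IsWeightedHomogeneous.bind₁ {σ τ : Type*} {w : σ → ℝ} {v : τ → ℝ}
    {k : σ → MvPolynomial τ ℂ} {p : MvPolynomial σ ℂ} {κ : ℝ} (hp : IsWeightedHomogeneous w p κ)
    (hk : ∀ i, IsWeightedHomogeneous v (k i) (w i)) :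
    IsWeightedHomogeneous v (MvPolynomial.bind₁ k p) κ := by
  rw [p.as_sum, map_sum]
  refine IsWeightedHomogeneous.sum _ _ _ fun d hd => ?_
  rw [bind₁_monomial]
  refine IsWeightedHomogeneous.C_mul ?_ _
  have hd' : Finsupp.weight w d = κ := hp (mem_support_iff.1 hd)
  rw [← hd', Finsupp.weight_apply, Finsupp.sum]
  exact IsWeightedHomogeneous.prod _ _ _ fun i _ => (hk i).pow _

theorem isWeightedHomogeneous_conjPoly {q : MvPolynomial (Fin n) ℂ} {κ : ℝ}
    (hq : IsWeightedHomogeneous μ q κ) : IsWeightedHomogeneous μ (conjPoly q) κ := by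
  intro d hd
  refine hq (d := d) fun h => hd ?_
  rw [conjPoly, coeff_map, h, map_zero]

theorem isWeightedHomogeneous_rename {σ τ : Type*} {w : σ → ℝ} {v : τ → ℝ} (f : σ → τ)
    (hf : ∀ i, v (f i) = w i) {q : MvPolynomial σ ℂ} {κ : ℝ} (hq : IsWeightedHomogeneous w q κ) :
    IsWeightedHomogeneous v (rename f q) κ := by
  have e : (rename f : MvPolynomial σ ℂ →ₐ[ℂ] MvPolynomial τ ℂ) =
      MvPolynomial.bind₁ (fun i => X (f i)) := MvPolynomial.algHom_ext fun i => by simp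
  rw [e]
  refine IsWeightedHomogeneous.bind₁ hq fun i => ?_
  rw [← hf i]
  exact isWeightedHomogeneous_X _ _ _

theorem ZPoly.isWeightedHomogeneous_subst {w : Fin n → ℝ} {P : ZPoly n} {κ : ℝ}
    (hP : IsWeightedHomogeneous (Sum.elim w w) P κ) {k : Fin n → MvPolynomial (Fin n) ℂ}
    (hk : ∀ i, IsWeightedHomogeneous μ (k i) (w i)) :
    IsWeightedHomogeneous (Sum.elim μ μ) (P.subst k) κ := by
  refine IsWeightedHomogeneous.bind₁ hP fun j => ?_
  rcases j with j | j
  · exact isWeightedHomogeneous_rename _ (fun _ => rfl) (hk j)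
  · exact isWeightedHomogeneous_rename _ (fun _ => rfl) (isWeightedHomogeneous_conjPoly (hk j))

theorem isWeightedHomogeneous_imPart {q : MvPolynomial (Fin n) ℂ} {κ : ℝ}
    (hq : IsWeightedHomogeneous μ q κ) : IsWeightedHomogeneous (Sum.elim μ μ) (imPart q) κ :=
  IsWeightedHomogeneous.C_mul ((isWeightedHomogeneous_rename Sum.inl (fun _ => rfl) hq).sub
    (isWeightedHomogeneous_rename Sum.inr (fun _ => rfl) (isWeightedHomogeneous_conjPoly hq))) _

theorem weight_cast (Λ : Fin n → ℚ) (d : Fin n ⊕ Fin n →₀ ℕ) :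
    Finsupp.weight (Sum.elim (fun i => (Λ i : ℝ)) fun i => (Λ i : ℝ)) d =
      ((Finsupp.weight (Sum.elim Λ Λ) d : ℚ) : ℝ) := by
  rw [Finsupp.weight_eq_sum, Finsupp.weight_eq_sum]
  push_cast
  refine Finset.sum_congr rfl fun j _ => ?_
  rcases j with j | j <;> simp

theorem isHomogeneousOne_iff {Λ : Fin n → ℚ} {P : ZPoly n} : IsHomogeneousOne Λ P ↔
    IsWeightedHomogeneous (Sum.elim (fun i => (Λ i : ℝ)) fun i => (Λ i : ℝ)) P 1 := by
  constructor
  · intro h d hd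
    rw [weight_cast, h hd, Rat.cast_one]
  · intro h d hd
    have := h hd
    rw [weight_cast] at this
    exact_mod_cast this

end Weights

/-! ### Jets and homogeneous leading parts. -/

section Jets

variable {n : ℕ}

theorem exists_jet {q : (Fin n → ℂ) → ℂ} (hq : AnalyticAt ℂ q 0) (M : ℕ) :
    ∃ Q : MvPolynomial (Fin n) ℂ, (fun z => q z - eval z Q) =O[𝓝 0] fun z => ‖z‖ ^ M := by
  classical
  refine ⟨∑ m ∈ Finset.range M, ∑ s : Fin m → Fin n, C ((m.factorial : ℂ)⁻¹ *
    iteratedFDeriv ℂ m q 0 (fun i => Pi.single (s i) 1)) * ∏ i, X (s i), ?_⟩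
  refine (hq.hasTaylorBound M).congr_left fun z => ?_
  congr 1
  rw [map_sum]
  refine Finset.sum_congr rfl fun m _ => ?_
  have e : (fun _ : Fin m => z) = fun _ => ∑ j, z j • (Pi.single j (1 : ℂ) : Fin n → ℂ) := by
    funext _ i; simp [Finset.sum_apply, Pi.single_apply]
  rw [e, ContinuousMultilinearMap.map_sum, Finset.smul_sum, map_sum]
  refine Finset.sum_congr rfl fun s _ => ?_
  rw [ContinuousMultilinearMap.map_smul_univ]
  simp only [map_mul, eval_C, map_prod, eval_X, smul_eq_mul]
  ring

theorem exists_zjet {f : (Fin n → ℂ) → ℂ} (hf : ContDiffAt ℝ ∞ f 0) (M : ℕ) :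
    ∃ Q : ZPoly n, (fun z => f z - Q.value z) =O[𝓝 0] fun z => ‖z‖ ^ (M + 1) := by
  classical
  -- The real coordinates Re z_i and Im z_i as polynomials in z and its conjugate; they turn the
  -- real Taylor polynomial into a `ZPoly`.
  let cf : Fin n ⊕ Fin n → ZPoly n := Sum.elim
    (fun i => C (1 / 2) * (X (Sum.inl i) + X (Sum.inr i)))
    (fun i => C (1 / (2 * Complex.I)) * (X (Sum.inl i) - X (Sum.inr i)))
  let co : (Fin n → ℂ) → Fin n ⊕ Fin n → ℝ := fun z => Sum.elim (fun i => (z i).re)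
    (fun i => (z i).im)
  let ve : Fin n ⊕ Fin n → (Fin n → ℂ) := Sum.elim (fun i => Pi.single i 1)
    (fun i => Pi.single i Complex.I)
  have hcf : ∀ z j, (cf j).value z = (co z j : ℂ) := by
    intro z j
    rcases j with j | j
    · simp only [cf, co, ZPoly.value, Sum.elim_inl, map_mul, map_add, eval_C, eval_X, Sum.elim_inr]
      rw [Complex.add_conj]; push_cast; ring
    · simp only [cf, co, ZPoly.value, Sum.elim_inl, map_mul, map_sub, eval_C, eval_X, Sum.elim_inr]
      rw [Complex.sub_conj]; push_cast; field_simp [Complex.I_ne_zero]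
  refine ⟨∑ m ∈ Finset.range (M + 1), ∑ s : Fin m → Fin n ⊕ Fin n, C ((m.factorial : ℂ)⁻¹ *
    iteratedFDeriv ℝ m f 0 (fun i => ve (s i))) * ∏ i, cf (s i), ?_⟩
  refine (hf.hasTaylorBound M).congr_left fun z => ?_
  congr 1
  rw [ZPoly.value, map_sum]
  refine Finset.sum_congr rfl fun m _ => ?_
  have e : (fun _ : Fin m => z) = fun _ => ∑ j, co z j • ve j := by
    funext _ i
    rw [Fintype.sum_sum_type]
    simp only [co, ve, Sum.elim_inl, Sum.elim_inr, Pi.add_apply, Finset.sum_apply, Pi.smul_apply,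
      Pi.single_apply]
    simp
  rw [e, ContinuousMultilinearMap.map_sum, Finset.smul_sum, map_sum]
  refine Finset.sum_congr rfl fun s _ => ?_
  rw [ContinuousMultilinearMap.map_smul_univ]
  have : ∀ j, eval (Sum.elim z fun i => (starRingEnd ℂ) (z i)) (cf j) = (co z j : ℂ) := hcf z
  simp only [map_mul, eval_C, map_prod, this, Complex.real_smul]
  push_cast
  ring

theorem isBigO_norm_zgauge {μ : Fin n → ℝ} (hμ : ∀ i, 0 < μ i) {m : ℝ} (hm : 0 < m)
    (hmμ : ∀ i, m ≤ μ i) : (fun z : Fin n → ℂ => z) =O[𝓝 0] fun z => zgauge μ z ^ m :=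
  isBigO_zvec zgauge_nonneg (tendsto_zgauge hμ) hm hmμ fun i => isBigO_coord_zgauge hμ i

/-- The growth bound forces all monomials of a sufficiently high jet to have weight at least κ. The
component of weight κ is p; the other monomials and the remainder are smaller. -/
theorem exists_leadingPart {μ : Fin n → ℝ} (hμ : ∀ i, 0 < μ i) {q : (Fin n → ℂ) → ℂ}
    (hq : AnalyticAt ℂ q 0) {κ : ℝ} (hκ : 0 < κ) (h : q =O[𝓝 0] fun z => zgauge μ z ^ κ) :
    ∃ p : MvPolynomial (Fin n) ℂ, IsWeightedHomogeneous μ p κ ∧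
      (fun z => q z - eval z p) =o[𝓝 0] fun z => zgauge μ z ^ κ := by
  classical
  obtain ⟨m, hm, hm1, hmμ⟩ := exists_weight_bound hμ
  obtain ⟨M, hM⟩ := exists_nat_gt (κ / m)
  rw [div_lt_iff₀ hm] at hM
  obtain ⟨Q, hQ⟩ := exists_jet hq M
  have hQ' := hQ.trans_isLittleO (isLittleO_norm_pow zgauge_nonneg (tendsto_zgauge hμ)
    (isBigO_norm_zgauge hμ hm hmμ) M hκ (by linarith))
  have hQO : (fun z => eval z Q) =O[𝓝 0] fun z => zgauge μ z ^ κ :=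
    (h.sub hQ'.isBigO).congr_left fun z => by ring
  have hw := le_weight_of_isBigO_eval hμ hQO
  refine ⟨weightedHomogeneousComponent μ κ Q,
    weightedHomogeneousComponent_isWeightedHomogeneous κ Q, ?_⟩
  have h2 : (fun z => eval z (Q - weightedHomogeneousComponent μ κ Q)) =o[𝓝 0]
      fun z => zgauge μ z ^ κ := by
    refine isLittleO_eval zgauge_nonneg (tendsto_zgauge hμ) (fun i => (hμ i).le)
      (fun i => isBigO_coord_zgauge hμ i) _ hκ fun d hd => ?_
    rw [mem_support_iff, coeff_sub, coeff_weightedHomogeneousComponent] at hd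
    by_cases hdκ : Finsupp.weight μ d = κ
    · simp [hdκ] at hd
    · rw [if_neg hdκ, sub_zero] at hd
      exact lt_of_le_of_ne (hw d (mem_support_iff.2 hd)) (Ne.symm hdκ)
  refine (hQ'.add h2).congr_left fun z => ?_
  rw [map_sub]; ring

end Jets

/-! ### Holomorphic maps bounded for the gauge, and their inverses. -/

section GaugeBounded

variable {n : ℕ} {μ : Fin n → ℝ}

/-- The coordinates of a point `(z, w)`. -/
def coord : Option (Fin n) → Space n →ₗ[ℂ] ℂ
  | some i => (LinearMap.proj i).comp (LinearMap.fst ℂ _ _)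
  | none => LinearMap.snd ℂ _ _

theorem coord_some (i : Fin n) (x : Space n) : coord (some i) x = x.1 i := rfl

theorem coord_none (x : Space n) : coord none x = x.2 := rfl

theorem coord_cdir (j k : Option (Fin n)) :
    coord j (cdir k : Space n) = if j = k then 1 else 0 := by
  rcases j with _ | j <;> rcases k with _ | k <;> simp [coord, cdir, Pi.single_apply]

theorem sum_coord_smul_cdir (x : Space n) : ∑ j, coord j x • cdir j = x := by
  rw [Fintype.sum_option]
  ext i
  · simp [coord, cdir, Prod.fst_sum, Finset.sum_apply, Pi.single_apply]
  · simp [coord, cdir, Prod.snd_sum]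

theorem norm_coord_le (x : Space n) (j : Option (Fin n)) : ‖coord j x‖ ≤ ‖x‖ := by
  rcases j with _ | j
  · exact norm_snd_le x
  · exact (norm_le_pi_norm x.1 j).trans (norm_fst_le x)

theorem norm_coord_le_wgauge (hμ : ∀ i, 0 < μ i) (x : Space n) (j : Option (Fin n)) :
    ‖coord j x‖ ≤ wgauge μ x ^ realWeight μ j := by
  rcases j with _ | j
  · rw [realWeight, Real.rpow_one]; exact norm_snd_le_gauge x
  · exact norm_le_gauge_rpow hμ x j

variable {X : Type*} {l : Filter X} {ρ : X → ℝ}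

theorem isBigO_coord_of_isBigO_wgauge (hμ : ∀ i, 0 < μ i) (h0 : ∀ a, 0 ≤ ρ a) {y : X → Space n}
    (h : (fun a => wgauge μ (y a)) =O[l] ρ) (j : Option (Fin n)) :
    (fun a => coord j (y a)) =O[l] fun a => ρ a ^ realWeight μ j :=
  (IsBigO.of_norm_le fun a => norm_coord_le_wgauge hμ (y a) j).trans
    (h.rpow (realWeight_pos hμ j).le (Eventually.of_forall h0))

theorem isBigO_wgauge_of_coord (hμ : ∀ i, 0 < μ i) (h0 : ∀ a, 0 ≤ ρ a) {y : X → Space n}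
    (h : ∀ j, (fun a => coord j (y a)) =O[l] fun a => ρ a ^ realWeight μ j) :
    (fun a => wgauge μ (y a)) =O[l] ρ :=
  isBigO_gauge hμ h0 (fun i => h (some i)) (by simpa [realWeight, coord_none] using h none)

theorem isBigO_wgauge_iff (hμ : ∀ i, 0 < μ i) (h0 : ∀ a, 0 ≤ ρ a) {y : X → Space n} :
    (fun a => wgauge μ (y a)) =O[l] ρ ↔
      ∀ j, (fun a => coord j (y a)) =O[l] fun a => ρ a ^ realWeight μ j :=
  ⟨isBigO_coord_of_isBigO_wgauge hμ h0, isBigO_wgauge_of_coord hμ h0⟩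

theorem isBigO_wgauge_sub (hμ : ∀ i, 0 < μ i) (h0 : ∀ a, 0 ≤ ρ a) {y y' : X → Space n}
    (h : (fun a => wgauge μ (y a)) =O[l] ρ) (h' : (fun a => wgauge μ (y' a)) =O[l] ρ) :
    (fun a => wgauge μ (y a - y' a)) =O[l] ρ := by
  rw [isBigO_wgauge_iff hμ h0] at *
  intro j
  simpa only [map_sub] using (h j).sub (h' j)

/-- A linear map that does not lower weights is bounded for the gauge. -/
theorem isBigO_wgauge_linear (hμ : ∀ i, 0 < μ i) (A : Space n →ₗ[ℂ] Space n)
    (hA : ∀ j k, realWeight μ k < realWeight μ j → coord j (A (cdir k)) = 0) :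
    (fun x => wgauge μ (A x)) =O[𝓝 0] wgauge μ := by
  refine isBigO_wgauge_of_coord hμ gauge_nonneg fun j => ?_
  have e : ∀ x, coord j (A x) = ∑ k, coord k x * coord j (A (cdir k)) := fun x => by
    conv_lhs => rw [← sum_coord_smul_cdir x]
    simp only [map_sum, map_smul, smul_eq_mul]
  refine IsBigO.congr_left (f₁ := fun x => ∑ k, coord k x * coord j (A (cdir k))) ?_
    fun x => (e x).symm
  refine IsBigO.fun_sum fun k _ => ?_
  by_cases hk : realWeight μ k < realWeight μ j
  · simp only [hA j k hk, mul_zero]; exact isBigO_zero _ _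
  · have h1 : (fun x : Space n => coord k x) =O[𝓝 0] fun x => wgauge μ x ^ realWeight μ k :=
      IsBigO.of_norm_le fun x => norm_coord_le_wgauge hμ x k
    exact ((h1.trans (isBigO_rpow_of_le gauge_nonneg (tendsto_gauge hμ) (realWeight_pos hμ j)
      (not_lt.1 hk))).const_mul_left (coord j (A (cdir k)))).congr_left fun x => mul_comm _ _

/-- At t^w `cdir k`, with w the weight of k, differentiability gives t^w L(`cdir k`) + o(t^w),
whereas the gauge bound makes the j-th component o(t^w). -/
theorem coord_fderiv_eq_zero (hμ : ∀ i, 0 < μ i) {T : Space n → Space n}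
    (hT0 : T 0 = 0) {L : Space n →L[ℂ] Space n} (hL : HasFDerivAt T L 0)
    (hT : (fun x => wgauge μ (T x)) =O[𝓝 0] wgauge μ) (j k : Option (Fin n))
    (hjk : realWeight μ k < realWeight μ j) : coord j (L (cdir k)) = 0 := by
  set w := realWeight μ k
  have ht : Tendsto (fun t : ℝ => (t ^ w) • (cdir k : Space n)) (𝓝[>] 0) (𝓝 0) := by
    have := tendsto_sum_rpow_smul (fun _ : Fin 1 => (cdir k : Space n)) (fun _ => w)
      (fun _ => realWeight_pos hμ k) Finset.univ
    simpa using this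
  have h1 : (fun t : ℝ => coord j (T ((t ^ w) • (cdir k : Space n)))) =o[𝓝[>] 0]
      fun t : ℝ => t ^ w := by
    have h := (isBigO_coord_of_isBigO_wgauge hμ gauge_nonneg hT j).comp_tendsto ht
    have h2 : (fun t : ℝ => wgauge μ ((t ^ w) • (cdir k : Space n)) ^ realWeight μ j)
        =O[𝓝[>] 0] fun t : ℝ => t ^ realWeight μ j := by
      refine IsBigO.of_bound (wgauge μ (cdir k : Space n) ^ realWeight μ j) ?_
      filter_upwards [self_mem_nhdsWithin] with t ht
      have ht' : (0 : ℝ) < t := ht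
      have := gauge_sum_smul_cdir hμ (fun _ : Fin 1 => k) Finset.univ ht'.le
      simp only [Finset.univ_unique, Finset.sum_singleton] at this
      rw [this, Real.mul_rpow ht'.le (gauge_nonneg _), norm_mul,
        Real.norm_of_nonneg (Real.rpow_nonneg (gauge_nonneg _) _), mul_comm]
    exact (h.trans h2).trans_isLittleO (isLittleO_rpow_nhdsGT hjk)
  have h3 : (fun t : ℝ => coord j (T ((t ^ w) • (cdir k : Space n))) -
      ((t ^ w : ℝ) : ℂ) * coord j (L (cdir k))) =o[𝓝[>] 0] fun t : ℝ => t ^ w := by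
    have h := hL.isLittleO.comp_tendsto ht
    have h4 : (fun t : ℝ => (t ^ w) • (cdir k : Space n)) =O[𝓝[>] 0] fun t : ℝ => t ^ w := by
      refine IsBigO.of_bound ‖(cdir k : Space n)‖ (Eventually.of_forall fun t => ?_)
      rw [norm_smul, mul_comm]
    have h5 := (h.trans_isBigO (by simpa [Function.comp_def] using h4))
    refine IsBigO.trans_isLittleO (IsBigO.of_norm_le fun t => ?_) h5.norm_left
    have e : coord j (T ((t ^ w) • (cdir k : Space n))) -
      ((t ^ w : ℝ) : ℂ) * coord j (L (cdir k)) = coord j (T ((t ^ w) • (cdir k : Space n)) - T 0 -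
        L ((t ^ w) • (cdir k : Space n) - 0)) := by
      rw [hT0, sub_zero, sub_zero, map_sub, ← Complex.coe_smul (t ^ w) (cdir k : Space n), map_smul,
        map_smul, smul_eq_mul]
    rw [e]
    exact norm_coord_le _ j
  have h6 := coeff_eq_zero_of_isLittleO_sum_rpow {w} (fun _ => coord j (L (cdir k))) w
    ((h1.sub h3).congr_left fun t => by simp) w (by simp) le_rfl
  exact h6

/-- Vectors without components of weight above that of k form an L-invariant subspace. By finite
dimension L maps it onto itself, so the inverse preserves it as well. -/
theorem coord_symm_eq_zero (L : Space n ≃L[ℂ] Space n)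
    (hL : ∀ j k, realWeight μ k < realWeight μ j → coord j (L (cdir k)) = 0)
    (j k : Option (Fin n)) (hjk : realWeight μ k < realWeight μ j) :
    coord j (L.symm (cdir k)) = 0 := by
  set V : Submodule ℂ (Space n) :=
    ⨅ j ∈ {j | realWeight μ k < realWeight μ j}, LinearMap.ker (coord j) with hV
  have hmem : ∀ x, x ∈ V ↔ ∀ j, realWeight μ k < realWeight μ j → coord j x = 0 := fun x => by
    simp [hV, Submodule.mem_iInf]
  have hle : V.map (L.toLinearEquiv : Space n →ₗ[ℂ] Space n) ≤ V := by
    rintro _ ⟨x, hx, rfl⟩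
    rw [hmem]
    intro j hj
    have hx' := (hmem x).1 hx
    have e : coord j (L x) = ∑ i, coord i x * coord j (L (cdir i)) := by
      conv_lhs => rw [← sum_coord_smul_cdir x]
      simp only [map_sum, map_smul, smul_eq_mul]
    change coord j (L x) = 0
    rw [e]
    refine Finset.sum_eq_zero fun i _ => ?_
    by_cases hi : realWeight μ k < realWeight μ i
    · rw [hx' i hi, zero_mul]
    · rw [hL j i (lt_of_le_of_lt (not_lt.1 hi) hj), mul_zero]
  have heq : V.map (L.toLinearEquiv : Space n →ₗ[ℂ] Space n) = V :=
    Submodule.eq_of_le_of_finrank_eq hle (LinearEquiv.finrank_map_eq L.toLinearEquiv V)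
  have hk : (cdir k : Space n) ∈ V := by
    rw [hmem]
    intro i hi
    rw [coord_cdir, if_neg]
    rintro rfl
    exact lt_irrefl _ hi
  rw [← heq] at hk
  obtain ⟨x, hx, hxe⟩ := hk
  have : L.symm (cdir k) = x := by
    rw [← hxe]; exact L.symm_apply_apply x
  rw [this]
  exact (hmem x).1 hx j hjk

/-- Successive approximations to the inverse of `A`. -/
noncomputable def approxInverse (A : Space n → Space n) : ℕ → Space n → Space n
  | 0, y => y
  | k + 1, y => y - (A (approxInverse A k y) - approxInverse A k y)

/-- Near 0 the map A - id has a Lipschitz constant of the size of its arguments, so each Picard step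
gains one order of accuracy. A step only composes with A and subtracts, which keeps the gauge bound.
-/
theorem approxInverse_spec (hμ : ∀ i, 0 < μ i) {A : Space n → Space n} (hA : AnalyticAt ℂ A 0)
    (hA0 : A 0 = 0) (hA1 : HasFDerivAt A (ContinuousLinearMap.id ℂ (Space n)) 0)
    (hAμ : (fun x => wgauge μ (A x)) =O[𝓝 0] wgauge μ) (k : ℕ) :
    (approxInverse A k) =O[𝓝 0] (fun x => x) ∧
    (fun x => wgauge μ (approxInverse A k x)) =O[𝓝 0] wgauge μ ∧
    (fun x => approxInverse A k (A x) - x) =O[𝓝 0] fun x => ‖x‖ ^ (k + 2) := by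
  obtain ⟨p, hp⟩ := hA
  have hlip := hp.isBigO_image_sub_norm_mul_norm_sub
  have hp1 : ∀ v : Space n, p 1 (fun _ => v) = v := fun v => by
    have := hp.hasFDerivAt.unique hA1
    have := congrArg (fun B => B v) this
    have e : (fun _ : Fin 1 => v) = ![v] := by funext i; fin_cases i; rfl
    rw [e]
    simpa using this
  simp only [hp1] at hlip
  have hAt : Tendsto A (𝓝 0) (𝓝 0) := by
    have := hA1.continuousAt.tendsto; rwa [hA0] at this
  have hAO : A =O[𝓝 0] fun x => x := by
    simpa [hA0] using hA1.isBigO_sub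
  induction k with
  | zero =>
    refine ⟨isBigO_refl _ _, isBigO_refl _ _, ?_⟩
    have ht : Tendsto (fun x : Space n => (x, (0 : Space n))) (𝓝 0) (𝓝 ((0 : Space n), 0)) :=
      (Continuous.prodMk_left (0 : Space n)).tendsto' 0 _ rfl
    have := hlip.comp_tendsto ht
    refine (this.congr_left fun x => ?_).trans (IsBigO.of_norm_le fun x => ?_)
    · simp [approxInverse, hA0]
    · simp [pow_two]
  | succ k ih =>
    obtain ⟨h1, h2, h3⟩ := ih
    have ht1 : Tendsto (approxInverse A k) (𝓝 0) (𝓝 0) := h1.trans_tendsto tendsto_id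
    refine ⟨?_, ?_, ?_⟩
    · exact (isBigO_refl _ _).sub (((hAO.comp_tendsto ht1).trans h1).sub h1)
    · exact isBigO_wgauge_sub hμ gauge_nonneg (isBigO_refl _ _)
        (isBigO_wgauge_sub hμ gauge_nonneg ((hAμ.comp_tendsto ht1).trans h2) h2)
    · have h4 : (fun x => approxInverse A k (A x)) =O[𝓝 0] fun x => x :=
        (h1.comp_tendsto hAt).trans hAO
      have ht : Tendsto (fun x => (x, approxInverse A k (A x))) (𝓝 0) (𝓝 ((0 : Space n), 0)) :=
        tendsto_id.prodMk_nhds (ht1.comp hAt)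
      have h5 := hlip.comp_tendsto ht
      have h6 : (fun x : Space n => (x, approxInverse A k (A x))) =O[𝓝 0] fun x => x :=
        (isBigO_refl _ _).prod_left h4
      have h7 : (fun x => ‖(x, approxInverse A k (A x)) - ((0 : Space n), (0 : Space n))‖ *
          ‖x - approxInverse A k (A x)‖) =O[𝓝 0] fun x => ‖x‖ * ‖x‖ ^ (k + 2) := by
        refine IsBigO.mul ?_ ?_
        · refine (h6.norm_left.congr_left fun x => ?_).norm_right
          simp
        · refine h3.norm_left.congr_left fun x => ?_
          rw [norm_sub_rev]
      refine ((h5.trans h7).congr_left fun x => ?_).congr_right fun x => ?_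
      · simp only [Function.comp_apply, approxInverse]; abel
      · ring

/-- The inverse of a transformation that is bounded for the gauge is bounded for the gauge. -/
theorem isBigO_wgauge_image (hμ : ∀ i, 0 < μ i) {T : Space n → Space n} (hT : AnalyticAt ℂ T 0)
    (hT0 : T 0 = 0) {L : Space n ≃L[ℂ] Space n} (hL : HasFDerivAt T (L : Space n →L[ℂ] Space n) 0)
    (hTμ : (fun x => wgauge μ (T x)) =O[𝓝 0] wgauge μ) :
    wgauge μ =O[𝓝 0] fun x => wgauge μ (T x) := by
  have hLw := coord_fderiv_eq_zero hμ hT0 hL hTμ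
  have hLs := coord_symm_eq_zero L hLw
  have hlin := isBigO_wgauge_linear hμ (L.symm.toLinearEquiv : Space n →ₗ[ℂ] Space n) hLs
  -- Dividing out the differential, which respects weights in both directions, leaves a map tangent
  -- to the identity.
  have hTt : Tendsto T (𝓝 0) (𝓝 0) := by
    have := hL.continuousAt.tendsto; rwa [hT0] at this
  set A : Space n → Space n := fun x => L.symm (T x) with hA
  have hAa : AnalyticAt ℂ A 0 := (L.symm : Space n →L[ℂ] Space n).analyticAt _ |>.comp hT
  have hA0 : A 0 = 0 := by simp [hA, hT0]
  have hA1 : HasFDerivAt A (ContinuousLinearMap.id ℂ (Space n)) 0 := by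
    have := (L.symm : Space n →L[ℂ] Space n).hasFDerivAt.comp (0 : Space n) hL
    refine this.congr_fderiv ?_
    ext x <;> simp
  have hAT : (fun x => wgauge μ (A x)) =O[𝓝 0] fun x => wgauge μ (T x) := hlin.comp_tendsto hTt
  have hAμ := hAT.trans hTμ
  refine IsBigO.trans ?_ hAT
  have hAt : Tendsto A (𝓝 0) (𝓝 0) := by
    have := hA1.continuousAt.tendsto; rwa [hA0] at this
  obtain ⟨m, hm, hm1, hmμ⟩ := exists_weight_bound hμ
  -- All weights are at most 1 + Σ μ_i and x = O(gauge(A x)^m), so for this K the inversion error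
  -- ‖x‖^(K + 2) is admissible in every component.
  obtain ⟨K, hK⟩ := exists_nat_gt ((1 + ∑ i, μ i) / m)
  rw [div_lt_iff₀ hm] at hK
  obtain ⟨-, h2, h3⟩ := approxInverse_spec hμ hAa hA0 hA1 hAμ K
  have hxA : (fun x : Space n => x) =O[𝓝 0] A := by
    have h := hA1.isLittleO
    simp only [hA0, sub_zero, ContinuousLinearMap.id_apply] at h
    have := h.symm.right_isBigO_sub
    simpa using this
  have hAm : A =O[𝓝 0] fun x => wgauge μ (A x) ^ m := by
    have : (fun x : Space n => x) =O[𝓝 0] fun x => wgauge μ x ^ m :=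
      isBigO_vec gauge_nonneg (tendsto_gauge hμ) hm hmμ hm1 (fun i => isBigO_coord_wgauge hμ i _)
        (isBigO_snd_wgauge _)
    exact this.comp_tendsto hAt
  have hgA : Tendsto (fun x => wgauge μ (A x)) (𝓝 0) (𝓝 0) := (tendsto_gauge hμ).comp hAt
  refine isBigO_wgauge_of_coord (y := fun x => x) hμ (fun x => gauge_nonneg _) fun j => ?_
  have hw : realWeight μ j ≤ 1 + ∑ i, μ i := by
    rcases j with _ | j
    · exact le_add_of_nonneg_right (Finset.sum_nonneg fun i _ => (hμ i).le)
    · exact (Finset.single_le_sum (f := μ) (fun i _ => (hμ i).le) (Finset.mem_univ j)).trans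
        (le_add_of_nonneg_left zero_le_one)
  have h4 : (fun x => ‖x‖ ^ (K + 2)) =O[𝓝 0] fun x => wgauge μ (A x) ^ realWeight μ j :=
    isBigO_norm_pow (fun x => gauge_nonneg _) hgA (hxA.trans hAm) (K + 2) (realWeight_pos hμ j)
      (by push_cast; nlinarith)
  have h5 : (fun x => coord j (approxInverse A K (A x))) =O[𝓝 0]
      fun x => wgauge μ (A x) ^ realWeight μ j :=
    (isBigO_coord_of_isBigO_wgauge hμ gauge_nonneg h2 j).comp_tendsto hAt
  have h6 : (fun x => coord j (approxInverse A K (A x) - x)) =O[𝓝 0]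
      fun x => wgauge μ (A x) ^ realWeight μ j :=
    ((IsBigO.of_norm_le fun x => norm_coord_le _ j).trans h3.norm_left).trans h4
  refine (h5.sub h6).congr_left fun x => ?_
  rw [map_sub]; ring

end GaugeBounded

/-! ### Local biholomorphisms and their differentials at the origin. -/

section Coordinates

variable {n : ℕ} {M : Set (Space n)} {p : Space n} {Φ T : Space n → Space n}

theorem IsBiholomorphicAt.exists_inverse (hT : IsBiholomorphicAt T 0) (hT0 : T 0 = 0) :
    ∃ S : Space n → Space n, IsBiholomorphicAt S 0 ∧ S 0 = 0 ∧ (∀ᶠ x in 𝓝 0, S (T x) = x) ∧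
      ∀ᶠ x in 𝓝 0, T (S x) = x := by
  obtain ⟨ha, L, hL⟩ := hT
  have hc : ContDiffAt ℂ ω T 0 := ha.contDiffAt
  have hs : HasStrictFDerivAt T (L : Space n →L[ℂ] Space n) 0 := by
    have := ha.hasStrictFDerivAt
    rwa [hL.fderiv] at this
  refine ⟨hc.localInverse hL (by simp), ⟨?_, L.symm, ?_⟩, ?_, ?_, ?_⟩
  · have := hc.to_localInverse hL (by simp)
    rw [hT0] at this
    exact this.analyticAt
  · have := hs.to_localInverse.hasFDerivAt
    rw [hT0] at this
    exact this
  · have := hc.localInverse_apply_image hL (by simp)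
    rwa [hT0] at this
  · exact hs.eventually_left_inverse
  · have := hs.eventually_right_inverse
    rwa [hT0] at this

theorem IsBiholomorphicAt.comp (hT : IsBiholomorphicAt T (Φ p)) (hΦ : IsBiholomorphicAt Φ p) :
    IsBiholomorphicAt (T ∘ Φ) p := by
  obtain ⟨ha, L, hL⟩ := hT
  obtain ⟨hb, K, hK⟩ := hΦ
  exact ⟨ha.comp hb, K.trans L, hL.comp p hK⟩

theorem IsCoordinatesAt.comp (hΦ : IsCoordinatesAt p Φ) (hT : IsBiholomorphicAt T 0)
    (hT0 : T 0 = 0) : IsCoordinatesAt p (T ∘ Φ) :=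
  ⟨IsBiholomorphicAt.comp (by rwa [hΦ.2]) hΦ.1, by simp [hΦ.2, hT0]⟩

theorem IsBiholomorphicAt.map_nhds (hΦ : IsBiholomorphicAt Φ p) : map Φ (𝓝 p) = 𝓝 (Φ p) := by
  obtain ⟨ha, L, hL⟩ := hΦ
  have := ha.hasStrictFDerivAt
  rw [hL.fderiv] at this
  exact this.map_nhds_eq_of_equiv

theorem IsBiholomorphicAt.tendsto (hT : IsBiholomorphicAt T 0) (hT0 : T 0 = 0) :
    Tendsto T (𝓝 0) (𝓝 0) := by
  have := hT.1.continuousAt.tendsto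
  rwa [hT0] at this

/-- A transformation that preserves the tangent hyperplane `v = 0` has differential
`w* = c w` in the last coordinate. -/
theorem PreservesTangent.exists_coeff (h : PreservesTangent T) (hT : IsBiholomorphicAt T 0) :
    ∃ c : ℝ, c ≠ 0 ∧ ∀ ξ, (fderiv ℂ T 0 ξ).2 = c * ξ.2 := by
  obtain ⟨ha, L, hL⟩ := hT
  rw [PreservesTangent, hL.fderiv] at h
  rw [hL.fderiv]
  -- The hyperplane v = 0 contains the complex subspace w = 0, so on it both the last component and
  -- i times it have zero imaginary part.
  have h0 : ∀ z : Fin n → ℂ, (L (z, 0)).2 = 0 := fun z => by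
    have h1 := h (z, 0) (by simp)
    have h2 := h (Complex.I • (z, 0)) (by simp)
    rw [map_smul] at h2
    simp only [ContinuousLinearEquiv.coe_coe, Prod.smul_snd, smul_eq_mul, Complex.mul_im,
      Complex.I_re, Complex.I_im, zero_mul, one_mul, zero_add] at h1 h2
    exact Complex.ext h2 h1
  have h1 := h (0, 1) (by simp)
  have h2 : ∀ ξ : Space n, (L ξ).2 = (((L (0, 1)).2.re : ℝ) : ℂ) * ξ.2 := fun ξ => by
    have e : ξ = (ξ.1, 0) + ξ.2 • ((0, 1) : Space n) := by ext <;> simp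
    conv_lhs => rw [e, map_add, map_smul]
    rw [Prod.snd_add, h0, zero_add, Prod.smul_snd, smul_eq_mul, mul_comm]
    congr 1
    exact Complex.ext rfl h1
  refine ⟨_, fun hc => ?_, h2⟩
  have := h2 (L.symm (0, 1))
  rw [hc] at this
  simp at this

theorem preservesTangent_of_coeff {c : ℝ} (h : ∀ ξ, (fderiv ℂ T 0 ξ).2 = c * ξ.2) :
    PreservesTangent T := fun ξ hξ => by
  rw [h, Complex.im_ofReal_mul, hξ, mul_zero]

theorem coeff_inverse {S : Space n → Space n} (hT : IsBiholomorphicAt T 0)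
    (hS : IsBiholomorphicAt S 0) (hS0 : S 0 = 0) (hTS : ∀ᶠ x in 𝓝 0, T (S x) = x) {c : ℝ}
    (hc : c ≠ 0) (h : ∀ ξ, (fderiv ℂ T 0 ξ).2 = c * ξ.2) (ξ : Space n) :
    (fderiv ℂ S 0 ξ).2 = (c⁻¹ : ℝ) * ξ.2 := by
  have h1 : HasFDerivAt (fun x => T (S x)) ((fderiv ℂ T 0).comp (fderiv ℂ S 0)) 0 := by
    refine HasFDerivAt.comp (0 : Space n) ?_ hS.1.differentiableAt.hasFDerivAt
    rw [hS0]
    exact hT.1.differentiableAt.hasFDerivAt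
  have h2 : HasFDerivAt (fun x => T (S x)) (ContinuousLinearMap.id ℂ (Space n)) 0 :=
    (hasFDerivAt_id (0 : Space n)).congr_of_eventuallyEq hTS
  have h3 := congrArg (fun B : Space n →L[ℂ] Space n => (B ξ).2) (h1.unique h2)
  simp only [ContinuousLinearMap.comp_apply, h, ContinuousLinearMap.id_apply] at h3
  rw [← h3, Complex.ofReal_inv, inv_mul_cancel_left₀ (Complex.ofReal_ne_zero.2 hc)]

end Coordinates

/-! ### Hypersurfaces as graphs in two coordinate systems. -/

section Graphs

variable {n : ℕ} {M : Set (Space n)} {p : Space n} {Φ T : Space n → Space n}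

/-- The point of the graph `v = F (z, u)` over `(z, u)`. -/
noncomputable def graphPt (F : (Fin n → ℂ) × ℝ → ℝ) (x : (Fin n → ℂ) × ℝ) : Space n :=
  (x.1, x.2 + F x * Complex.I)

theorem graphPt_fst (F : (Fin n → ℂ) × ℝ → ℝ) (x : (Fin n → ℂ) × ℝ) : (graphPt F x).1 = x.1 := rfl

theorem graphPt_re (F : (Fin n → ℂ) × ℝ → ℝ) (x : (Fin n → ℂ) × ℝ) :
    (graphPt F x).2.re = x.2 := by simp [graphPt]

theorem graphPt_im (F : (Fin n → ℂ) × ℝ → ℝ) (x : (Fin n → ℂ) × ℝ) :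
    (graphPt F x).2.im = F x := by simp [graphPt]

theorem tendsto_graphPt {F : (Fin n → ℂ) × ℝ → ℝ} (hF : Tendsto F (𝓝 0) (𝓝 0)) :
    Tendsto (graphPt F) (𝓝 0) (𝓝 0) := by
  have h1 : Tendsto (fun x : (Fin n → ℂ) × ℝ => x.1) (𝓝 0) (𝓝 0) := continuous_fst.tendsto' _ _ rfl
  have h2 : Tendsto (fun x : (Fin n → ℂ) × ℝ => (x.2 : ℂ)) (𝓝 0) (𝓝 0) :=
    (Complex.continuous_ofReal.comp continuous_snd).tendsto' _ _ (by simp)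
  have h3 : Tendsto (fun x => (F x : ℂ) * Complex.I) (𝓝 0) (𝓝 0) := by
    have := ((Complex.continuous_ofReal.tendsto 0).comp hF).mul_const Complex.I
    simpa using this
  have := h1.prodMk_nhds (h2.add h3)
  rw [add_zero] at this
  exact this

theorem IsGraphIn.tendsto {F : (Fin n → ℂ) × ℝ → ℝ} (hF : IsGraphIn M p Φ F) :
    Tendsto F (𝓝 0) (𝓝 0) := by
  have := hF.1.self_of_nhds.continuousAt.tendsto
  rwa [hF.2.1] at this

theorem IsGraphIn.hasFDerivAt {F : (Fin n → ℂ) × ℝ → ℝ} (hF : IsGraphIn M p Φ F) :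
    HasFDerivAt F (0 : (Fin n → ℂ) × ℝ →L[ℝ] ℝ) 0 := by
  have := (hF.1.self_of_nhds.differentiableAt (by simp)).hasFDerivAt
  rwa [hF.2.2.1] at this

theorem IsGraphIn.eventually_iff {F F' : (Fin n → ℂ) × ℝ → ℝ} (hΦ : IsCoordinatesAt p Φ)
    (hF : IsGraphIn M p Φ F) (hF' : IsGraphIn M p (T ∘ Φ) F') :
    ∀ᶠ y in 𝓝 (0 : Space n), (y.2.im = F (y.1, y.2.re) ↔
      (T y).2.im = F' ((T y).1, (T y).2.re)) := by
  have h := hΦ.1.map_nhds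
  rw [hΦ.2] at h
  rw [← h, eventually_map]
  filter_upwards [hF.2.2.2, hF'.2.2.2] with q h1 h2
  exact h1.symm.trans h2

theorem IsGraphIn.eventually_apply {F F' : (Fin n → ℂ) × ℝ → ℝ} (hΦ : IsCoordinatesAt p Φ)
    (hF : IsGraphIn M p Φ F) (hF' : IsGraphIn M p (T ∘ Φ) F') :
    ∀ᶠ x in 𝓝 (0 : (Fin n → ℂ) × ℝ), (T (graphPt F x)).2.im =
      F' ((T (graphPt F x)).1, (T (graphPt F x)).2.re) := by
  filter_upwards [(tendsto_graphPt hF.tendsto).eventually (hF.eventually_iff hΦ hF')] with x hx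
  refine hx.1 ?_
  rw [graphPt_im, graphPt_re, graphPt_fst]

theorem hasFDerivAt_graphPt {F : (Fin n → ℂ) × ℝ → ℝ}
    (hF : HasFDerivAt F (0 : (Fin n → ℂ) × ℝ →L[ℝ] ℝ) 0) :
    HasFDerivAt (graphPt F) ((ContinuousLinearMap.fst ℝ _ _).prod
      (Complex.ofRealCLM.comp (ContinuousLinearMap.snd ℝ (Fin n → ℂ) ℝ))) 0 := by
  refine (hasFDerivAt_fst).prodMk ?_
  have h1 := (Complex.ofRealCLM.comp
    (ContinuousLinearMap.snd ℝ (Fin n → ℂ) ℝ)).hasFDerivAt (x := (0 : (Fin n → ℂ) × ℝ))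
  have h2 := (Complex.ofRealCLM.hasFDerivAt.comp (0 : (Fin n → ℂ) × ℝ) hF).mul_const Complex.I
  refine (h1.add h2).congr_fderiv ?_
  ext <;> simp

/-- Differentiate the relation between the graphs at the origin: F and F' have zero differential
there, so vectors with v = 0 are mapped to vectors with v* = 0. -/
theorem preservesTangent_of_isGraphIn {F F' : (Fin n → ℂ) × ℝ → ℝ} (hΦ : IsCoordinatesAt p Φ)
    (hT : IsBiholomorphicAt T 0) (hT0 : T 0 = 0) (hF : IsGraphIn M p Φ F)
    (hF' : IsGraphIn M p (T ∘ Φ) F') : PreservesTangent T := by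
  have hγ := hasFDerivAt_graphPt hF.hasFDerivAt
  have hγ0 : graphPt F 0 = 0 := by simp [graphPt, hF.2.1]
  have hTd : HasFDerivAt T ((fderiv ℂ T 0).restrictScalars ℝ) (graphPt F 0) := by
    rw [hγ0]; exact hT.1.differentiableAt.hasFDerivAt.restrictScalars ℝ
  have h1 := hTd.comp (0 : (Fin n → ℂ) × ℝ) hγ
  have him := Complex.imCLM.hasFDerivAt.comp (0 : (Fin n → ℂ) × ℝ) h1.snd
  have hpt := h1.fst.prodMk (Complex.reCLM.hasFDerivAt.comp (0 : (Fin n → ℂ) × ℝ) h1.snd)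
  have hF'd : HasFDerivAt F' (0 : (Fin n → ℂ) × ℝ →L[ℝ] ℝ)
      (((T ∘ graphPt F) 0).1, Complex.reCLM ((T ∘ graphPt F) 0).2) := by
    have : (((T ∘ graphPt F) 0).1, Complex.reCLM ((T ∘ graphPt F) 0).2) = 0 := by
      simp [hγ0, hT0]
    rw [this]; exact hF'.hasFDerivAt
  have h2 := hF'd.comp (0 : (Fin n → ℂ) × ℝ) hpt
  have h3 := him.congr_of_eventuallyEq
    (f₁ := F' ∘ fun x => (((T ∘ graphPt F) x).1, Complex.reCLM ((T ∘ graphPt F) x).2)) (by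
      filter_upwards [hF.eventually_apply hΦ hF'] with x hx
      exact hx.symm)
  have h4 := h3.unique h2
  intro ξ hξ
  have h5 := congrArg (fun B : (Fin n → ℂ) × ℝ →L[ℝ] ℝ => B (ξ.1, ξ.2.re)) h4
  have e : ((ξ.1, ((ξ.2.re : ℝ) : ℂ)) : Space n) = ξ :=
    Prod.ext rfl (Complex.ext (by simp) (by simp [hξ]))
  simpa [e] using h5

end Graphs

/-- Smoothness of order ∞ at the origin alone does not spread to a neighbourhood. At a nearby point
f coincides locally with the implicit function based there, by uniqueness, and is smooth for that
reason. -/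
theorem exists_smooth_implicit {E : Type*} [NormedAddCommGroup E] [NormedSpace ℝ E]
    [CompleteSpace E] {Ψ : E × ℝ → ℝ} {c : ℝ} (hc : c ≠ 0)
    (hΨ : ∀ᶠ v in 𝓝 0, ContDiffAt ℝ ∞ Ψ v) (h0 : Ψ 0 = 0)
    (hd : HasFDerivAt Ψ (c • ContinuousLinearMap.snd ℝ E ℝ) 0) :
    ∃ f : E → ℝ, f 0 = 0 ∧ (∀ᶠ x in 𝓝 0, ContDiffAt ℝ ∞ f x) ∧ fderiv ℝ f 0 = 0 ∧
      ∀ᶠ v in 𝓝 (0 : E × ℝ), (Ψ v = 0 ↔ v.2 = f v.1) := by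
  have hn : (∞ : ℕ∞ω) ≠ 0 := by simp
  have hinv : ∀ᶠ v in 𝓝 (0 : E × ℝ),
      (fderiv ℝ Ψ v ∘L .inr ℝ E ℝ).IsInvertible := by
    have hcont : ContinuousAt (fun v => fderiv ℝ Ψ v (0, 1)) 0 := by
      have : ContinuousAt (fderiv ℝ Ψ) 0 :=
        (hΨ.self_of_nhds.fderiv_right (m := 0) (by simp)).continuousAt
      exact this.clm_apply continuousAt_const
    have hne : fderiv ℝ Ψ 0 ((0 : E), (1 : ℝ)) ≠ 0 := by
      rw [hd.fderiv]; simpa using hc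
    filter_upwards [hcont.eventually_ne hne] with v hv
    refine ⟨ContinuousLinearEquiv.unitsEquivAut ℝ (Units.mk0 _ hv), ?_⟩
    ext
    simp
  have hcd := hΨ.self_of_nhds
  have if₂ := hinv.self_of_nhds
  set f := hcd.implicitFunction hn if₂ with hf
  have hf0 : f 0 = 0 := hcd.implicitFunction_apply_self hn if₂
  have hfc : ContDiffAt ℝ ∞ f 0 := hcd.contDiffAt_implicitFunction hn if₂
  have hiff : ∀ᶠ v in 𝓝 (0 : E × ℝ), (Ψ v = 0 ↔ v.2 = f v.1) := by
    filter_upwards [hcd.eventually_apply_eq_iff_implicitFunction hn if₂] with v hv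
    rw [h0] at hv
    rw [hv, eq_comm]
  refine ⟨f, hf0, ?_, ?_, hiff⟩
  · have hcont : ∀ᶠ x in 𝓝 0, ContinuousAt f x := by
      have h1 : ContDiffAt ℝ 1 f 0 := hfc.of_le (by simp)
      filter_upwards [h1.eventually (by simp)] with x hx
      exact hx.continuousAt
    have ht : Tendsto (fun x => (x, f x)) (𝓝 0) (𝓝 (0 : E × ℝ)) := by
      have h2 := hfc.continuousAt.tendsto
      rw [hf0] at h2
      exact tendsto_id.prodMk_nhds h2
    filter_upwards [hcont, ht.eventually hΨ, ht.eventually hinv,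
      ht.eventually hiff.eventually_nhds] with x hx h1 h2 h3
    have hg : ContDiffAt ℝ ∞ (h1.implicitFunction hn h2) x :=
      h1.contDiffAt_implicitFunction hn h2
    refine hg.congr_of_eventuallyEq ?_
    have ht' : Tendsto (fun y => (y, f y)) (𝓝 x) (𝓝 (x, f x)) := tendsto_id.prodMk_nhds hx.tendsto
    have h4 := ht'.eventually (h1.eventually_apply_eq_iff_implicitFunction hn h2)
    have h5 : Ψ (x, f x) = 0 := h3.self_of_nhds.2 rfl
    filter_upwards [h4, ht'.eventually h3] with y h6 h7
    rw [h5] at h6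
    exact (h6.1 (h7.2 rfl)).symm
  · have h1 := (hcd.hasStrictFDerivAt_implicitFunction hn if₂).hasFDerivAt.fderiv
    change fderiv ℝ f 0 = _ at h1
    have h2 : fderiv ℝ Ψ 0 ∘L .inl ℝ E ℝ = 0 := by
      rw [hd.fderiv]; ext; simp
    rw [h1, h2, ContinuousLinearMap.comp_zero, neg_zero]

/-! ### Existence of the graph in new coordinates. -/

section Graphs

variable {n : ℕ} {M : Set (Space n)} {p : Space n} {Φ T : Space n → Space n}

theorem IsGraphIn.exists_comp {F : (Fin n → ℂ) × ℝ → ℝ} (hΦ : IsCoordinatesAt p Φ)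
    (hF : IsGraphIn M p Φ F) (hT : IsBiholomorphicAt T 0) (hT0 : T 0 = 0)
    (hTt : PreservesTangent T) : ∃ F', IsGraphIn M p (T ∘ Φ) F' := by
  obtain ⟨S, hS, hS0, hST, hTS⟩ := hT.exists_inverse hT0
  obtain ⟨c, hc, hcT⟩ := hTt.exists_coeff hT
  have hcS := coeff_inverse hT hS hS0 hTS hc hcT
  let ι : ((Fin n → ℂ) × ℝ) × ℝ →L[ℝ] Space n :=
    ((ContinuousLinearMap.fst ℝ _ _).comp (ContinuousLinearMap.fst ℝ _ _)).prod
      (Complex.ofRealCLM.comp ((ContinuousLinearMap.snd ℝ _ _).comp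
        (ContinuousLinearMap.fst ℝ _ _)) +
        Complex.I • Complex.ofRealCLM.comp (ContinuousLinearMap.snd ℝ _ _))
  have hι1 : ∀ v, (ι v).1 = v.1.1 := fun v => rfl
  have hιre : ∀ v, (ι v).2.re = v.1.2 := fun v => by simp [ι]
  have hιim : ∀ v, (ι v).2.im = v.2 := fun v => by simp [ι]
  let π : Space n →L[ℝ] (Fin n → ℂ) × ℝ := (ContinuousLinearMap.fst ℝ _ _).prod
    (Complex.reCLM.comp (ContinuousLinearMap.snd ℝ _ _))
  let τ : Space n →L[ℝ] ℝ := Complex.imCLM.comp (ContinuousLinearMap.snd ℝ _ _)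
  -- The defining function v - F(z, u) pulled back by the inverse S; its differential at the origin
  -- is c⁻¹ dv, so the implicit function theorem applies.
  let Ψ : ((Fin n → ℂ) × ℝ) × ℝ → ℝ := fun v => τ (S (ι v)) - F (π (S (ι v)))
  have hιt : Tendsto ι (𝓝 0) (𝓝 0) := ι.continuous.tendsto' _ _ (map_zero _)
  have hπt : Tendsto π (𝓝 0) (𝓝 0) := π.continuous.tendsto' _ _ (map_zero _)
  have hSt := hS.tendsto hS0
  have hSd : HasFDerivAt S ((fderiv ℂ S 0).restrictScalars ℝ) (ι 0) := by
    rw [map_zero]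
    exact hS.1.differentiableAt.hasFDerivAt.restrictScalars ℝ
  have hΨd : HasFDerivAt Ψ (c⁻¹ • ContinuousLinearMap.snd ℝ ((Fin n → ℂ) × ℝ) ℝ) 0 := by
    have h1 := hSd.comp (0 : ((Fin n → ℂ) × ℝ) × ℝ) ι.hasFDerivAt
    have h2 := τ.hasFDerivAt.comp (0 : ((Fin n → ℂ) × ℝ) × ℝ) h1
    have hFd : HasFDerivAt F (0 : (Fin n → ℂ) × ℝ →L[ℝ] ℝ) (π ((S ∘ ι) 0)) := by
      simp only [Function.comp_apply, map_zero, hS0]; exact hF.hasFDerivAt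
    have h3 := hFd.comp (0 : ((Fin n → ℂ) × ℝ) × ℝ)
      (π.hasFDerivAt.comp (0 : ((Fin n → ℂ) × ℝ) × ℝ) h1)
    refine (h2.sub h3).congr_fderiv ?_
    refine ContinuousLinearMap.ext fun v => ?_
    have h4 : τ (fderiv ℂ S 0 (ι v)) = c⁻¹ * v.2 := by
      change (fderiv ℂ S 0 (ι v)).2.im = _
      rw [hcS, Complex.im_ofReal_mul, hιim]
    simpa using h4
  have hΨs : ∀ᶠ v in 𝓝 0, ContDiffAt ℝ ∞ Ψ v := by
    have hSs : ∀ᶠ y in 𝓝 (0 : Space n), ContDiffAt ℝ ∞ S y := by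
      filter_upwards [hS.1.eventually_analyticAt] with y hy
      exact (hy.restrictScalars (𝕜 := ℝ)).contDiffAt
    filter_upwards [hιt.eventually hSs, ((hπt.comp hSt).comp hιt).eventually hF.1] with v h1 h2
    have h3 : ContDiffAt ℝ ∞ (fun v => S (ι v)) v := h1.comp v ι.contDiff.contDiffAt
    exact (τ.contDiff.contDiffAt.comp v h3).sub
      (ContDiffAt.comp v h2 (π.contDiff.contDiffAt.comp v h3))
  obtain ⟨F', h0, hs, hd, hiff⟩ := exists_smooth_implicit (inv_ne_zero hc) hΨs
    (by simp [Ψ, hS0, hF.2.1]) hΨd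
  refine ⟨F', hs, h0, hd, ?_⟩
  have hΦt : Tendsto Φ (𝓝 p) (𝓝 0) := by
    have := hΦ.1.1.continuousAt.tendsto
    rwa [hΦ.2] at this
  let κ : Space n →L[ℝ] ((Fin n → ℂ) × ℝ) × ℝ := π.prod τ
  have hκι : ∀ y, ι (κ y) = y := fun y =>
    Prod.ext rfl (Complex.ext (hιre (κ y)) (hιim (κ y)))
  have hκt : Tendsto κ (𝓝 0) (𝓝 0) := κ.continuous.tendsto' _ _ (map_zero _)
  filter_upwards [hF.2.2.2, hΦt.eventually hST,
    ((hκt.comp (hT.tendsto hT0)).comp hΦt).eventually hiff] with q h1 h2 h3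
  rw [h1]
  refine Iff.trans ?_ h3
  change _ ↔ τ (S (ι (κ (T (Φ q))))) - F (π (S (ι (κ (T (Φ q)))))) = 0
  rw [hκι, h2, sub_eq_zero]
  rfl

end Graphs

/-! ### Leading terms of maps and the transformation rule for leading parts. -/

section Expansion

variable {n : ℕ} {μ : Fin n → ℝ}

theorem tendsto_fst_nhds_zero {E F : Type*} [NormedAddCommGroup E] [NormedAddCommGroup F] :
    Tendsto (fun y : E × F => y.1) (𝓝 0) (𝓝 0) := continuous_fst.tendsto' _ _ rfl

theorem isBigO_zgauge_fst_rpow {K : Type*} [NormedAddCommGroup K] {κ : ℝ} (hκ : 0 ≤ κ) :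
    (fun y : (Fin n → ℂ) × K => zgauge μ y.1 ^ κ) =O[𝓝 0] fun y => wgauge μ y ^ κ := by
  refine IsBigO.rpow hκ (Eventually.of_forall gauge_nonneg) (IsBigO.of_bound 1 ?_)
  refine Eventually.of_forall fun y => ?_
  rw [one_mul, Real.norm_of_nonneg (zgauge_nonneg _), Real.norm_of_nonneg (gauge_nonneg _)]
  exact zgauge_le_gauge y

theorem tendsto_prodMk_zero : Tendsto (fun z : Fin n → ℂ => ((z, 0) : Space n)) (𝓝 0) (𝓝 0) :=
  (Continuous.prodMk_left (0 : ℂ)).tendsto' 0 _ rfl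

theorem analyticAt_coord_prodMk_zero {S : Space n → Space n} (hS : AnalyticAt ℂ S 0)
    (j : Option (Fin n)) : AnalyticAt ℂ (fun z : Fin n → ℂ => coord j (S (z, 0))) 0 := by
  have h1 : AnalyticAt ℂ (fun z : Fin n → ℂ => ((z, 0) : Space n)) 0 :=
    (ContinuousLinearMap.inl ℂ (Fin n → ℂ) ℂ).analyticAt 0
  have h2 : AnalyticAt ℂ (fun z : Fin n → ℂ => S (z, 0)) 0 := AnalyticAt.fun_comp hS h1
  exact (LinearMap.toContinuousLinearMap (coord j : Space n →ₗ[ℂ] ℂ)).analyticAt _ |>.fun_comp h2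

/-- A holomorphic map bounded for the gauge has homogeneous leading terms. -/
theorem exists_expansion (hμ : ∀ i, 0 < μ i) (hμ1 : ∀ i, μ i < 1) {S : Space n → Space n}
    (hS : AnalyticAt ℂ S 0) (hSμ : (fun y => wgauge μ (S y)) =O[𝓝 0] wgauge μ) {c : ℂ}
    (hc : ∀ ξ, (fderiv ℂ S 0 ξ).2 = c * ξ.2) :
    ∃ (k : Fin n → MvPolynomial (Fin n) ℂ) (D : MvPolynomial (Fin n) ℂ),
      (∀ i, IsWeightedHomogeneous μ (k i) (μ i)) ∧ IsWeightedHomogeneous μ D 1 ∧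
      (∀ i, (fun y : Space n => (S y).1 i - eval y.1 (k i)) =o[𝓝 0] fun y => wgauge μ y ^ μ i) ∧
      (fun y : Space n => (S y).2 - c * y.2 - eval y.1 D) =o[𝓝 0] wgauge μ := by
  have hq : ∀ j, (fun z : Fin n → ℂ => coord j (S (z, 0))) =O[𝓝 0]
      fun z => zgauge μ z ^ realWeight μ j := fun j => by
    refine ((isBigO_coord_of_isBigO_wgauge hμ gauge_nonneg hSμ j).comp_tendsto
      tendsto_prodMk_zero).congr_right fun z => ?_
    simp only [Function.comp_apply, gauge_zero_right]
  choose k hk hko using fun j => exists_leadingPart hμ (analyticAt_coord_prodMk_zero hS j)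
    (realWeight_pos hμ j) (hq j)
  have hko' : ∀ j, (fun y : Space n => coord j (S (y.1, 0)) - eval y.1 (k j)) =o[𝓝 0]
      fun y => wgauge μ y ^ realWeight μ j := fun j =>
    ((hko j).comp_tendsto tendsto_fst_nhds_zero).trans_isBigO
      (isBigO_zgauge_fst_rpow (realWeight_pos hμ j).le)
  have ht : Tendsto (fun y : Space n => (y, ((y.1, 0) : Space n))) (𝓝 0) (𝓝 ((0 : Space n), 0)) :=
    tendsto_id.prodMk_nhds (tendsto_prodMk_zero.comp tendsto_fst_nhds_zero)
  have hw : (fun y : Space n => y - ((y.1, 0) : Space n)) =O[𝓝 0] wgauge μ :=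
    IsBigO.of_norm_le fun y => by
      have : y - ((y.1, 0) : Space n) = (0, y.2) := by ext <;> simp
      rw [this, Prod.norm_mk, norm_zero, max_eq_right (norm_nonneg _)]
      exact norm_snd_le_gauge y
  -- The leading terms come from S(z, 0). Passing to S(z, w) costs O(|w|), negligible against
  -- gauge^(μ i) as μ i < 1; in the last component the differential contributes exactly c w.
  have hd := (hS.hasStrictFDerivAt.isLittleO.comp_tendsto ht).trans_isBigO hw
  have hO : (fun y : Space n => S y - S (y.1, 0)) =O[𝓝 0] wgauge μ :=
    (hS.hasStrictFDerivAt.isBigO_sub.comp_tendsto ht).trans hw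
  refine ⟨fun i => k (some i), k none, fun i => hk (some i), hk none, fun i => ?_, ?_⟩
  · have h1 : (fun y : Space n => coord (some i) (S y - S (y.1, 0))) =o[𝓝 0]
        fun y => wgauge μ y ^ μ i := by
      refine ((IsBigO.of_norm_le fun y => norm_coord_le _ _).trans hO.norm_left).trans_isLittleO ?_
      have := isLittleO_rpow_of_lt (gauge_nonneg (μ := μ) (K := ℂ)) (tendsto_gauge hμ) (hμ i)
        (hμ1 i)
      simpa using this
    refine (h1.add (hko' (some i))).congr_left fun y => ?_
    rw [map_sub, coord_some, coord_some]; ring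
  · have h1 : (fun y : Space n => (S y - S (y.1, 0) - fderiv ℂ S 0 (y - (y.1, 0))).2) =o[𝓝 0]
        wgauge μ := IsBigO.trans_isLittleO (IsBigO.of_norm_le fun y => norm_snd_le _) hd.norm_left
    have h2 := hko' none
    simp only [realWeight, Real.rpow_one] at h2
    refine (h1.add h2).congr_left fun y => ?_
    rw [Prod.snd_sub, hc, coord_none, Prod.snd_sub, Prod.snd_sub]; ring

/-- Comparison of the leading parts of the defining functions of two graphs that correspond to each
other under a map with given leading terms. -/
theorem isLittleO_graph_transfer (hμ : ∀ i, 0 < μ i) {P : ZPoly n}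
    (hP : IsWeightedHomogeneous (Sum.elim μ μ) P 1) {F F' : (Fin n → ℂ) × ℝ → ℝ}
    (hF : (fun x => (F x : ℂ) - P.value x.1) =o[𝓝 0] wgauge μ) (hF' : Tendsto F' (𝓝 0) (𝓝 0))
    {S : Space n → Space n} (hS : Tendsto S (𝓝 0) (𝓝 0)) {c : ℝ} (hc : c ≠ 0)
    {k : Fin n → MvPolynomial (Fin n) ℂ}
    {D : MvPolynomial (Fin n) ℂ} (hk : ∀ i, IsWeightedHomogeneous μ (k i) (μ i))
    (hD : IsWeightedHomogeneous μ D 1)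
    (hSk : ∀ i, (fun y : Space n => (S y).1 i - eval y.1 (k i)) =o[𝓝 0] fun y => wgauge μ y ^ μ i)
    (hSD : (fun y : Space n => (S y).2 - c * y.2 - eval y.1 D) =o[𝓝 0] wgauge μ)
    (hrel : ∀ᶠ x in 𝓝 0, (S (graphPt F' x)).2.im =
      F ((S (graphPt F' x)).1, (S (graphPt F' x)).2.re)) :
    (fun x => (F' x : ℂ) - ZPoly.value (C (c⁻¹ : ℂ) * (P.subst k - imPart D)) x.1) =o[𝓝 0]
      wgauge μ := by
  -- No bound of F' by the gauge is known beforehand. It is included in the comparison function and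
  -- absorbed at the end, where F' - P' = o(ρ) forces F' = O(gauge).
  set ρ : (Fin n → ℂ) × ℝ → ℝ := fun x => wgauge μ x + |F' x| with hρ
  have hρ0 : ∀ x, 0 ≤ ρ x := fun x => add_nonneg (gauge_nonneg x) (abs_nonneg _)
  have hρt : Tendsto ρ (𝓝 0) (𝓝 0) := by
    have := (tendsto_gauge hμ (K := ℝ)).add hF'.abs
    simpa using this
  have hγt := tendsto_graphPt hF'
  have hNγ : (fun x => wgauge μ (graphPt F' x)) =O[𝓝 0] ρ := by
    refine IsBigO.of_norm_le fun x => ?_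
    rw [Real.norm_of_nonneg (gauge_nonneg _)]
    have : ‖(graphPt F' x).2‖ ≤ ‖x.2‖ + |F' x| := by
      refine (norm_add_le _ _).trans ?_
      simp
    simp only [hρ, wgauge, graphPt_fst] at *
    linarith
  have hNγκ : ∀ {κ : ℝ}, 0 ≤ κ → (fun x => wgauge μ (graphPt F' x) ^ κ) =O[𝓝 0]
      fun x => ρ x ^ κ := fun hκ => hNγ.rpow hκ (Eventually.of_forall hρ0)
  have hz : ∀ i, (fun x : (Fin n → ℂ) × ℝ => x.1 i) =O[𝓝 0] fun x => ρ x ^ μ i := fun i =>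
    (isBigO_coord_wgauge hμ i _).trans (IsBigO.rpow (hμ i).le (Eventually.of_forall hρ0)
      (IsBigO.of_norm_le fun x => by
        rw [Real.norm_of_nonneg (gauge_nonneg _)]
        exact le_add_of_nonneg_right (abs_nonneg _)))
  have hkO : ∀ i, (fun x : (Fin n → ℂ) × ℝ => eval x.1 (k i)) =O[𝓝 0] fun x => ρ x ^ μ i :=
    fun i => isBigO_eval hρ0 hρt (fun j => (hμ j).le) hz (k i) (hμ i)
      fun d hd => (hk i (mem_support_iff.1 hd)).ge
  have hSk' : ∀ i, (fun x => (S (graphPt F' x)).1 i - eval x.1 (k i)) =o[𝓝 0]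
      fun x => ρ x ^ μ i := fun i =>
    ((hSk i).comp_tendsto hγt).trans_isBigO (hNγκ (hμ i).le)
  have hSO : ∀ i, (fun x => (S (graphPt F' x)).1 i) =O[𝓝 0] fun x => ρ x ^ μ i := fun i =>
    ((hSk' i).isBigO.add (hkO i)).congr_left fun x => by ring
  have hSD' : (fun x => (S (graphPt F' x)).2 - c * (graphPt F' x).2 - eval x.1 D) =o[𝓝 0] ρ :=
    (hSD.comp_tendsto hγt).trans_isBigO hNγ
  have hDO : (fun x : (Fin n → ℂ) × ℝ => eval x.1 D) =O[𝓝 0] ρ := by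
    have := isBigO_eval hρ0 hρt (fun j => (hμ j).le) hz D one_pos
      fun d hd => (hD (mem_support_iff.1 hd)).ge
    simpa using this
  have hwO : (fun x => (graphPt F' x).2) =O[𝓝 0] ρ := (isBigO_snd_wgauge _).comp_tendsto hγt |>.trans
    hNγ
  have hS2O : (fun x => (S (graphPt F' x)).2) =O[𝓝 0] ρ :=
    ((hSD'.isBigO.add hDO).add (hwO.const_mul_left (c : ℂ))).congr_left fun x => by ring
  set σ : (Fin n → ℂ) × ℝ → (Fin n → ℂ) × ℝ := fun x =>
    ((S (graphPt F' x)).1, (S (graphPt F' x)).2.re) with hσ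
  have hσt : Tendsto σ (𝓝 0) (𝓝 0) := by
    have h1 := hS.comp hγt
    exact (tendsto_fst_nhds_zero.comp h1).prodMk_nhds
      (((Complex.continuous_re.comp continuous_snd).tendsto' (0 : Space n) 0 rfl).comp h1)
  have hσO : (fun x => wgauge μ (σ x)) =O[𝓝 0] ρ := isBigO_gauge hμ hρ0 hSO
    ((IsBigO.of_norm_le fun x => (Complex.abs_re_le_norm _)).trans hS2O.norm_left)
  have h1 : (fun x => (F (σ x) : ℂ) - P.value (σ x).1) =o[𝓝 0] ρ :=
    (hF.comp_tendsto hσt).trans_isBigO hσO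
  have h2 : (fun x => P.value (σ x).1 - P.value fun i => eval x.1 (k i)) =o[𝓝 0] ρ := by
    have := ZPoly.isLittleO_value_sub_value hμ hρ0 hSO hSk' hP
    simpa using this
  have h3 : (fun x => (((S (graphPt F' x)).2 - c * (graphPt F' x).2 - eval x.1 D).im : ℂ)) =o[𝓝 0]
      ρ := IsBigO.trans_isLittleO (IsBigO.of_norm_le fun x => by
        rw [Complex.norm_real]; exact Complex.abs_im_le_norm _) hSD'.norm_left
  set P' : ZPoly n := C (c⁻¹ : ℂ) * (P.subst k - imPart D) with hP'
  have hc' : (c : ℂ) ≠ 0 := Complex.ofReal_ne_zero.2 hc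
  have hP'v : ∀ z, P'.value z = (c⁻¹ : ℂ) * (P.value (fun i => eval z (k i)) - (eval z D).im) :=
    fun z => by
      rw [hP', ← ZPoly.value_subst, ← value_imPart]
      simp only [ZPoly.value, map_mul, eval_C, map_sub]
  -- Up to o(ρ), the relation `hrel` reads c F' + Im D = P(k(z)).
  have h4 : (fun x => (F' x : ℂ) - P'.value x.1) =o[𝓝 0] ρ := by
    refine (((h1.add h2).sub h3).const_mul_left (c⁻¹ : ℂ)).congr' ?_ EventuallyEq.rfl
    filter_upwards [hrel] with x hx
    rw [hP'v]
    simp only [hσ, Complex.sub_im, Complex.im_ofReal_mul, hx, graphPt_im]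
    push_cast
    field_simp
    ring
  have hP'h : IsWeightedHomogeneous (Sum.elim μ μ) P' 1 := IsWeightedHomogeneous.C_mul
    ((ZPoly.isWeightedHomogeneous_subst hP hk).sub (isWeightedHomogeneous_imPart hD)) _
  have hP'O : (fun x : (Fin n → ℂ) × ℝ => P'.value x.1) =O[𝓝 0] wgauge μ := by
    have := ZPoly.isBigO_value hμ gauge_nonneg (tendsto_gauge hμ)
      (fun i => isBigO_coord_wgauge hμ i (𝓝 (0 : (Fin n → ℂ) × ℝ))) P' one_pos
      fun d hd => (hP'h (mem_support_iff.1 hd)).ge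
    simpa using this
  refine h4.trans_isBigO ?_
  have h5 : (fun x => |F' x|) =O[𝓝 0] wgauge μ := by
    have h6 := h4.bound (c := 1 / 2) (by norm_num)
    obtain ⟨K, hK⟩ := hP'O.bound
    refine IsBigO.of_bound (2 * (1 / 2 + K)) ?_
    filter_upwards [h6, hK] with x h6 h7
    have h8 : |F' x| ≤ ‖(F' x : ℂ) - P'.value x.1‖ + ‖P'.value x.1‖ := by
      have := norm_add_le ((F' x : ℂ) - P'.value x.1) (P'.value x.1)
      simpa using this
    rw [Real.norm_of_nonneg (hρ0 x)] at h6
    rw [Real.norm_of_nonneg (gauge_nonneg x)] at h7 ⊢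
    rw [Real.norm_of_nonneg (abs_nonneg _)]
    simp only [hρ] at h6
    linarith
  exact (isBigO_refl _ _).add h5

end Expansion

/-! ### Leading parts: superhomogeneity by the gauge, transfer, uniqueness, reality. -/

section LeadingPart

variable {n : ℕ} {M : Set (Space n)} {p : Space n} {Φ T : Space n → Space n} {Λ : Fin n → ℚ}
  {P : ZPoly n}

theorem ZPoly.contDiff_value (P : ZPoly n) : ContDiff ℝ ∞ P.value := by
  have : P.value = fun z => ∑ d ∈ P.support, coeff d P *
      ∏ j, Sum.elim z (fun i => (starRingEnd ℂ) (z i)) j ^ d j := by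
    funext z
    rw [ZPoly.value, eval_eq']
  rw [this]
  refine ContDiff.sum fun d _ => contDiff_const.mul (contDiff_prod fun j _ => ContDiff.pow ?_ _)
  rcases j with j | j
  · exact contDiff_apply ℝ ℂ j
  · exact Complex.conjCLE.contDiff.comp (contDiff_apply ℝ ℂ j)

theorem contDiffAt_sub_value {F : (Fin n → ℂ) × ℝ → ℝ} (hF : ContDiffAt ℝ ∞ F 0) (P : ZPoly n) :
    ContDiffAt ℝ ∞ (fun x => (F x : ℂ) - P.value x.1) 0 :=
  (Complex.ofRealCLM.contDiff.contDiffAt.comp 0 hF).sub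
    ((P.contDiff_value.comp contDiff_fst).contDiffAt)

/-- Bounded for the gauge, in terms of weighted orders. -/
theorem isSuperhomogeneous_iff (hΛ : ∀ i, 0 < Λ i) (hT : AnalyticAt ℂ T 0) :
    IsSuperhomogeneous Λ T ↔ PreservesTangent T ∧
      (fun y => wgauge (fun i => (Λ i : ℝ)) (T y)) =O[𝓝 0] wgauge fun i => (Λ i : ℝ) := by
  have hμ : ∀ i, (0 : ℝ) < Λ i := fun i => Rat.cast_pos.2 (hΛ i)
  have hai : ∀ j, AnalyticAt ℂ (fun y : Space n => coord j (T y) - coord j y) 0 := fun j =>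
    ((LinearMap.toContinuousLinearMap (coord j : Space n →ₗ[ℂ] ℂ)).analyticAt _ |>.fun_comp hT).sub
      ((LinearMap.toContinuousLinearMap (coord j : Space n →ₗ[ℂ] ℂ)).analyticAt _)
  -- The identity satisfies the same bounds, so f and g may be exchanged for the components of T.
  have hid : ∀ j, (fun y : Space n => coord j y) =O[𝓝 0]
      fun y => wgauge (fun i => (Λ i : ℝ)) y ^ realWeight (fun i => (Λ i : ℝ)) j := fun j =>
    IsBigO.of_norm_le fun x => norm_coord_le_wgauge hμ x j
  refine and_congr_right fun _ => ?_
  constructor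
  · rintro ⟨h1, h2⟩
    refine isBigO_wgauge_of_coord hμ gauge_nonneg fun j => ?_
    have h3 : (fun y : Space n => coord j (T y) - coord j y) =O[𝓝 0]
        fun y => wgauge (fun i => (Λ i : ℝ)) y ^ realWeight (fun i => (Λ i : ℝ)) j := by
      rcases j with _ | j
      · have := isBigO_gauge_of_weightedOrderGE hΛ (hai none) one_pos h2
        rwa [Rat.cast_one] at this
      · exact isBigO_gauge_of_weightedOrderGE hΛ (hai (some j)) (hΛ j) (h1 j)
    exact (h3.add (hid j)).congr_left fun y => by ring
  · intro h
    have h3 : ∀ j, (fun y : Space n => coord j (T y) - coord j y) =O[𝓝 0]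
        fun y => wgauge (fun i => (Λ i : ℝ)) y ^ realWeight (fun i => (Λ i : ℝ)) j := fun j =>
      (isBigO_coord_of_isBigO_wgauge hμ gauge_nonneg h j).sub (hid j)
    refine ⟨fun i => weightedOrderGE_of_isBigO_gauge hΛ (hai (some i)) (hΛ i) (h3 (some i)),
      weightedOrderGE_of_isBigO_gauge hΛ (hai none) one_pos ?_⟩
    have := h3 none
    rwa [realWeight, ← Rat.cast_one (α := ℝ)] at this

theorem HasLeadingPart.isLittleO (hΛ : ∀ i, 0 < Λ i) {F : (Fin n → ℂ) × ℝ → ℝ}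
    (hF : IsGraphIn M p Φ F) (h : IsLittleO Λ (fun x => (F x : ℂ) - P.value x.1)) :
    (fun x => (F x : ℂ) - P.value x.1) =o[𝓝 0] wgauge fun i => (Λ i : ℝ) :=
  isLittleO_gauge_of_isLittleO hΛ (contDiffAt_sub_value hF.1.self_of_nhds P) h

theorem HasLeadingPart.exists_graph (hΛ : ∀ i, 0 < Λ i) (h : HasLeadingPart M p Λ Φ P) :
    IsCoordinatesAt p Φ ∧ ∃ F, IsGraphIn M p Φ F ∧
      (fun x => (F x : ℂ) - P.value x.1) =o[𝓝 0] wgauge fun i => (Λ i : ℝ) := by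
  obtain ⟨hΦ, F, hF, hP⟩ := h
  exact ⟨hΦ, F, hF, HasLeadingPart.isLittleO hΛ hF hP⟩

theorem HasLeadingPart.of_graph (hΛ : ∀ i, 0 < Λ i) (hΦ : IsCoordinatesAt p Φ)
    {F : (Fin n → ℂ) × ℝ → ℝ} (hF : IsGraphIn M p Φ F)
    (h : (fun x => (F x : ℂ) - P.value x.1) =o[𝓝 0] wgauge fun i => (Λ i : ℝ)) :
    HasLeadingPart M p Λ Φ P :=
  ⟨hΦ, F, hF, isLittleO_of_isLittleO_gauge hΛ (contDiffAt_sub_value hF.1.self_of_nhds P) h⟩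

/-- The leading part in new coordinates. -/
theorem HasLeadingPart.transfer (hΛ : ∀ i, 0 < Λ i) (hP : IsHomogeneousOne Λ P)
    (h : HasLeadingPart M p Λ Φ P) (hT : IsBiholomorphicAt T 0) (hT0 : T 0 = 0)
    (hTt : PreservesTangent T) {S : Space n → Space n} (hS : Tendsto S (𝓝 0) (𝓝 0))
    (hST : ∀ᶠ x in 𝓝 0, S (T x) = x) {c : ℝ} (hc : c ≠ 0)
    {k : Fin n → MvPolynomial (Fin n) ℂ} {D : MvPolynomial (Fin n) ℂ}
    (hk : ∀ i, IsWeightedHomogeneous (fun i => (Λ i : ℝ)) (k i) (Λ i : ℝ))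
    (hD : IsWeightedHomogeneous (fun i => (Λ i : ℝ)) D 1)
    (hSk : ∀ i, (fun y : Space n => (S y).1 i - eval y.1 (k i)) =o[𝓝 0]
      fun y => wgauge (fun i => (Λ i : ℝ)) y ^ (Λ i : ℝ))
    (hSD : (fun y : Space n => (S y).2 - c * y.2 - eval y.1 D) =o[𝓝 0]
      wgauge fun i => (Λ i : ℝ)) :
    HasLeadingPart M p Λ (T ∘ Φ) (C (c⁻¹ : ℂ) * (P.subst k - imPart D)) ∧
      IsHomogeneousOne Λ (C (c⁻¹ : ℂ) * (P.subst k - imPart D) : ZPoly n) := by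
  have hμ : ∀ i, (0 : ℝ) < Λ i := fun i => Rat.cast_pos.2 (hΛ i)
  obtain ⟨hΦ, F, hF, hFP⟩ := h.exists_graph hΛ
  obtain ⟨F', hF'⟩ := hF.exists_comp hΦ hT hT0 hTt
  rw [isHomogeneousOne_iff] at hP ⊢
  refine ⟨HasLeadingPart.of_graph hΛ (hΦ.comp hT hT0) hF' ?_, IsWeightedHomogeneous.C_mul
    ((ZPoly.isWeightedHomogeneous_subst hP hk).sub (isWeightedHomogeneous_imPart hD)) _⟩
  refine isLittleO_graph_transfer hμ hP hFP hF'.tendsto hS hc hk hD hSk hSD ?_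
  have h1 := hF.eventually_iff hΦ hF'
  have hTt' := hT.tendsto hT0
  have hmap : map T (𝓝 0) = 𝓝 0 := by
    have := hT.map_nhds
    rwa [hT0] at this
  have h2 : ∀ᶠ y in 𝓝 (0 : Space n), (y.2.im = F' (y.1, y.2.re) →
      (S y).2.im = F ((S y).1, (S y).2.re)) := by
    rw [← hmap, eventually_map]
    filter_upwards [h1, hST] with y h3 h4 h5
    rw [h4]
    exact h3.2 h5
  filter_upwards [(tendsto_graphPt hF'.tendsto).eventually h2] with x hx
  refine hx ?_
  rw [graphPt_im, graphPt_re, graphPt_fst]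

theorem leadingPart_unique {μ : Fin n → ℝ} (hμ : ∀ i, 0 < μ i) {f : (Fin n → ℂ) × ℝ → ℂ}
    {P Q : ZPoly n} (hP : IsWeightedHomogeneous (Sum.elim μ μ) P 1)
    (hQ : IsWeightedHomogeneous (Sum.elim μ μ) Q 1)
    (h : (fun x => f x - P.value x.1) =o[𝓝 0] wgauge μ)
    (h' : (fun x => f x - Q.value x.1) =o[𝓝 0] wgauge μ) : P = Q := by
  have ht : Tendsto (fun z : Fin n → ℂ => (z, (0 : ℝ))) (𝓝 0) (𝓝 0) :=
    (Continuous.prodMk_left (0 : ℝ)).tendsto' 0 _ rfl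
  have h1 := (h'.sub h).comp_tendsto ht
  rw [← sub_eq_zero]
  refine ZPoly.eq_zero_of_isLittleO_value hμ (hP.sub hQ) (h1.congr (fun z => ?_) fun z => ?_)
  · simp [ZPoly.value]
  · simp [gauge_zero_right]

/-- The complex conjugate of a polynomial in `z` and its conjugate. -/
noncomputable def ZPoly.conjSwap (P : ZPoly n) : ZPoly n :=
  rename Sum.swap (map (starRingEnd ℂ) P)

theorem ZPoly.polar_conjSwap (P : ZPoly n) (x η : Fin n → ℂ) :
    P.conjSwap.polar x η = (starRingEnd ℂ) (P.polar (conjv η) (conjv x)) := by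
  have e : (Sum.elim x η ∘ Sum.swap) = fun j => (starRingEnd ℂ)
      (Sum.elim (conjv η) (conjv x) j) := by
    funext j
    rcases j with j | j <;> simp [conjv]
  rw [ZPoly.polar, ZPoly.conjSwap, eval_rename, e, ZPoly.polar, eval_map, eval₂_eq', eval_eq',
    map_sum]
  refine Finset.sum_congr rfl fun d _ => ?_
  simp [map_prod]

theorem ZPoly.value_conjSwap (P : ZPoly n) (z : Fin n → ℂ) :
    P.conjSwap.value z = (starRingEnd ℂ) (P.value z) := by
  rw [ZPoly.value_eq_polar, ZPoly.polar_conjSwap, conjv_conjv, ← ZPoly.value_eq_polar]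

/-- As F is real, the conjugate of P is a leading part as well, and leading parts are unique. -/
theorem leadingPart_real {μ : Fin n → ℝ} (hμ : ∀ i, 0 < μ i) {F : (Fin n → ℂ) × ℝ → ℝ}
    {P : ZPoly n} (hP : IsWeightedHomogeneous (Sum.elim μ μ) P 1)
    (h : (fun x => (F x : ℂ) - P.value x.1) =o[𝓝 0] wgauge μ) : P.conjSwap = P := by
  have hQh : IsWeightedHomogeneous (Sum.elim μ μ) P.conjSwap 1 := by
    refine isWeightedHomogeneous_rename (w := Sum.elim μ μ) _ (fun j => by rcases j <;> rfl) ?_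
    intro d hd
    refine hP (d := d) fun h => hd ?_
    rw [coeff_map, h, map_zero]
  refine (leadingPart_unique hμ hP hQh h
    (h.norm_left.congr_left fun x => ?_).of_norm_left).symm
  rw [← Complex.norm_conj, map_sub, Complex.conj_ofReal, ZPoly.value_conjSwap]

end LeadingPart

/-! ### Spans of derivatives of slices, and the dichotomy behind the normalization. -/

section DerivSpan

variable {n : ℕ} {μ : Fin n → ℝ} {P : ZPoly n}

/-- The polynomial in `z` obtained by freezing the conjugate variables. -/
noncomputable def ZPoly.slice (P : ZPoly n) (η : Fin n → ℂ) : MvPolynomial (Fin n) ℂ :=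
  aeval (Sum.elim X fun j => C (η j)) P

theorem ZPoly.eval_slice (P : ZPoly n) (x η : Fin n → ℂ) : eval x (P.slice η) = P.polar x η := by
  rw [ZPoly.slice, ← MvPolynomial.coe_aeval_eq_eval, RingHom.coe_coe, ← AlgHom.comp_apply,
    ZPoly.polar, ← MvPolynomial.coe_aeval_eq_eval, RingHom.coe_coe]
  congr 1
  refine MvPolynomial.algHom_ext fun j => ?_
  rcases j with j | j <;> simp

/-- The subspace contains all slices of `P` with respect to conjugate variables of weight at least
`μ i`, and is closed under differentiation with respect to variables of such weights. -/
def IsDerivClosed (μ : Fin n → ℝ) (P : ZPoly n) (i : Fin n)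
    (V : Submodule ℂ (MvPolynomial (Fin n) ℂ)) : Prop :=
  (∀ η : Fin n → ℂ, (∀ j, μ j < μ i → η j = 0) → P.slice η ∈ V) ∧
    ∀ k, μ i ≤ μ k → ∀ p ∈ V, pderiv k p ∈ V

/-- The span of the iterated derivatives of the slices of `P`. -/
noncomputable def derivSpan (μ : Fin n → ℝ) (P : ZPoly n) (i : Fin n) :
    Submodule ℂ (MvPolynomial (Fin n) ℂ) :=
  sInf {V | IsDerivClosed μ P i V}

theorem isDerivClosed_derivSpan (i : Fin n) : IsDerivClosed μ P i (derivSpan μ P i) := by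
  constructor
  · intro η hη
    rw [derivSpan, Submodule.mem_sInf]
    exact fun V hV => hV.1 η hη
  · intro k hk p hp
    rw [derivSpan, Submodule.mem_sInf] at hp ⊢
    exact fun V hV => hV.2 k hk p (hp V hV)

theorem derivSpan_le {i : Fin n} {V : Submodule ℂ (MvPolynomial (Fin n) ℂ)}
    (h : IsDerivClosed μ P i V) : derivSpan μ P i ≤ V := sInf_le h

theorem component_pderiv (k : Fin n) (κ : ℝ) (p : MvPolynomial (Fin n) ℂ) :
    weightedHomogeneousComponent μ κ (pderiv k p) =
      pderiv k (weightedHomogeneousComponent μ (κ + μ k) p) := by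
  classical
  ext d
  rw [coeff_weightedHomogeneousComponent, coeff_pderiv, coeff_pderiv,
    coeff_weightedHomogeneousComponent, map_add, Finsupp.weight_single, one_smul]
  simp only [add_left_inj]
  split_ifs <;> simp

/-- By homogeneity of P, dilating x amounts to dilating η inversely, up to the factor s^κ. So these
weighted sums of components are multiples of slices. -/
theorem sum_component_slice {κ : ℝ} (hP : IsWeightedHomogeneous (Sum.elim μ μ) P κ)
    (η : Fin n → ℂ) {s : ℝ} (hs : 0 < s) :
    ∑ k ∈ (P.slice η).support.image (Finsupp.weight μ), ((s ^ k : ℝ) : ℂ) •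
      weightedHomogeneousComponent μ k (P.slice η) =
    ((s ^ κ : ℝ) : ℂ) • P.slice fun j => ((s ^ (-μ j) : ℝ) : ℂ) * η j := by
  refine MvPolynomial.funext fun x => ?_
  simp only [map_sum, smul_eval]
  rw [← eval_scaled μ hs x, ZPoly.eval_slice, ZPoly.eval_slice]
  rw [ZPoly.polar, ZPoly.polar, ← eval_scaled_of_isWeightedHomogeneous hs _ hP]
  congr 2
  funext j
  rcases j with j | j
  · simp
  · simp only [Sum.elim_inr, ← mul_assoc, ← Complex.ofReal_mul, ← Real.rpow_add hs]
    simp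

/-- A linear functional vanishing on the span vanishes on the slices at all dilates of η, hence on Σ
s^k (component k) for all s > 0, hence on each component. Derivatives commute with taking components
up to a shift of the weight. -/
theorem component_mem_derivSpan {κ : ℝ} (hP : IsWeightedHomogeneous (Sum.elim μ μ) P κ)
    {i : Fin n} {p : MvPolynomial (Fin n) ℂ} (hp : p ∈ derivSpan μ P i) (k : ℝ) :
    weightedHomogeneousComponent μ k p ∈ derivSpan μ P i := by
  classical
  have hV := isDerivClosed_derivSpan (μ := μ) (P := P) i
  set V := derivSpan μ P i
  suffices h : V ≤ ⨅ k, V.comap (weightedHomogeneousComponent μ k) by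
    have := h hp
    rw [Submodule.mem_iInf] at this
    exact this k
  refine derivSpan_le ⟨fun η hη => ?_, fun j hj q hq => ?_⟩
  · rw [Submodule.mem_iInf]
    intro k
    rw [Submodule.mem_comap]
    by_cases hk : k ∈ (P.slice η).support.image (Finsupp.weight μ)
    · by_contra hcon
      obtain ⟨f, hf, hVf⟩ := Submodule.exists_le_ker_of_notMem hcon
      refine hf (coeff_eq_zero_of_isLittleO_sum_rpow _
        (fun k => f (weightedHomogeneousComponent μ k (P.slice η))) k ?_ k hk le_rfl)
      refine (isLittleO_zero _ _).congr' ?_ EventuallyEq.rfl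
      filter_upwards [self_mem_nhdsWithin] with s hs
      have h1 := congrArg f (sum_component_slice hP η hs)
      simp only [map_sum, map_smul, smul_eq_mul] at h1
      have h2 : f (P.slice fun j => ((s ^ (-μ j) : ℝ) : ℂ) * η j) = 0 :=
        hVf (hV.1 _ fun j hj => by rw [hη j hj, mul_zero])
      rw [h1, h2, mul_zero]
    · have : weightedHomogeneousComponent μ k (P.slice η) = 0 := by
        refine weightedHomogeneousComponent_eq_zero' _ _ fun d hd hdk => hk ?_
        rw [← hdk]
        exact Finset.mem_image_of_mem _ hd
      rw [this]
      exact V.zero_mem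
  · rw [Submodule.mem_iInf] at hq ⊢
    intro k
    rw [Submodule.mem_comap, component_pderiv]
    exact hV.2 j hj _ (hq _)

theorem pderiv_pderiv_comm (j k : Fin n) (p : MvPolynomial (Fin n) ℂ) :
    pderiv j (pderiv k p) = pderiv k (pderiv j p) := by
  by_cases h : j = k
  · rw [h]
  · ext m
    rw [coeff_pderiv, coeff_pderiv, coeff_pderiv, coeff_pderiv, add_right_comm, Finsupp.add_apply,
      Finsupp.add_apply, Finsupp.single_eq_of_ne (Ne.symm h), Finsupp.single_eq_of_ne h, add_zero,
      add_zero]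
    ring

theorem eval_bind₁ {σ τ : Type*} (f : σ → MvPolynomial τ ℂ) (p : MvPolynomial σ ℂ) (x : τ → ℂ) :
    eval x (bind₁ f p) = eval (fun i => eval x (f i)) p := by
  rw [← MvPolynomial.coe_aeval_eq_eval, RingHom.coe_coe, aeval_bind₁,
    ← MvPolynomial.coe_aeval_eq_eval, RingHom.coe_coe]

theorem apply_mul_le_weight (hμ : ∀ i, 0 < μ i) (d : Fin n →₀ ℕ) (j : Fin n) :
    d j * μ j ≤ Finsupp.weight μ d := by
  rw [weight_eq_sum_mul]
  exact Finset.single_le_sum (f := fun j => (d j : ℝ) * μ j)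
    (fun j _ => mul_nonneg (Nat.cast_nonneg _) (hμ j).le) (Finset.mem_univ j)

theorem eq_single_of_weight_le (hμ : ∀ i, 0 < μ i) {d : Fin n →₀ ℕ} {j : Fin n} (hd : d j ≠ 0)
    (h : Finsupp.weight μ d ≤ μ j) : d = Finsupp.single j 1 := by
  classical
  have h1 : Finsupp.single j 1 ≤ d := by
    rw [Finsupp.single_le_iff]; omega
  obtain ⟨e, rfl⟩ := exists_add_of_le h1
  rw [map_add, Finsupp.weight_single, one_smul] at h
  have : e = 0 := by
    ext k
    have h2 := apply_mul_le_weight hμ e k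
    by_contra hk
    have h3 : (1 : ℝ) ≤ e k := by exact_mod_cast Nat.one_le_iff_ne_zero.2 hk
    have := hμ k
    nlinarith
  rw [this, add_zero]

/-- Either a variable can be corrected by a polynomial in the variables of smaller weight so as to
lie in the span of derivatives of slices, or the slices do not depend on some direction. -/
theorem exists_shear_or_direction (hμ : ∀ i, 0 < μ i) {κ : ℝ}
    (hP : IsWeightedHomogeneous (Sum.elim μ μ) P κ) (i : Fin n) :
    (∃ r : MvPolynomial (Fin n) ℂ, IsWeightedHomogeneous μ r (μ i) ∧
      (∀ d ∈ r.support, ∀ j, d j ≠ 0 → μ j < μ i) ∧ X i + r ∈ derivSpan μ P i) ∨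
    ∃ c : Fin n → ℂ, c i ≠ 0 ∧ (∀ j, c j ≠ 0 → μ j = μ i) ∧ ∀ p ∈ derivSpan μ P i,
      ∀ d : Fin n →₀ ℕ, (∀ j, d j ≠ 0 → μ i ≤ μ j) → coeff d (∑ j, C (c j) * pderiv j p) = 0 := by
  classical
  have hV := isDerivClosed_derivSpan (μ := μ) (P := P) i
  -- The linear coefficients in the variables of the same weight as i. The dichotomy is whether the
  -- i-th unit vector is attained on the span.
  let a : MvPolynomial (Fin n) ℂ →ₗ[ℂ] (Fin n → ℂ) := LinearMap.pi fun j =>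
    if μ j = μ i then lcoeff ℂ (Finsupp.single j 1) else 0
  have ha : ∀ p j, a p j = if μ j = μ i then coeff (Finsupp.single j 1) p else 0 := fun p j => by
    simp only [a, LinearMap.pi_apply]
    split_ifs <;> simp
  by_cases hE : Pi.single i 1 ∈ (derivSpan μ P i).map a
  · left
    obtain ⟨p, hp, hpa⟩ := hE
    refine ⟨weightedHomogeneousComponent μ (μ i) p - X i,
      (weightedHomogeneousComponent_isWeightedHomogeneous _ _).sub (isWeightedHomogeneous_X _ _ _),
      fun d hd j hj => ?_, ?_⟩
    · by_contra hcon
      push Not at hcon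
      have hdw : Finsupp.weight μ d = μ i :=
        ((weightedHomogeneousComponent_isWeightedHomogeneous (w := μ) (μ i) p).sub
          (isWeightedHomogeneous_X ℂ μ i)) (mem_support_iff.1 hd)
      -- A monomial of weight μ i that contains a variable of weight at least μ i is that variable
      -- alone.
      have hds := eq_single_of_weight_le hμ hj (hdw.le.trans hcon)
      subst hds
      rw [Finsupp.weight_single, one_smul] at hdw
      rw [mem_support_iff, coeff_sub, coeff_weightedHomogeneousComponent, Finsupp.weight_single,
        one_smul, if_pos hdw, coeff_X] at hd
      have h1 := congrFun hpa j
      rw [ha, if_pos hdw, Pi.single_apply] at h1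
      rw [h1] at hd
      refine hd ?_
      by_cases hij : j = i
      · subst hij; simp
      · rw [if_neg hij, if_neg]
        · simp
        · simpa [Finsupp.single_left_inj] using Ne.symm hij
    · rw [add_sub_cancel]
      exact component_mem_derivSpan hP hp _
  · right
    -- A functional separating the unit vector from the attained coefficients supplies the direction
    -- c.
    obtain ⟨f, hf, hfE⟩ := Submodule.exists_le_ker_of_notMem hE
    clear hE
    let c : Fin n → ℂ := fun j => if μ j = μ i then f (Pi.single j 1) else 0
    have hc0 : ∀ p ∈ derivSpan μ P i, ∑ j, c j * coeff (Finsupp.single j 1) p = 0 := by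
      intro p hp
      have h1 : f (a p) = 0 := hfE (Submodule.mem_map_of_mem hp)
      rw [← h1, LinearMap.pi_apply_eq_sum_univ f]
      refine Finset.sum_congr rfl fun j _ => ?_
      rw [ha]
      simp only [c]
      split_ifs
      · rw [smul_eq_mul, mul_comm]
        congr 2
        funext k
        simp [Pi.single_apply, eq_comm]
      · simp
    have hci : c i ≠ 0 := by simpa [c] using hf
    have hcG : ∀ j, c j ≠ 0 → μ j = μ i := fun j hj => by
      by_contra h
      exact hj (by simp [c, h])
    clear_value c
    clear hfE ha hf f a
    refine ⟨c, hci, hcG, ?_⟩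
    -- Differentiation in a variable of weight at least μ i stays in the span and lowers the degree
    -- of d, until only linear coefficients of p are left.
    · suffices h : ∀ N : ℕ, ∀ p ∈ derivSpan μ P i, ∀ d : Fin n →₀ ℕ, d.degree = N →
          (∀ j, d j ≠ 0 → μ i ≤ μ j) → coeff d (∑ j, C (c j) * pderiv j p) = 0 from
        fun p hp d hd => h _ p hp d rfl hd
      intro N
      induction N with
      | zero =>
        intro p hp d hd _
        rw [Finsupp.degree_eq_zero_iff] at hd
        subst hd
        rw [← hc0 p hp, coeff_sum]
        refine Finset.sum_congr rfl fun j _ => ?_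
        rw [coeff_C_mul, coeff_pderiv]
        simp
      | succ N ih =>
        intro p hp d hd hdU
        obtain ⟨k, hk⟩ : ∃ k, d k ≠ 0 := by
          by_contra hcon
          push Not at hcon
          have : d = 0 := Finsupp.ext hcon
          rw [this, map_zero] at hd
          omega
        have hle : Finsupp.single k 1 ≤ d := by
          rw [Finsupp.single_le_iff]; omega
        obtain ⟨e, rfl⟩ := exists_add_of_le hle
        rw [map_add, Finsupp.degree_single] at hd
        have h1 := ih (pderiv k p) (hV.2 k (hdU k hk) p hp) e (by omega) fun j hj =>
          hdU j (by simp [hj])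
        have h2 : ∑ j, C (c j) * pderiv j (pderiv k p) = pderiv k (∑ j, C (c j) * pderiv j p) := by
          rw [map_sum]
          refine Finset.sum_congr rfl fun j _ => ?_
          rw [pderiv_C_mul, pderiv_pderiv_comm j k p]
        rw [h2, coeff_pderiv, mul_eq_zero] at h1
        rw [add_comm]
        rcases h1 with h1 | h1
        · exact h1
        · exact absurd h1 (Nat.cast_add_one_ne_zero _)

theorem aeval_shear_pderiv {i k : Fin n} {r : MvPolynomial (Fin n) ℂ} (hr : pderiv k r = 0)
    (p : MvPolynomial (Fin n) ℂ) : aeval (Function.update X i (X i - r)) (pderiv k p) =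
      pderiv k (aeval (Function.update X i (X i - r)) p) := by
  classical
  have hX : ∀ j, pderiv k (Function.update X i (X i - r) j) = (pderiv k (X j) :
      MvPolynomial (Fin n) ℂ) := fun j => by
    by_cases hj : j = i
    · subst hj; simp [hr]
    · simp [Function.update_of_ne hj]
  induction p using MvPolynomial.induction_on with
  | C a => simp
  | add p q hp hq => rw [map_add, map_add, hp, hq, map_add, map_add]
  | mul_X p j hp =>
    rw [pderiv_mul, map_add, map_mul, map_mul, map_mul, pderiv_mul, hp, aeval_X, hX, pderiv_X]
    congr 2
    by_cases hj : k = j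
    · subst hj; simp
    · simp [hj]

/-- The shear `X_i ↦ X_i - r`. -/
noncomputable def shear (i : Fin n) (r : MvPolynomial (Fin n) ℂ) :
    Fin n → MvPolynomial (Fin n) ℂ := Function.update X i (X i - r)

theorem eval_eq_zero_of_forall_support {p : MvPolynomial (Fin n) ℂ} {x : Fin n → ℂ}
    (h : ∀ d ∈ p.support, ∃ j, d j ≠ 0 ∧ x j = 0) : eval x p = 0 := by
  rw [eval_eq']
  refine Finset.sum_eq_zero fun d hd => ?_
  obtain ⟨j, hj, hx⟩ := h d hd
  rw [Finset.prod_eq_zero (Finset.mem_univ j) (by rw [hx, zero_pow hj]), mul_zero]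

/-- The shear respects both generating operations. The monomials of r contain only variables of
weight below μ i ≤ μ m, so r vanishes at the conjugates of the admissible η and is constant in the
variables of differentiation. -/
theorem aeval_shear_mem_derivSpan (hμ : ∀ i, 0 < μ i) {i m : Fin n} {r : MvPolynomial (Fin n) ℂ}
    (hr : IsWeightedHomogeneous μ r (μ i)) (hrL : ∀ d ∈ r.support, ∀ j, d j ≠ 0 → μ j < μ i)
    (hm : μ i ≤ μ m) {g : MvPolynomial (Fin n) ℂ} (hg : g ∈ derivSpan μ P m) :
    aeval (shear i r) g ∈ derivSpan μ (P.subst (shear i r)) m := by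
  have hV := isDerivClosed_derivSpan (μ := μ) (P := P.subst (shear i r)) m
  suffices h : derivSpan μ P m ≤ (derivSpan μ (P.subst (shear i r)) m).comap
      (aeval (shear i r)).toLinearMap from h hg
  refine derivSpan_le ⟨fun η hη => ?_, fun k hk p hp => ?_⟩
  · have e : aeval (shear i r) (P.slice η) = (P.subst (shear i r)).slice η := by
      refine MvPolynomial.funext fun x => ?_
      rw [ZPoly.eval_slice, ZPoly.polar_subst]
      change eval x (bind₁ (shear i r) _) = _
      rw [eval_bind₁, ZPoly.eval_slice]
      congr 1
      funext j
      rw [eval_conjPoly]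
      by_cases hj : j = i
      · subst hj
        have h0 : eval (conjv η) r = 0 := by
          refine eval_eq_zero_of_forall_support fun d hd => ?_
          have hd0 : d ≠ 0 := fun h => by
            have := hr (mem_support_iff.1 hd)
            rw [h, map_zero] at this
            exact (hμ j).ne this
          obtain ⟨l, hl⟩ := Finsupp.ne_iff.1 hd0
          exact ⟨l, hl, by rw [conjv, hη l ((hrL d hd l hl).trans_le hm), map_zero]⟩
        simp [shear, h0, conjv]
      · simp [shear, Function.update_of_ne hj, conjv]
    rw [Submodule.mem_comap, AlgHom.toLinearMap_apply, e]
    exact hV.1 η hη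
  · rw [Submodule.mem_comap, AlgHom.toLinearMap_apply, shear, aeval_shear_pderiv]
    · exact hV.2 k hk _ hp
    · refine pderiv_eq_zero_of_notMem_vars fun hk' => ?_
      rw [mem_vars_iff_mem_support] at hk'
      obtain ⟨d, hd, hkd⟩ := hk'
      exact (hrL d hd k (Finsupp.mem_support_iff.1 hkd)).not_ge (hm.trans hk)

end DerivSpan

/-! ### Polynomial coordinate changes. -/

section PolyMap

variable {n : ℕ} {M : Set (Space n)} {p : Space n} {Φ : Space n → Space n} {Λ : Fin n → ℚ}
  {P : ZPoly n} {k k' : Fin n → MvPolynomial (Fin n) ℂ} {D D' : MvPolynomial (Fin n) ℂ}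

/-- The map `z* = k(z)`, `w* = w + D(z)`. -/
noncomputable def polyMap (k : Fin n → MvPolynomial (Fin n) ℂ) (D : MvPolynomial (Fin n) ℂ)
    (y : Space n) : Space n :=
  (fun i => eval y.1 (k i), y.2 + eval y.1 D)

theorem analyticAt_eval_fst (q : MvPolynomial (Fin n) ℂ) (y : Space n) :
    AnalyticAt ℂ (fun y : Space n => eval y.1 q) y := by
  have := AnalyticAt.aeval_mvPolynomial (𝕜 := ℂ) (A := ℂ) (B := ℂ) (z := y)
    (f := fun (y : Space n) i => y.1 i) (fun i =>
      (LinearMap.toContinuousLinearMap (coord (some i) : Space n →ₗ[ℂ] ℂ)).analyticAt _) q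
  simpa [MvPolynomial.aeval_eq_eval] using this

theorem analyticAt_polyMap (y : Space n) : AnalyticAt ℂ (polyMap k D) y :=
  (AnalyticAt.pi fun i => analyticAt_eval_fst (k i) y).prod
    (analyticAt_snd.add (analyticAt_eval_fst D y))

/-- The maps `polyMap k D` and `polyMap k' D'` are inverse to each other and fix the origin. -/
structure PolyInverse (k : Fin n → MvPolynomial (Fin n) ℂ) (D : MvPolynomial (Fin n) ℂ)
    (k' : Fin n → MvPolynomial (Fin n) ℂ) (D' : MvPolynomial (Fin n) ℂ) : Prop where
  left : ∀ z, (fun i => eval (fun j => eval z (k j)) (k' i)) = z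
  right : ∀ z, (fun i => eval (fun j => eval z (k' j)) (k i)) = z
  cancel : ∀ z, eval z D + eval (fun j => eval z (k j)) D' = 0
  zero : ∀ i, eval 0 (k i) = 0
  zero' : eval 0 D = 0

theorem PolyInverse.polyMap_left (h : PolyInverse k D k' D') (y : Space n) :
    polyMap k' D' (polyMap k D y) = y := by
  refine Prod.ext (h.left y.1) ?_
  change y.2 + eval y.1 D + eval (fun i => eval y.1 (k i)) D' = y.2
  rw [add_assoc, h.cancel, add_zero]

theorem PolyInverse.symm (h : PolyInverse k D k' D') : PolyInverse k' D' k D := by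
  have h0 : ∀ i, eval 0 (k' i) = 0 := fun i => by
    have := congrFun (h.left 0) i
    simp only [h.zero] at this
    exact this
  refine ⟨h.right, h.left, fun z => ?_, h0, ?_⟩
  · have := h.cancel (fun j => eval z (k' j))
    rw [h.right] at this
    rw [add_comm]; exact this
  · have := h.cancel 0
    simp only [h.zero, h.zero', zero_add] at this
    exact this

theorem PolyInverse.polyMap_zero (h : PolyInverse k D k' D') : polyMap k D 0 = 0 := by
  refine Prod.ext (funext h.zero) ?_
  change (0 : ℂ) + eval 0 D = 0
  rw [h.zero', add_zero]

theorem isBiholomorphicAt_of_inverse {T S : Space n → Space n} (hT : AnalyticAt ℂ T 0)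
    (hS : AnalyticAt ℂ S 0) (hT0 : T 0 = 0) (hS0 : S 0 = 0) (hST : ∀ x, S (T x) = x)
    (hTS : ∀ x, T (S x) = x) : IsBiholomorphicAt T 0 := by
  have h1 : (fderiv ℂ S 0).comp (fderiv ℂ T 0) = ContinuousLinearMap.id ℂ _ := by
    have h := HasFDerivAt.comp (0 : Space n) (g := S) (f := T)
      (by rw [hT0]; exact hS.differentiableAt.hasFDerivAt) hT.differentiableAt.hasFDerivAt
    exact (h.congr_of_eventuallyEq (Eventually.of_forall fun x => (hST x).symm)).unique
      (hasFDerivAt_id _)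
  have h2 : (fderiv ℂ T 0).comp (fderiv ℂ S 0) = ContinuousLinearMap.id ℂ _ := by
    have h := HasFDerivAt.comp (0 : Space n) (g := T) (f := S)
      (by rw [hS0]; exact hT.differentiableAt.hasFDerivAt) hS.differentiableAt.hasFDerivAt
    exact (h.congr_of_eventuallyEq (Eventually.of_forall fun x => (hTS x).symm)).unique
      (hasFDerivAt_id _)
  exact ⟨hT, ContinuousLinearEquiv.equivOfInverse _ _ (fun x => congrArg (fun B => B x) h1)
    fun x => congrArg (fun B => B x) h2, hT.differentiableAt.hasFDerivAt⟩

theorem PolyInverse.isBiholomorphicAt (h : PolyInverse k D k' D') :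
    IsBiholomorphicAt (polyMap k D) 0 :=
  isBiholomorphicAt_of_inverse (analyticAt_polyMap 0) (analyticAt_polyMap 0) h.polyMap_zero
    h.symm.polyMap_zero h.polyMap_left h.symm.polyMap_left

theorem preservesTangent_polyMap (h0 : eval 0 D = 0)
    (hD : (fun z => eval z D) =o[𝓝 0] fun z : Fin n → ℂ => z) :
    PreservesTangent (polyMap k D) := by
  have h1 : HasFDerivAt (fun y : Space n => eval y.1 D) (0 : Space n →L[ℂ] ℂ) 0 := by
    rw [hasFDerivAt_iff_isLittleO]
    have h2 := hD.comp_tendsto (tendsto_fst_nhds_zero (E := Fin n → ℂ) (F := ℂ))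
    refine (h2.congr_left fun y => ?_).trans_isBigO
      (IsBigO.of_bound 1 (Eventually.of_forall fun y => ?_))
    · simp only [Function.comp_apply, Prod.fst_zero, h0, sub_zero, _root_.zero_apply]
    · rw [sub_zero, one_mul]; exact norm_fst_le y
  have h2 : ∀ ξ, (fderiv ℂ (polyMap k D) 0 ξ).2 = ((1 : ℝ) : ℂ) * ξ.2 := fun ξ => by
    have h3 := ((analyticAt_polyMap (k := k) (D := D) (0 : Space n)).differentiableAt.hasFDerivAt).snd
    have h4 : HasFDerivAt (fun y : Space n => (polyMap k D y).2)
        (ContinuousLinearMap.snd ℂ (Fin n → ℂ) ℂ + 0) 0 := hasFDerivAt_snd.add h1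
    have h5 := congrArg (fun B : Space n →L[ℂ] ℂ => B ξ) (h3.unique h4)
    simpa using h5
  exact preservesTangent_of_coeff h2

theorem isBigO_wgauge_polyMap {μ : Fin n → ℝ} (hμ : ∀ i, 0 < μ i)
    (hk : ∀ i, IsWeightedHomogeneous μ (k i) (μ i)) (hD : IsWeightedHomogeneous μ D 1) :
    (fun y : Space n => wgauge μ (polyMap k D y)) =O[𝓝 0] wgauge μ := by
  have h : ∀ (q : MvPolynomial (Fin n) ℂ) {κ : ℝ}, 0 < κ → IsWeightedHomogeneous μ q κ →
      (fun y : Space n => eval y.1 q) =O[𝓝 0] fun y => wgauge μ y ^ κ := fun q κ hκ hq =>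
    isBigO_eval gauge_nonneg (tendsto_gauge hμ) (fun j => (hμ j).le)
      (fun i => isBigO_coord_wgauge hμ i _) q hκ fun d hd => (hq (mem_support_iff.1 hd)).ge
  refine isBigO_gauge hμ gauge_nonneg (fun i => h _ (hμ i) (hk i)) ?_
  have := h D one_pos hD
  simp only [Real.rpow_one] at this
  exact (isBigO_snd_wgauge _).add this

/-- The case of a polynomial coordinate change. Only the weight-one part q of the inverse's
transverse term D' enters the new leading part. -/
theorem HasLeadingPart.polyMap (hΛ : ∀ i, 0 < Λ i) (hP : IsHomogeneousOne Λ P)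
    (h : HasLeadingPart M p Λ Φ P) (hinv : PolyInverse k D k' D')
    (hDo : (fun z => eval z D) =o[𝓝 0] fun z : Fin n → ℂ => z)
    (hk' : ∀ i, IsWeightedHomogeneous (fun i => (Λ i : ℝ)) (k' i) (Λ i : ℝ))
    {q : MvPolynomial (Fin n) ℂ} (hq : IsWeightedHomogeneous (fun i => (Λ i : ℝ)) q 1)
    (hD' : (fun z => eval z D' - eval z q) =o[𝓝 0] zgauge fun i => (Λ i : ℝ)) :
    HasLeadingPart M p Λ (CatlinMultitype.polyMap k D ∘ Φ) (P.subst k' - imPart q) ∧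
      IsHomogeneousOne Λ (P.subst k' - imPart q) := by
  have h1 := h.transfer hΛ hP hinv.isBiholomorphicAt hinv.polyMap_zero
    (preservesTangent_polyMap hinv.zero' hDo)
    (hinv.symm.isBiholomorphicAt.tendsto hinv.symm.polyMap_zero)
    (Eventually.of_forall hinv.polyMap_left) (c := 1) one_ne_zero hk' hq
    (fun i => (isLittleO_zero _ _).congr_left fun y => by simp [CatlinMultitype.polyMap]) (by
      have h2 := hD'.comp_tendsto (tendsto_fst_nhds_zero (E := Fin n → ℂ) (F := ℂ))
      refine (h2.congr_left fun y => ?_).trans_isBigO (IsBigO.of_norm_le fun y => ?_)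
      · simp [CatlinMultitype.polyMap]
      · rw [Function.comp_apply, Real.norm_of_nonneg (zgauge_nonneg _)]
        exact zgauge_le_gauge y)
  simpa using h1

theorem ZPoly.subst_X (P : ZPoly n) : P.subst X = P := by
  refine ZPoly.polar_ext fun x η => ?_
  rw [ZPoly.polar_subst]
  congr 1 <;> funext i
  · simp
  · simp [eval_conjPoly, conjv]

theorem ZPoly.forall_mixed_subst (hP : ∀ d ∈ P.support, IsMixed d) (hk : ∀ i, eval 0 (k i) = 0) :
    ∀ d ∈ (P.subst k).support, IsMixed d := by
  rw [ZPoly.forall_mixed_iff_polar] at hP ⊢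
  have h1 : (fun i => eval 0 (conjPoly (k i))) = (0 : Fin n → ℂ) := funext fun i => by
    rw [eval_conjPoly, conjv_zero, hk, map_zero, Pi.zero_apply]
  have h2 : (fun i => eval 0 (k i)) = (0 : Fin n → ℂ) := funext hk
  constructor
  · intro x
    rw [ZPoly.polar_subst, h1, hP.1]
  · intro η
    rw [ZPoly.polar_subst, h2, hP.2]

theorem PolyInverse.subst_ne_zero (h : PolyInverse k D k' D') (hP : P ≠ 0) : P.subst k' ≠ 0 := by
  intro h0
  refine hP (ZPoly.eq_of_value_eq fun z => ?_)
  have h1 : (P.subst k').value (fun j => eval z (k j)) = 0 := by rw [h0]; simp [ZPoly.value]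
  rw [ZPoly.value_subst, h.left] at h1
  rw [h1]; simp [ZPoly.value]

theorem imPart_zero : imPart (0 : MvPolynomial (Fin n) ℂ) = 0 := by
  simp [imPart, conjPoly]

theorem polyInverse_vertical (hD : eval 0 D = 0) : PolyInverse X D X (-D) := by
  refine ⟨?_, ?_, ?_, ?_, hD⟩ <;> intros <;> simp

theorem polyInverse_shear {i : Fin n} {r : MvPolynomial (Fin n) ℂ}
    (hr : ∀ z a, eval (Function.update z i a) r = eval z r) (h0 : eval 0 r = 0) :
    PolyInverse (shear i r) 0 (shear i (-r)) 0 := by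
  have e : ∀ z (s : MvPolynomial (Fin n) ℂ), (fun j => eval z (shear i s j)) =
      Function.update z i (z i - eval z s) := fun z s => by
    funext j
    by_cases hj : j = i
    · subst hj; simp [shear]
    · simp [shear, Function.update_of_ne hj]
  have hr' : ∀ z a, eval (Function.update z i a) (-r) = eval z (-r) := fun z a => by
    rw [map_neg, map_neg, hr]
  refine ⟨fun z => ?_, fun z => ?_, fun z => by simp, fun j => ?_, by simp⟩
  · rw [e, e, hr', map_neg]; simp [shear]
  · rw [e, e, hr, map_neg]; simp [shear]
  · have := congrFun (e 0 r) j
    rw [this, h0]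
    by_cases hj : j = i
    · subst hj; simp
    · simp [Function.update_of_ne hj]

end PolyMap

/-! ### Restriction of polynomials to coordinate subspaces. -/

section Restrict

/-- Set the variables that do not satisfy `S` to zero. -/
noncomputable def restrictVars {σ : Type*} (S : σ → Prop) [DecidablePred S]
    (p : MvPolynomial σ ℂ) : MvPolynomial σ ℂ := bind₁ (fun i => if S i then X i else 0) p

theorem coeff_restrictVars {σ : Type*} (S : σ → Prop) [DecidablePred S] (p : MvPolynomial σ ℂ)
    (d : σ →₀ ℕ) (hd : ∀ i, d i ≠ 0 → S i) : coeff d (restrictVars S p) = coeff d p := by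
  classical
  induction p using MvPolynomial.induction_on' with
  | add p q hp hq => rw [restrictVars, map_add, coeff_add, coeff_add, ← hp, ← hq]; rfl
  | monomial e a =>
    rw [restrictVars, bind₁_monomial]
    by_cases he : ∀ i, e i ≠ 0 → S i
    · have : ∏ i ∈ e.support, (if S i then X i else 0 : MvPolynomial σ ℂ) ^ e i =
          ∏ i ∈ e.support, X i ^ e i := Finset.prod_congr rfl fun i hi => by
        rw [if_pos (he i (Finsupp.mem_support_iff.1 hi))]
      rw [this, monomial_eq]; rfl
    · push Not at he
      obtain ⟨i, hi, hSi⟩ := he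
      rw [Finset.prod_eq_zero (Finsupp.mem_support_iff.2 hi) (by rw [if_neg hSi, zero_pow hi]),
        mul_zero, coeff_zero, coeff_monomial, if_neg]
      rintro rfl
      exact hSi (hd i hi)

theorem coeff_restrictVars_eq_zero {σ : Type*} (S : σ → Prop) [DecidablePred S]
    (p : MvPolynomial σ ℂ) (d : σ →₀ ℕ) {i : σ} (hdi : d i ≠ 0) (hi : ¬ S i) :
    coeff d (restrictVars S p) = 0 := by
  classical
  induction p using MvPolynomial.induction_on' with
  | add p q hp hq =>
    rw [restrictVars, map_add, coeff_add]
    change coeff d (restrictVars S p) + coeff d (restrictVars S q) = 0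
    rw [hp, hq, add_zero]
  | monomial e a =>
    by_cases he : ∀ j, e j ≠ 0 → S j
    · have : restrictVars S (monomial e a) = monomial e a := by
        rw [restrictVars, bind₁_monomial, monomial_eq]
        congr 1
        exact Finset.prod_congr rfl fun j hj => by
          rw [if_pos (he j (Finsupp.mem_support_iff.1 hj))]
      rw [this, coeff_monomial, if_neg]
      rintro rfl
      exact hi (he i hdi)
    · push Not at he
      obtain ⟨j, hj, hSj⟩ := he
      rw [restrictVars, bind₁_monomial, Finset.prod_eq_zero (Finsupp.mem_support_iff.2 hj)
        (by rw [if_neg hSj, zero_pow hj]), mul_zero, coeff_zero]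

theorem eval_restrictVars {σ : Type*} (S : σ → Prop) [DecidablePred S] (p : MvPolynomial σ ℂ)
    (x : σ → ℂ) : eval x (restrictVars S p) = eval (fun i => if S i then x i else 0) p := by
  rw [restrictVars, eval_bind₁]
  congr 2
  funext i
  split_ifs <;> simp

/-- A polynomial that does not depend on a variable when restricted to a coordinate subspace. -/
theorem coeff_eq_zero_of_eval_update {σ : Type*} [DecidableEq σ] (S : σ → Prop)
    {p : MvPolynomial σ ℂ} {i : σ} (hi : S i)
    (h : ∀ x : σ → ℂ, (∀ j, ¬ S j → x j = 0) → eval (Function.update x i 0) p = eval x p)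
    {d : σ →₀ ℕ} (hd : ∀ j, d j ≠ 0 → S j) (hdi : d i ≠ 0) : coeff d p = 0 := by
  classical
  have h1 : restrictVars S p = restrictVars (fun j => S j ∧ j ≠ i) (restrictVars S p) := by
    refine MvPolynomial.funext fun x => ?_
    rw [eval_restrictVars, eval_restrictVars, eval_restrictVars, ← h _ fun j hj => if_neg hj]
    congr 2
    funext j
    by_cases hj : j = i
    · subst hj; simp
    · by_cases hS : S j <;> simp [hj, hS]
  rw [← coeff_restrictVars S p d hd, h1]
  exact coeff_restrictVars_eq_zero _ _ d hdi fun hcon => hcon.2 rfl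

end Restrict

/-! ### Removing pluriharmonic terms to high order. -/

section NormalForm

variable {n : ℕ} {M : Set (Space n)} {p : Space n} {Φ : Space n → Space n} {Λ : Fin n → ℚ}
  {P Q : ZPoly n} {μ : Fin n → ℝ}

theorem isBigO_norm_pow_zgauge (hμ : ∀ i, 0 < μ i) {m : ℕ} (hm : ∀ i, 1 ≤ m * μ i) (hm0 : 0 < m) :
    (fun z : Fin n → ℂ => ‖z‖ ^ m) =O[𝓝 0] zgauge μ := by
  have hm' : (0 : ℝ) < m := Nat.cast_pos.2 hm0
  have h1 := isBigO_norm_zgauge hμ (m := 1 / m) (by positivity) fun i => by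
    rw [div_le_iff₀ hm', mul_comm]; exact hm i
  have h2 := isBigO_norm_pow zgauge_nonneg (tendsto_zgauge hμ) h1 m one_pos (by
    rw [one_div, inv_mul_cancel₀ hm'.ne'])
  simpa using h2

theorem ZPoly.le_degree_of_isLittleO {R : ZPoly n} {m : ℕ}
    (h : R.value =o[𝓝 0] fun z => ‖z‖ ^ m) :
    ∀ d ∈ R.support, ((m + 1 : ℕ) : ℝ) ≤ Finsupp.weight (fun _ => (1 : ℝ)) d := by
  intro d hd
  have h1 := isBigO_norm_zgauge (n := n) (μ := fun _ => 1) (fun _ => one_pos) one_pos fun _ => le_rfl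
  have h2 : (fun z : Fin n → ℂ => ‖z‖ ^ m) =O[𝓝 0]
      fun z => zgauge (fun _ => 1) z ^ ((m : ℕ) : ℝ) := by
    have := h1.norm_left.pow m
    simpa using this
  have h3 := ZPoly.lt_weight_of_isLittleO_value (μ := fun _ : Fin n => (1 : ℝ)) (κ := m) (fun z =>
    isLittleO_comp_dil (fun _ => one_pos) (h.trans_isBigO h2) z) d hd
  have e : Sum.elim (fun _ : Fin n => (1 : ℝ)) (fun _ : Fin n => (1 : ℝ)) = fun _ => 1 := by
    funext j; rcases j <;> rfl
  rw [e] at h3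
  rw [weight_eq_sum_mul] at h3 ⊢
  simp only [mul_one] at h3 ⊢
  exact_mod_cast h3

theorem tendsto_prodMk_real_zero :
    Tendsto (fun z : Fin n → ℂ => (z, (0 : ℝ))) (𝓝 0) (𝓝 0) :=
  (Continuous.prodMk_left (0 : ℝ)).tendsto' 0 _ rfl

theorem lt_weight_sub (hμ : ∀ i, 0 < μ i) {F : (Fin n → ℂ) × ℝ → ℝ}
    (hF : (fun x => (F x : ℂ) - P.value x.1) =o[𝓝 0] wgauge μ)
    (hQ : (fun z => (F (z, 0) : ℂ) - Q.value z) =o[𝓝 0] zgauge μ) :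
    ∀ d ∈ (Q - P).support, 1 < Finsupp.weight (Sum.elim μ μ) d := by
  have h1 : (fun z => (F (z, 0) : ℂ) - P.value z) =o[𝓝 0] zgauge μ :=
    (hF.comp_tendsto tendsto_prodMk_real_zero).congr_right fun z => by simp [gauge_zero_right]
  have h2 : ZPoly.value (Q - P) =o[𝓝 0] fun z => zgauge μ z ^ (1 : ℝ) := by
    refine (h1.sub hQ).congr (fun z => ?_) fun z => by simp
    simp [ZPoly.value]
  exact ZPoly.lt_weight_of_isLittleO_value fun z => isLittleO_comp_dil hμ h2 z

theorem exists_real_zjet {F : (Fin n → ℂ) × ℝ → ℝ} (hF : ContDiffAt ℝ ∞ F 0) (m : ℕ) :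
    ∃ Q : ZPoly n, Q.conjSwap = Q ∧
      (fun z => (F (z, 0) : ℂ) - Q.value z) =O[𝓝 0] fun z => ‖z‖ ^ (m + 1) := by
  have h1 : ContDiffAt ℝ ∞ (fun z : Fin n → ℂ => (F (z, 0) : ℂ)) 0 := by
    have h2 : ContDiffAt ℝ ∞ (fun z : Fin n → ℂ => F (z, (0 : ℝ))) 0 :=
      ContDiffAt.comp (0 : Fin n → ℂ) (g := F) hF (contDiff_id.prodMk contDiff_const).contDiffAt
    exact Complex.ofRealCLM.contDiff.contDiffAt.comp 0 h2
  obtain ⟨Q, hQ⟩ := exists_zjet h1 m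
  have hv : ∀ z, ZPoly.value (C (1 / 2) * (Q + Q.conjSwap)) z = ((Q.value z).re : ℂ) := fun z => by
    have : ZPoly.value (C (1 / 2) * (Q + Q.conjSwap)) z =
        1 / 2 * (Q.value z + Q.conjSwap.value z) := by simp [ZPoly.value]
    rw [this, ZPoly.value_conjSwap, Complex.add_conj]
    push_cast
    ring
  refine ⟨C (1 / 2) * (Q + Q.conjSwap), ZPoly.eq_of_value_eq fun z => ?_, ?_⟩
  · rw [ZPoly.value_conjSwap, hv, Complex.conj_ofReal]
  · refine IsBigO.trans (IsBigO.of_norm_le fun z => ?_) hQ.norm_left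
    rw [hv, ← Complex.ofReal_sub, Complex.norm_real]
    have := Complex.abs_re_le_norm ((F (z, 0) : ℂ) - Q.value z)
    simpa using this

/-- The differential of F at 0 is zero, and strict differentiability makes local Lipschitz constants
arbitrarily small. -/
theorem isLittleO_graph_sub {F : (Fin n → ℂ) × ℝ → ℝ} (hF : IsGraphIn M p Φ F) {X : Type*}
    {l : Filter X} {y y' : X → (Fin n → ℂ) × ℝ} (hy : Tendsto y l (𝓝 0)) (hy' : Tendsto y' l (𝓝 0)) :
    (fun a => F (y a) - F (y' a)) =o[l] fun a => y a - y' a := by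
  have h1 := hF.1.self_of_nhds.hasStrictFDerivAt (by simp)
  rw [hF.2.2.1] at h1
  have h2 := h1.isLittleO.comp_tendsto (hy.prodMk_nhds hy')
  simpa [Function.comp_def] using h2

/-- Pluriharmonic terms can be removed to any order from the restriction of the defining function
to `u = 0`, keeping its leading part. -/
theorem exists_normal_form (hΛ : ∀ i, 0 < Λ i) (hP : IsHomogeneousOne Λ P)
    (hmix : ∀ d ∈ P.support, IsMixed d) (h : HasLeadingPart M p Λ Φ P) (m : ℕ) (hm : 1 ≤ m) :
    ∃ (Φ' : Space n → Space n) (F : (Fin n → ℂ) × ℝ → ℝ) (Q : ZPoly n), IsCoordinatesAt p Φ' ∧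
      IsGraphIn M p Φ' F ∧
      (fun x => (F x : ℂ) - P.value x.1) =o[𝓝 0] (wgauge fun i => (Λ i : ℝ)) ∧
      (∀ d ∈ Q.support, IsMixed d) ∧
      (fun z => (F (z, 0) : ℂ) - Q.value z) =o[𝓝 0] fun z => ‖z‖ ^ m := by
  have hμ : ∀ i, (0 : ℝ) < Λ i := fun i => Rat.cast_pos.2 (hΛ i)
  induction m, hm using Nat.le_induction with
  | base =>
    obtain ⟨hΦ, F, hF, hFP⟩ := h.exists_graph hΛ
    refine ⟨Φ, F, 0, hΦ, hF, hFP, by simp, ?_⟩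
    have h1 := isLittleO_graph_sub hF (tendsto_prodMk_real_zero (n := n)) (tendsto_const_nhds)
    simp only [hF.2.1, sub_zero] at h1
    have h2 : (fun z : Fin n → ℂ => ((z, (0 : ℝ)) : (Fin n → ℂ) × ℝ)) =O[𝓝 0] fun z => z :=
      (isBigO_refl _ _).prod_left (isBigO_zero _ _)
    have h3 : (fun z : Fin n → ℂ => (F (z, 0) : ℂ)) =o[𝓝 0] fun z => z :=
      ((h1.trans_isBigO h2).norm_left.congr_left fun z => by
        rw [← Complex.norm_real]).of_norm_left
    simpa [ZPoly.value] using h3.norm_right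
  | succ m hm ih =>
    obtain ⟨Φ', F, Q, hΦ', hF, hFP, hQm, hFQ⟩ := ih
    obtain ⟨N, hN⟩ : ∃ N : ℕ, ∀ i, 1 ≤ N * (Λ i : ℝ) := by
      obtain ⟨w, hw, -, hwμ⟩ := exists_weight_bound hμ
      obtain ⟨N, hN⟩ := exists_nat_gt (1 / w)
      refine ⟨N, fun i => ?_⟩
      rw [div_lt_iff₀ hw] at hN
      have := hwμ i
      nlinarith [Nat.cast_nonneg (α := ℝ) N]
    -- The order exceeds both m + 1 and N, so the remainder is negligible for the norm and for the
    -- gauge.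
    obtain ⟨Q₁, hQ₁r, hQ₁⟩ := exists_real_zjet hF.1.self_of_nhds (m + 1 + N)
    have hpow : ∀ {a b : ℕ}, a < b → (fun z : Fin n → ℂ => ‖z‖ ^ b) =o[𝓝 0] fun z => ‖z‖ ^ a :=
      fun hab => isLittleO_norm_pow_norm_pow hab
    have hQ₁g : (fun z => (F (z, 0) : ℂ) - Q₁.value z) =o[𝓝 0] zgauge fun i => (Λ i : ℝ) :=
      ((hQ₁.trans_isLittleO (hpow (a := 1 + N) (by omega)))).trans_isBigO
        (isBigO_norm_pow_zgauge hμ (fun i => by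
          push_cast
          have := hN i
          have := hμ i
          linarith) (by omega))
    have hord := ZPoly.le_degree_of_isLittleO (R := Q₁ - Q) (m := m) (by
      refine (hFQ.sub (hQ₁.trans_isLittleO (hpow (by omega)))).congr_left fun z => ?_
      simp [ZPoly.value])
    have hwt := lt_weight_sub hμ hFP hQ₁g
    -- The holomorphic terms of the jet; by reality the antiholomorphic ones are their conjugates.
    -- Comparison with the mixed polynomials Q and P shows that q has degree above m and weight
    -- above one.
    set q := Q₁.slice 0 with hq
    have hqe : ∀ (R : ZPoly n), (∀ d ∈ R.support, IsMixed d) → ∀ z, eval z q =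
        eval (Sum.elim z 0) (Q₁ - R) := fun R hR z => by
      have := (ZPoly.forall_mixed_iff_polar.1 hR).1 z
      rw [map_sub, hq, ZPoly.eval_slice]
      simp only [ZPoly.polar] at this ⊢
      rw [this, sub_zero]
    have hqm : (fun z => eval z q) =O[𝓝 0] fun z : Fin n → ℂ => ‖z‖ ^ (m + 1) := by
      have h1 := isBigO_eval (X := Fin n → ℂ) (l := 𝓝 0) (ρ := fun z => ‖z‖) (w := fun _ => 1)
        (y := fun z => Sum.elim z 0)
        (fun _ => norm_nonneg _) (tendsto_norm_zero) (fun _ => zero_le_one) (fun j => by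
          simp only [Real.rpow_one]
          rcases j with j | j
          · exact IsBigO.of_norm_le fun z => norm_le_pi_norm z j
          · exact isBigO_zero _ _) (Q₁ - Q) (κ := ((m + 1 : ℕ) : ℝ)) (by positivity) hord
      simp only [Real.rpow_natCast] at h1
      exact h1.congr_left fun z => (hqe Q hQm z).symm
    have hqg : (fun z => eval z q) =o[𝓝 0] zgauge fun i => (Λ i : ℝ) := by
      have h1 := isLittleO_eval (X := Fin n → ℂ) (l := 𝓝 0) (ρ := zgauge fun i => (Λ i : ℝ))
        (y := fun z => Sum.elim z 0) zgauge_nonneg (tendsto_zgauge hμ) (sumElim_nonneg hμ) (fun j => by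
          rcases j with j | j
          · exact isBigO_coord_zgauge hμ j
          · exact isBigO_zero _ _) (Q₁ - P) (κ := 1) one_pos hwt
      simp only [Real.rpow_one] at h1
      exact h1.congr_left fun z => (hqe P hmix z).symm
    have hq0 : eval 0 q = 0 := by
      have h2 : (fun z => eval z q) =O[𝓝 0] fun z : Fin n → ℂ => ‖z - 0‖ ^ (m + 1) := by
        simpa using hqm
      exact h2.eq_zero_of_norm_pow (by omega)
    -- Im D = -2 Re q cancels q plus its conjugate, at the price of shifting u by Re D = 2 Im q.
    set D : MvPolynomial (Fin n) ℂ := C (-2 * Complex.I) * q with hD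
    have hDe : ∀ z, eval z D = -2 * Complex.I * eval z q := fun z => by simp [hD]
    have hDinv := polyInverse_vertical (D := D) (by rw [hDe, hq0, mul_zero])
    have hDo : (fun z => eval z D) =o[𝓝 0] fun z : Fin n → ℂ => z := by
      have h1 : (fun z => eval z q) =o[𝓝 0] fun z : Fin n → ℂ => z := by
        have h2 := hqm.trans_isLittleO (hpow (a := 1) (by omega))
        simp only [pow_one] at h2
        exact h2.of_norm_right
      exact (h1.const_mul_left (-2 * Complex.I)).congr_left fun z => (hDe z).symm
    have hlead := (HasLeadingPart.of_graph hΛ hΦ' hF hFP).polyMap hΛ hP hDinv hDo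
      (fun i => isWeightedHomogeneous_X _ _ _) (q := 0) (isWeightedHomogeneous_zero _ _ _) (by
        refine (hqg.const_mul_left (2 * Complex.I)).congr_left fun z => ?_
        rw [map_neg, hDe]; simp)
    rw [ZPoly.subst_X, imPart_zero, sub_zero] at hlead
    obtain ⟨hΦ'', F', hF', hFP'⟩ := hlead.1.exists_graph hΛ
    refine ⟨_, F', Q₁.mixedPart, hΦ'', hF', hFP', fun d hd => (ZPoly.support_mixedPart.1 hd).2, ?_⟩
    -- The points with vanishing new u-coordinate. Their old u is O(‖z‖^(m + 1)), which changes F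
    -- only by a smaller order.
    set y : (Fin n → ℂ) → (Fin n → ℂ) × ℝ := fun z => (z, -2 * (eval z q).im) with hy
    have hqt : Tendsto (fun z => eval z q) (𝓝 0) (𝓝 0) :=
      hqm.trans_tendsto (((continuous_norm.pow (m + 1)).tendsto' _ _ (by simp)))
    have hyt : Tendsto y (𝓝 0) (𝓝 0) := by
      refine tendsto_id.prodMk_nhds ?_
      have := ((Complex.continuous_im.tendsto _).comp hqt).const_mul (-2)
      simpa using this
    have h1 := isLittleO_graph_sub hF hyt (tendsto_prodMk_real_zero (n := n))
    have h2 : (fun z => y z - (z, 0)) =O[𝓝 0] fun z : Fin n → ℂ => ‖z‖ ^ (m + 1) := by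
      refine IsBigO.trans (IsBigO.of_bound 2 (Eventually.of_forall fun z => ?_)) hqm
      simp only [hy, Prod.mk_sub_mk, sub_self, sub_zero, Prod.norm_mk, norm_zero]
      rw [max_eq_right (norm_nonneg _), norm_mul, norm_neg, Real.norm_two]
      gcongr
      exact Complex.abs_im_le_norm _
    have h3 : (fun z => ((F (y z) - F (z, 0) : ℝ) : ℂ)) =o[𝓝 0]
        fun z : Fin n → ℂ => ‖z‖ ^ (m + 1) :=
      ((h1.trans_isBigO h2).norm_left.congr_left fun z => by rw [← Complex.norm_real]).of_norm_left
    have h4 := h3.add (hQ₁.trans_isLittleO (hpow (a := m + 1) (by omega)))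
    refine h4.congr' ?_ EventuallyEq.rfl
    filter_upwards [hyt.eventually (hF.eventually_apply hΦ' hF')] with z hz
    have e1 : (polyMap X D (graphPt F (y z))).2.re = 0 := by
      change ((graphPt F (y z)).2 + eval z D).re = 0
      rw [Complex.add_re, graphPt_re, hDe]
      simp [hy]
    have e2 : (polyMap X D (graphPt F (y z))).2.im = F (y z) - 2 * (eval z q).re := by
      change ((graphPt F (y z)).2 + eval z D).im = _
      rw [Complex.add_im, graphPt_im, hDe]
      simp
      ring
    have e3 : (polyMap X D (graphPt F (y z))).1 = z := by
      funext i
      change eval z (X i) = z i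
      simp
    rw [e1, e2, e3] at hz
    have e4 : Q₁.polar 0 (conjv z) = (starRingEnd ℂ) (eval z q) := by
      rw [← hQ₁r, ZPoly.polar_conjSwap, conjv_conjv, conjv_zero, hq, ZPoly.eval_slice]
    have e5 : Q₁.polar 0 0 = 0 := by rw [← ZPoly.eval_slice, ← hq, hq0]
    rw [← hz, ZPoly.value_eq_polar Q₁.mixedPart, ZPoly.polar_mixedPart, e4, e5,
      ← ZPoly.value_eq_polar, ← ZPoly.eval_slice, ← hq]
    have e6 := Complex.add_conj (eval z q)
    push_cast
    push_cast at e6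
    linear_combination -e6

end NormalForm

/-! ### Minimality of the multitype excludes degenerate leading parts. -/

section Minimality

variable {n : ℕ} {M : Set (Space n)} {p : Space n} {Φ : Space n → Space n} {Λ : Fin n → ℚ}
  {P Q : ZPoly n}

/-- The weight obtained from `Λ` by replacing the entries from `k` on by `x`. -/
def truncWeight (Λ : Fin n → ℚ) (k : Fin n) (x : ℚ) (j : Fin n) : ℚ := if j < k then Λ j else x

/-- The contribution to the weight of a monomial of the variables before `k`. -/
def headWeight (Λ : Fin n → ℚ) (k : Fin n) (d : Fin n ⊕ Fin n →₀ ℕ) : ℚ :=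
  ∑ j, if j < k then ((d (Sum.inl j) + d (Sum.inr j) : ℕ) : ℚ) * Λ j else 0

/-- The degree of a monomial in the variables from `k` on. -/
def tailDegree (k : Fin n) (d : Fin n ⊕ Fin n →₀ ℕ) : ℕ :=
  ∑ j, if j < k then 0 else d (Sum.inl j) + d (Sum.inr j)

theorem weight_sumElim (Λ : Fin n → ℚ) (d : Fin n ⊕ Fin n →₀ ℕ) :
    Finsupp.weight (Sum.elim Λ Λ) d = ∑ j, ((d (Sum.inl j) + d (Sum.inr j) : ℕ) : ℚ) * Λ j := by
  rw [Finsupp.weight_eq_sum, Fintype.sum_sum_type, ← Finset.sum_add_distrib]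
  refine Finset.sum_congr rfl fun j _ => ?_
  simp only [Sum.elim_inl, Sum.elim_inr, nsmul_eq_mul]
  push_cast
  ring

theorem weight_truncWeight (Λ : Fin n → ℚ) (k : Fin n) (x : ℚ) (d : Fin n ⊕ Fin n →₀ ℕ) :
    Finsupp.weight (Sum.elim (truncWeight Λ k x) (truncWeight Λ k x)) d =
      headWeight Λ k d + tailDegree k d * x := by
  rw [weight_sumElim, headWeight, tailDegree, Nat.cast_sum, Finset.sum_mul,
    ← Finset.sum_add_distrib]
  refine Finset.sum_congr rfl fun j _ => ?_
  rw [truncWeight]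
  split_ifs <;> simp

theorem weight_le_headWeight_add (hΛ : Antitone Λ) (k : Fin n) (d : Fin n ⊕ Fin n →₀ ℕ) :
    Finsupp.weight (Sum.elim Λ Λ) d ≤ headWeight Λ k d + tailDegree k d * Λ k := by
  rw [← weight_truncWeight, weight_sumElim, weight_sumElim]
  refine Finset.sum_le_sum fun j _ => mul_le_mul_of_nonneg_left ?_ (Nat.cast_nonneg _)
  rw [truncWeight]
  split_ifs with h
  · exact le_rfl
  · exact hΛ (not_lt.1 h)

theorem weight_lt_headWeight_add (hΛ : Antitone Λ) {k : Fin n} {d : Fin n ⊕ Fin n →₀ ℕ} {j : Fin n}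
    (hj : Λ j < Λ k) (hd : d (Sum.inl j) ≠ 0 ∨ d (Sum.inr j) ≠ 0) :
    Finsupp.weight (Sum.elim Λ Λ) d < headWeight Λ k d + tailDegree k d * Λ k := by
  rw [← weight_truncWeight, weight_sumElim, weight_sumElim]
  refine Finset.sum_lt_sum (fun j _ => mul_le_mul_of_nonneg_left ?_ (Nat.cast_nonneg _))
    ⟨j, Finset.mem_univ _, mul_lt_mul_of_pos_left ?_ ?_⟩
  · rw [truncWeight]
    split_ifs with h
    · exact le_rfl
    · exact hΛ (not_lt.1 h)
  · rw [truncWeight, if_neg]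
    · exact hj
    · exact fun h => hj.not_ge (hΛ h.le)
  · rw [Nat.cast_pos]; omega

theorem exists_of_tailDegree_ne_zero {k : Fin n} {d : Fin n ⊕ Fin n →₀ ℕ}
    (h : tailDegree k d ≠ 0) : ∃ j, k ≤ j ∧ (d (Sum.inl j) ≠ 0 ∨ d (Sum.inr j) ≠ 0) := by
  by_contra hcon
  push Not at hcon
  refine h (Finset.sum_eq_zero fun j _ => ?_)
  split_ifs with hj
  · rfl
  · obtain ⟨h1, h2⟩ := hcon j (not_lt.1 hj)
    rw [h1, h2, add_zero]

theorem isWeight_truncWeight (hΛ : IsWeight Λ) {k : Fin n} {x : ℚ} (hx : 0 < x) (hxk : x < Λ k)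
    (hrep : ∃ (b : ℕ) (a : Fin n → ℕ), 0 < b ∧ (∑ j, if j < k then (a j : ℚ) * Λ j else 0) + b * x = 1) :
    IsWeight (truncWeight Λ k x) := by
  obtain ⟨hΛ1, hΛa, hΛ2⟩ := hΛ
  refine ⟨fun i => ?_, fun i j hij => ?_, fun i => ?_⟩
  · rw [truncWeight]
    split_ifs
    · exact hΛ1 i
    · exact ⟨hx.le, hxk.le.trans (hΛ1 k).2⟩
  · rw [truncWeight, truncWeight]
    split_ifs with h1 h2 h2
    · exact hΛa hij
    · exact absurd (hij.trans_lt h1) h2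
    · exact hxk.le.trans (hΛa h2.le)
    · exact le_rfl
  · by_cases hi : i < k
    · rw [truncWeight, if_pos hi]
      refine (hΛ2 i).imp_right fun ⟨a, ha, hs⟩ => ⟨a, ha, ?_⟩
      rw [← hs]
      refine Finset.sum_congr rfl fun j hj => ?_
      rw [truncWeight, if_pos ((Finset.mem_Iic.1 hj).trans_lt hi)]
    · right
      obtain ⟨b, a, hb, hs⟩ := hrep
      refine ⟨fun j => if j < k then a j else if j = i then b else 0, by simp [hi, hb], ?_⟩
      have hki := not_lt.1 hi
      have e : ∑ j ∈ Finset.Iic i, (((if j < k then a j else if j = i then b else 0 : ℕ) : ℚ)) *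
          truncWeight Λ k x j = ∑ j, (if j ≤ i then (if j < k then (a j : ℚ) * Λ j else 0) +
            (if j = i then (b : ℚ) * x else 0) else 0) := by
        rw [← Finset.sum_filter]
        have : Finset.univ.filter (fun j => j ≤ i) = Finset.Iic i := by ext; simp
        rw [this]
        refine Finset.sum_congr rfl fun j _ => ?_
        rw [truncWeight]
        by_cases h1 : j < k
        · have : j ≠ i := fun h => hi (h ▸ h1)
          simp [h1, this]
        · by_cases h2 : j = i <;> simp [h1, h2, hi]
      have e2 : (b : ℚ) * x = ∑ j, if j = i then (b : ℚ) * x else 0 := by simp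
      rw [e, ← hs]
      conv_rhs => rw [e2]
      rw [← Finset.sum_add_distrib]
      refine Finset.sum_congr rfl fun j _ => ?_
      by_cases h1 : j ≤ i
      · rw [if_pos h1]
      · have h2 : ¬ j < k := fun h => h1 (h.le.trans hki)
        have h3 : j ≠ i := fun h => h1 h.le
        simp [h1, h2, h3]

/-- Minimality of the multitype: the leading part in adapted coordinates is not degenerate. -/
theorem false_of_degenerate (hM : HasFiniteMultitype M p Λ) (hw : IsWeight Λ)
    (hP : IsHomogeneousOne Λ P) (hP0 : P ≠ 0) (hmix : ∀ d ∈ P.support, IsMixed d)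
    (h : HasLeadingPart M p Λ Φ P) (k : Fin n) (hk : ∀ j, k < j → Λ j < Λ k)
    (hkP : ∀ d ∈ P.support, (d (Sum.inl k) ≠ 0 ∨ d (Sum.inr k) ≠ 0) →
      ∃ j, Λ j < Λ k ∧ (d (Sum.inl j) ≠ 0 ∨ d (Sum.inr j) ≠ 0)) : False := by
  classical
  have hΛ := hM.2
  have hμ : ∀ i, (0 : ℝ) < Λ i := fun i => Rat.cast_pos.2 (hΛ i)
  -- 1 / N lies below all weights, and a normal form modulo o(‖z‖^N) is precise enough for every
  -- weight vector with entries at least 1 / N.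
  obtain ⟨N, hN⟩ := exists_nat_gt (∑ i, 1 / Λ i)
  have hNΛ : ∀ i, 1 / (N : ℚ) < Λ i := fun i => by
    have h1 := (Finset.single_le_sum (f := fun i => 1 / Λ i) (fun i _ => (one_div_pos.2 (hΛ i)).le)
      (Finset.mem_univ i)).trans_lt hN
    have h2 : (0 : ℚ) < N := (one_div_pos.2 (hΛ i)).trans h1
    exact (one_div_lt h2 (hΛ i)).2 h1
  have hN0 : 0 < N := by
    by_contra hcon
    have h0 : N = 0 := by omega
    have h1 := Finset.sum_nonneg (s := Finset.univ) fun i _ => (one_div_pos.2 (hΛ i)).le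
    rw [h0, Nat.cast_zero] at hN
    exact hN.not_ge h1
  have hNq : (0 : ℚ) < N := Nat.cast_pos.2 hN0
  obtain ⟨Φ', F, Q, hΦ', hF, hFP, hQm, hFQ⟩ := exists_normal_form hΛ hP hmix h N hN0
  have hbound : ∀ (μ : Fin n → ℚ), (∀ i, 1 / (N : ℚ) ≤ μ i) →
      (fun z => (F (z, 0) : ℂ) - Q.value z) =o[𝓝 0] zgauge fun i => (μ i : ℝ) := fun μ hNμ =>
    hFQ.trans_isBigO (isBigO_norm_pow_zgauge
      (fun i => Rat.cast_pos.2 ((one_div_pos.2 hNq).trans_le (hNμ i))) (fun i => by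
        have := hNμ i
        rw [div_le_iff₀ hNq, mul_comm] at this
        exact_mod_cast this) hN0)
  have hQP : ∀ d ∈ (Q - P).support, 1 < Finsupp.weight (Sum.elim Λ Λ) d := fun d hd => by
    have h1 := lt_weight_sub hμ hFP (hbound Λ fun i => (hNΛ i).le) d hd
    rw [weight_cast] at h1
    exact_mod_cast h1
  have hQ1 : ∀ d ∈ Q.support, 1 < Finsupp.weight (Sum.elim Λ Λ) d ∨ d ∈ P.support := by
    intro d hd
    by_cases hd' : d ∈ (Q - P).support
    · exact Or.inl (hQP d hd')
    · right
      rw [notMem_support_iff, coeff_sub, sub_eq_zero] at hd'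
      rw [mem_support_iff] at hd ⊢
      rwa [← hd']
  have hPQ : ∀ d ∈ P.support, d ∈ Q.support := by
    intro d hd
    by_contra hd'
    refine absurd (hP (mem_support_iff.1 hd)) (hQP d ?_).ne'
    rw [mem_support_iff, coeff_sub, notMem_support_iff.1 hd', zero_sub, neg_ne_zero]
    exact mem_support_iff.1 hd
  -- With all weights from k on raised to Λ k, each monomial of Q in tail variables has weight
  -- strictly above one; for monomials of P this is the degeneracy hypothesis. This leaves room to
  -- go below Λ k.
  have hlt : ∀ d ∈ Q.support, tailDegree k d ≠ 0 →
      1 < headWeight Λ k d + tailDegree k d * Λ k := by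
    intro d hd hB
    rcases hQ1 d hd with h1 | h1
    · exact h1.trans_le (weight_le_headWeight_add hw.2.1 k d)
    · obtain ⟨j, hj, hdj⟩ : ∃ j, Λ j < Λ k ∧ (d (Sum.inl j) ≠ 0 ∨ d (Sum.inr j) ≠ 0) := by
        by_cases hdk : d (Sum.inl k) ≠ 0 ∨ d (Sum.inr k) ≠ 0
        · exact hkP d h1 hdk
        · obtain ⟨j, hkj, hdj⟩ := exists_of_tailDegree_ne_zero hB
          refine ⟨j, hk j (lt_of_le_of_ne hkj ?_), hdj⟩
          rintro rfl
          exact hdk hdj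
      rw [← hP (mem_support_iff.1 h1)]
      exact weight_lt_headWeight_add hw.2.1 hj hdj
  -- The maximum of E is the smallest common tail weight, not below 1 / N, for which all monomials
  -- of Q still have weight at least one.
  set E : Finset ℚ := insert (1 / (N : ℚ)) ((Q.support.filter fun d => tailDegree k d ≠ 0).image
    fun d => (1 - headWeight Λ k d) / tailDegree k d) with hE
  have hEne : E.Nonempty := Finset.insert_nonempty _ _
  set x := E.max' hEne with hx
  have hxN : 1 / (N : ℚ) ≤ x := Finset.le_max' _ _ (Finset.mem_insert_self _ _)
  have hx0 : 0 < x := (one_div_pos.2 hNq).trans_le hxN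
  have hxk : x < Λ k := by
    rw [hx, Finset.max'_lt_iff]
    intro y hy
    rw [hE, Finset.mem_insert, Finset.mem_image] at hy
    rcases hy with rfl | ⟨d, hd, rfl⟩
    · exact hNΛ k
    · rw [Finset.mem_filter] at hd
      rw [div_lt_iff₀ (Nat.cast_pos.2 (Nat.pos_of_ne_zero hd.2))]
      have := hlt d hd.1 hd.2
      linarith
  have hge : ∀ d ∈ Q.support, 1 ≤ headWeight Λ k d + tailDegree k d * x := by
    intro d hd
    by_cases hB : tailDegree k d = 0
    · have h1 := weight_le_headWeight_add hw.2.1 k d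
      rw [hB, Nat.cast_zero, zero_mul] at h1 ⊢
      refine le_trans ?_ h1
      rcases hQ1 d hd with h2 | h2
      · exact h2.le
      · exact (hP (mem_support_iff.1 h2)).ge
    · have h1 : (1 - headWeight Λ k d) / tailDegree k d ≤ x :=
        Finset.le_max' E _ (by
          rw [hE]
          exact Finset.mem_insert_of_mem (Finset.mem_image.2 ⟨d, Finset.mem_filter.2 ⟨hd, hB⟩, rfl⟩))
      rw [div_le_iff₀ (Nat.cast_pos.2 (Nat.pos_of_ne_zero hB))] at h1
      linarith
  set Λ' := truncWeight Λ k x with hΛ'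
  have hΛ'N : ∀ i, 1 / (N : ℚ) ≤ Λ' i := fun i => by
    rw [hΛ', truncWeight]
    split_ifs
    · exact (hNΛ i).le
    · exact hxN
  have hΛ'0 : ∀ i, 0 < Λ' i := fun i => (one_div_pos.2 hNq).trans_le (hΛ'N i)
  have hμ' : ∀ i, (0 : ℝ) < Λ' i := fun i => Rat.cast_pos.2 (hΛ'0 i)
  have hxE : x ∈ E := Finset.max'_mem _ _
  rw [hE, Finset.mem_insert, Finset.mem_image] at hxE
  have hweight : IsWeight Λ' := by
    refine isWeight_truncWeight hw hx0 hxk ?_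
    rcases hxE with hxE | ⟨d, hd, hdx⟩
    · refine ⟨N, 0, hN0, ?_⟩
      rw [hxE]
      simp [hNq.ne']
    · rw [Finset.mem_filter] at hd
      refine ⟨tailDegree k d, fun j => d (Sum.inl j) + d (Sum.inr j), Nat.pos_of_ne_zero hd.2, ?_⟩
      change headWeight Λ k d + _ = 1
      rw [← hdx, mul_div_cancel₀ _ (Nat.cast_ne_zero.2 hd.2)]
      ring
  obtain ⟨d₀, hd₀, hd₀w⟩ : ∃ d ∈ Q.support, headWeight Λ k d + tailDegree k d * x = 1 := by
    by_cases hcase : ∃ d ∈ Q.support.filter (fun d => tailDegree k d ≠ 0),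
        (1 - headWeight Λ k d) / tailDegree k d = x
    · obtain ⟨d, hd, hdx⟩ := hcase
      rw [Finset.mem_filter] at hd
      refine ⟨d, hd.1, ?_⟩
      rw [← hdx, mul_div_cancel₀ _ (Nat.cast_ne_zero.2 hd.2)]
      ring
    -- Here only the bound 1 / N is active. A monomial of P with tail variables would now have
    -- weight below one, so P has none, and its monomials keep weight one.
    · have hxN' : x = 1 / (N : ℚ) := hxE.resolve_right hcase
      obtain ⟨d, hd⟩ := support_nonempty.2 hP0
      refine ⟨d, hPQ d hd, ?_⟩
      have h1 := hP (mem_support_iff.1 hd)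
      have hB : tailDegree k d = 0 := by
        by_contra hB
        refine (hge d (hPQ d hd)).not_gt ?_
        obtain ⟨j, hkj, hdj⟩ := exists_of_tailDegree_ne_zero hB
        rw [← weight_truncWeight, ← h1, weight_sumElim, weight_sumElim]
        have hle : ∀ j, truncWeight Λ k x j ≤ Λ j := fun j => by
          rw [truncWeight, hxN']
          split_ifs
          · exact le_rfl
          · exact (hNΛ j).le
        refine Finset.sum_lt_sum (fun j _ => mul_le_mul_of_nonneg_left (hle j) (Nat.cast_nonneg _))
          ⟨j, Finset.mem_univ _, mul_lt_mul_of_pos_left ?_ ?_⟩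
        · rw [truncWeight, if_neg hkj.not_gt, hxN']
          exact hNΛ j
        · rw [Nat.cast_pos]; omega
      refine le_antisymm ?_ (hge d (hPQ d hd))
      rw [hB, Nat.cast_zero, zero_mul, add_zero, ← h1, weight_sumElim, headWeight]
      refine Finset.sum_le_sum fun j _ => ?_
      split_ifs
      · exact le_rfl
      · exact mul_nonneg (Nat.cast_nonneg _) (hΛ j).le
  set P' : ZPoly n := weightedHomogeneousComponent (Sum.elim Λ' Λ') 1 Q with hP'
  have hP'h : IsHomogeneousOne Λ' P' := weightedHomogeneousComponent_isWeightedHomogeneous _ _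
  have hP'c : ∀ d, coeff d P' = if headWeight Λ k d + tailDegree k d * x = 1 then coeff d Q else 0 :=
    fun d => by rw [hP', coeff_weightedHomogeneousComponent, hΛ', weight_truncWeight]
  have hP'0 : P' ≠ 0 := fun h0 => by
    have := hP'c d₀
    rw [h0, if_pos hd₀w, coeff_zero] at this
    exact mem_support_iff.1 hd₀ this.symm
  have hP'm : ∀ d ∈ P'.support, IsMixed d := fun d hd => by
    rw [mem_support_iff, hP'c] at hd
    split_ifs at hd with h1
    · exact hQm d (mem_support_iff.2 hd)
    · exact absurd rfl hd
  have hQP' : ∀ d ∈ (Q - P').support,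
      (1 : ℝ) < Finsupp.weight (Sum.elim (fun i => (Λ' i : ℝ)) fun i => (Λ' i : ℝ)) d := by
    intro d hd
    rw [mem_support_iff, coeff_sub, hP'c] at hd
    rw [weight_cast, hΛ', weight_truncWeight]
    split_ifs at hd with h1
    · exact absurd (sub_self _) hd
    · rw [sub_zero] at hd
      have := lt_of_le_of_ne (hge d (mem_support_iff.2 hd)) (Ne.symm h1)
      exact_mod_cast this
  have hlead : HasLeadingPart M p Λ' Φ' P' := by
    refine HasLeadingPart.of_graph hΛ'0 hΦ' hF ?_
    have ht : Tendsto (fun x : (Fin n → ℂ) × ℝ => ((x.1, 0) : (Fin n → ℂ) × ℝ)) (𝓝 0) (𝓝 0) :=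
      tendsto_prodMk_real_zero.comp tendsto_fst_nhds_zero
    have h1 := isLittleO_graph_sub hF (tendsto_id (x := 𝓝 (0 : (Fin n → ℂ) × ℝ))) ht
    have h2 : (fun x : (Fin n → ℂ) × ℝ => id x - ((x.1, 0) : (Fin n → ℂ) × ℝ)) =O[𝓝 0]
        wgauge fun i => (Λ' i : ℝ) := IsBigO.of_norm_le fun y => by
      have : id y - ((y.1, 0) : (Fin n → ℂ) × ℝ) = (0, y.2) := by ext <;> simp
      rw [this, Prod.norm_mk, norm_zero, max_eq_right (norm_nonneg _)]
      exact norm_snd_le_gauge y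
    have h3 : (fun x => ((F x - F (x.1, 0) : ℝ) : ℂ)) =o[𝓝 0] wgauge fun i => (Λ' i : ℝ) :=
      ((h1.trans_isBigO h2).norm_left.congr_left fun z => by
        rw [← Complex.norm_real]; rfl).of_norm_left
    have h4 : (fun x : (Fin n → ℂ) × ℝ => (F (x.1, 0) : ℂ) - Q.value x.1) =o[𝓝 0]
        wgauge fun i => (Λ' i : ℝ) :=
      ((hbound Λ' hΛ'N).comp_tendsto tendsto_fst_nhds_zero).trans_isBigO
        (IsBigO.of_norm_le fun y => by
          rw [Function.comp_apply, Real.norm_of_nonneg (zgauge_nonneg _)]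
          exact zgauge_le_gauge y)
    have h5 : (fun x : (Fin n → ℂ) × ℝ => ZPoly.value (Q - P') x.1) =o[𝓝 0]
        wgauge fun i => (Λ' i : ℝ) := by
      have := ZPoly.isLittleO_value hμ' gauge_nonneg (tendsto_gauge hμ')
        (fun i => isBigO_coord_wgauge hμ' i (𝓝 (0 : (Fin n → ℂ) × ℝ))) (Q - P') one_pos hQP'
      simpa using this
    refine ((h3.add h4).add h5).congr_left fun x => ?_
    simp [ZPoly.value]
  have hdist : toLex Λ' ∈ {L : Lex (Fin n → ℚ) | IsDistinguished M p (ofLex L)} :=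
    ⟨Φ', hweight, P', hP'h, hP'0, hP'm, hlead⟩
  -- The new distinguished weight agrees with Λ before k and is smaller at k.
  refine (hM.1.1 hdist).not_gt ?_
  refine ⟨k, fun j hj => ?_, ?_⟩
  · change truncWeight Λ k x j = Λ j
    rw [truncWeight, if_pos hj]
  · change truncWeight Λ k x k < Λ k
    rw [truncWeight, if_neg (lt_irrefl k)]
    exact hxk

end Minimality

/-! ### Superhomogeneous transformations form a group. -/

section SuperhomogeneousGroup

variable {n : ℕ} {Λ : Fin n → ℚ} {T S : Space n → Space n}

/-- Superhomogeneous biholomorphic transformations fixing the origin. -/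
structure IsSuperhomAut (Λ : Fin n → ℚ) (T : Space n → Space n) : Prop where
  biholomorphic : IsBiholomorphicAt T 0
  zero : T 0 = 0
  superhomogeneous : IsSuperhomogeneous Λ T

theorem IsSuperhomAut.isBigO (hΛ : ∀ i, 0 < Λ i) (h : IsSuperhomAut Λ T) :
    (fun y => wgauge (fun i => (Λ i : ℝ)) (T y)) =O[𝓝 0] wgauge fun i => (Λ i : ℝ) :=
  ((isSuperhomogeneous_iff hΛ h.biholomorphic.1).1 h.superhomogeneous).2

theorem IsSuperhomAut.comp (hΛ : ∀ i, 0 < Λ i) (hT : IsSuperhomAut Λ T) (hS : IsSuperhomAut Λ S) :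
    IsSuperhomAut Λ (T ∘ S) := by
  have hb : IsBiholomorphicAt (T ∘ S) 0 :=
    IsBiholomorphicAt.comp (by rw [hS.zero]; exact hT.biholomorphic) hS.biholomorphic
  refine ⟨hb, by simp [hS.zero, hT.zero], (isSuperhomogeneous_iff hΛ hb.1).2 ⟨?_, ?_⟩⟩
  · intro ξ hξ
    have h1 : HasFDerivAt (T ∘ S) ((fderiv ℂ T 0).comp (fderiv ℂ S 0)) 0 := by
      refine HasFDerivAt.comp (0 : Space n) ?_ hS.biholomorphic.1.differentiableAt.hasFDerivAt
      rw [hS.zero]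
      exact hT.biholomorphic.1.differentiableAt.hasFDerivAt
    rw [h1.fderiv]
    exact hT.superhomogeneous.1 _ (hS.superhomogeneous.1 ξ hξ)
  · exact ((hT.isBigO hΛ).comp_tendsto (hS.biholomorphic.tendsto hS.zero)).trans (hS.isBigO hΛ)

/-- The estimate gauge = O(gauge ∘ T) of `isBigO_wgauge_image`, taken at S y, is the gauge bound for
S. -/
theorem IsSuperhomAut.inverse (hΛ : ∀ i, 0 < Λ i) (hT : IsSuperhomAut Λ T)
    (hS : IsBiholomorphicAt S 0) (hS0 : S 0 = 0) (hTS : ∀ᶠ x in 𝓝 0, T (S x) = x) :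
    IsSuperhomAut Λ S := by
  obtain ⟨c, hc, hcT⟩ := hT.superhomogeneous.1.exists_coeff hT.biholomorphic
  refine ⟨hS, hS0, (isSuperhomogeneous_iff hΛ hS.1).2
    ⟨preservesTangent_of_coeff (coeff_inverse hT.biholomorphic hS hS0 hTS hc hcT), ?_⟩⟩
  obtain ⟨ha, L, hL⟩ := hT.biholomorphic
  have h1 := (isBigO_wgauge_image (fun i => Rat.cast_pos.2 (hΛ i)) ha hT.zero hL
    (hT.isBigO hΛ)).comp_tendsto (hS.tendsto hS0)
  refine h1.trans_eventuallyEq ?_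
  filter_upwards [hTS] with x hx
  rw [Function.comp_apply, hx]

theorem IsSuperhomAut.congr (hΛ : ∀ i, 0 < Λ i) (hT : IsSuperhomAut Λ T) (h : T =ᶠ[𝓝 0] S) :
    IsSuperhomAut Λ S := by
  have hb : IsBiholomorphicAt S 0 := by
    obtain ⟨ha, L, hL⟩ := hT.biholomorphic
    exact ⟨ha.congr h, L, hL.congr_of_eventuallyEq h.symm⟩
  refine ⟨hb, by rw [← h.self_of_nhds, hT.zero], (isSuperhomogeneous_iff hΛ hb.1).2 ⟨?_, ?_⟩⟩
  · intro ξ hξ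
    rw [← h.fderiv_eq]
    exact hT.superhomogeneous.1 ξ hξ
  · refine (hT.isBigO hΛ).congr' ?_ EventuallyEq.rfl
    filter_upwards [h] with x hx
    rw [hx]

theorem isSuperhomAut_polyMap (hΛ : ∀ i, 0 < Λ i) {k k' : Fin n → MvPolynomial (Fin n) ℂ}
    {D D' : MvPolynomial (Fin n) ℂ} (h : PolyInverse k D k' D')
    (hk : ∀ i, IsWeightedHomogeneous (fun i => (Λ i : ℝ)) (k i) (Λ i : ℝ))
    (hD : IsWeightedHomogeneous (fun i => (Λ i : ℝ)) D 1)
    (hDo : (fun z => eval z D) =o[𝓝 0] fun z : Fin n → ℂ => z) :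
    IsSuperhomAut Λ (polyMap k D) :=
  ⟨h.isBiholomorphicAt, h.polyMap_zero, (isSuperhomogeneous_iff hΛ (analyticAt_polyMap 0)).2
    ⟨preservesTangent_polyMap h.zero' hDo,
      isBigO_wgauge_polyMap (fun i => Rat.cast_pos.2 (hΛ i)) hk hD⟩⟩

end SuperhomogeneousGroup

/-! ### Normalizing adapted coordinates by shears. -/

section Normalization

variable {n : ℕ} {M : Set (Space n)} {p : Space n} {Φ : Space n → Space n} {Λ : Fin n → ℚ}
  {P : ZPoly n}

theorem hasDerivAt_eval_line (x c : Fin n → ℂ) (q : MvPolynomial (Fin n) ℂ) (τ : ℂ) :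
    HasDerivAt (fun τ : ℂ => eval (x + τ • c) q)
      (eval (x + τ • c) (∑ j, C (c j) * pderiv j q)) τ := by
  induction q using MvPolynomial.induction_on with
  | C a => simpa using hasDerivAt_const τ a
  | add q r hq hr =>
    have e : (∑ j, C (c j) * pderiv j (q + r)) =
        (∑ j, C (c j) * pderiv j q) + ∑ j, C (c j) * pderiv j r := by
      rw [← Finset.sum_add_distrib]
      exact Finset.sum_congr rfl fun j _ => by rw [map_add, mul_add]
    rw [e, map_add]
    refine (hq.add hr).congr_of_eventuallyEq (Eventually.of_forall fun τ => ?_)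
    simp
  | mul_X q i hq =>
    have e : (∑ j, C (c j) * pderiv j (q * X i)) =
        (∑ j, C (c j) * pderiv j q) * X i + q * C (c i) := by
      rw [Finset.sum_mul]
      have : q * C (c i) = ∑ j, C (c j) * (q * pderiv j (X i)) := by
        rw [Finset.sum_eq_single i]
        · rw [pderiv_X_self]; ring
        · intro j _ hj; rw [pderiv_X_of_ne (Ne.symm hj)]; ring
        · simp
      rw [this, ← Finset.sum_add_distrib]
      refine Finset.sum_congr rfl fun j _ => ?_
      rw [pderiv_mul]; ring
    have h1 : HasDerivAt (fun τ : ℂ => x i + τ * c i) (c i) τ := by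
      simpa using ((hasDerivAt_id τ).mul_const (c i)).const_add (x i)
    rw [e]
    refine ((hq.mul h1).congr_deriv ?_).congr_of_eventuallyEq (Eventually.of_forall fun τ => ?_)
    · simp
    · simp

/-- The derivative of the slice along c has no monomials in the variables of weight at least μ i
alone, and its other monomials vanish on the line x + τ c. -/
theorem polar_add_direction {μ : Fin n → ℝ} {i : Fin n} {c : Fin n → ℂ}
    (h : ∀ q ∈ derivSpan μ P i, ∀ d : Fin n →₀ ℕ, (∀ j, d j ≠ 0 → μ i ≤ μ j) →
      coeff d (∑ j, C (c j) * pderiv j q) = 0) (hc : ∀ j, c j ≠ 0 → μ j = μ i)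
    {x η : Fin n → ℂ} (hx : ∀ j, μ j < μ i → x j = 0) (hη : ∀ j, μ j < μ i → η j = 0) (τ : ℂ) :
    P.polar (x + τ • c) η = P.polar x η := by
  have h1 : ∀ τ : ℂ, HasDerivAt (fun τ : ℂ => eval (x + τ • c) (P.slice η)) 0 τ := fun τ => by
    refine (hasDerivAt_eval_line x c (P.slice η) τ).congr_deriv ?_
    refine eval_eq_zero_of_forall_support fun d hd => ?_
    by_contra hcon
    push Not at hcon
    refine mem_support_iff.1 hd (h _ ((isDerivClosed_derivSpan i).1 η hη) d fun j hj => ?_)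
    by_contra hji
    push Not at hji
    refine hcon j hj ?_
    have hcj : c j = 0 := by
      by_contra hcj
      exact hji.ne (hc j hcj)
    simp [hx j hji, hcj]
  have h2 := is_const_of_deriv_eq_zero (fun τ => (h1 τ).differentiableAt)
    (fun τ => (h1 τ).deriv) τ 0
  simpa [ZPoly.eval_slice] using h2

/-- In adapted coordinates of multitype weight, the leading part depends on all directions. -/
theorem false_of_direction (hM : HasFiniteMultitype M p Λ) (hw : IsWeight Λ)
    (hP : IsHomogeneousOne Λ P) (hP0 : P ≠ 0) (hmix : ∀ d ∈ P.support, IsMixed d)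
    (h : HasLeadingPart M p Λ Φ P) {i : Fin n} {c : Fin n → ℂ} (hci : c i ≠ 0)
    (hc : ∀ j, c j ≠ 0 → Λ j = Λ i)
    (hPc : ∀ x η : Fin n → ℂ, (∀ j, Λ j < Λ i → x j = 0) → (∀ j, Λ j < Λ i → η j = 0) → ∀ τ : ℂ,
      P.polar (x + τ • c) η = P.polar x η) : False := by
  classical
  have hΛ := hM.2
  have hμ : ∀ i, (0 : ℝ) < Λ i := fun i => Rat.cast_pos.2 (hΛ i)
  -- The last index of the weight block of i: lowering the weights from k on must leave the rest of
  -- the block alone.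
  obtain ⟨k, hki, hk⟩ : ∃ k, Λ k = Λ i ∧ ∀ j, k < j → Λ j < Λ k := by
    have hne : (Finset.univ.filter fun j => Λ j = Λ i).Nonempty := ⟨i, by simp⟩
    refine ⟨_, (Finset.mem_filter.1 (Finset.max'_mem _ hne)).2, fun j hj => ?_⟩
    refine lt_of_le_of_ne (hw.2.1 hj.le) fun hcon => hj.not_ge (Finset.le_max' _ _ ?_)
    rw [Finset.mem_filter]
    exact ⟨Finset.mem_univ _, hcon.trans (Finset.mem_filter.1 (Finset.max'_mem _ hne)).2⟩
  set σ := Equiv.swap i k with hσ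
  have hσΛ : ∀ j, Λ (σ j) = Λ j := fun j => by
    rw [hσ, Equiv.swap_apply_def]
    split_ifs with h1 h2
    · rw [h1, hki]
    · rw [h2, hki]
    · rfl
  have hσσ : ∀ j, σ (σ j) = j := fun j => Equiv.swap_apply_self i k j
  have hσi : σ i = k := Equiv.swap_apply_left i k
  have hσk : σ k = i := Equiv.swap_apply_right i k
  let δ : Fin n → ℂ := Pi.single i 1
  have hδi : δ i = 1 := by simp [δ]
  -- `g` is a linear map sending the k-th basis vector to c and otherwise permuting coordinates by
  -- σ; `f` is its inverse. Substituting `g` turns the direction c into the k-th variable.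
  let f : Fin n → MvPolynomial (Fin n) ℂ := fun j =>
    X (σ j) + C ((δ (σ j) - c (σ j)) / c i) * X i
  let g : Fin n → MvPolynomial (Fin n) ℂ := fun j => X (σ j) + C (c j - δ j) * X k
  have hf : ∀ z j, eval z (f j) = z (σ j) + (δ (σ j) - c (σ j)) / c i * z i := fun z j => by
    simp [f]
  have hg : ∀ z j, eval z (g j) = z (σ j) + (c j - δ j) * z k := fun z j => by simp [g]
  have hinv : PolyInverse f 0 g 0 := by
    refine ⟨fun z => ?_, fun z => ?_, fun z => by simp, fun j => by rw [hf]; simp, by simp⟩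
    · funext j
      rw [hg]
      simp only [hf, hσσ, hσk, hδi]
      field_simp
      ring
    · funext j
      rw [hf]
      simp only [hg, hσσ, hσi, hδi]
      field_simp
      ring
  have hgh : ∀ j, IsWeightedHomogeneous (fun i => (Λ i : ℝ)) (g j) (Λ j : ℝ) := fun j => by
    refine IsWeightedHomogeneous.add ?_ ?_
    · have := isWeightedHomogeneous_X ℂ (fun i => (Λ i : ℝ)) (σ j)
      rwa [hσΛ] at this
    · by_cases hj : c j - δ j = 0
      · rw [hj, C_0, zero_mul]
        exact isWeightedHomogeneous_zero _ _ _
      · have hji : Λ j = Λ k := by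
          rw [hki]
          by_cases hij : j = i
          · rw [hij]
          · refine hc j fun h0 => hj ?_
            simp [h0, δ, hij]
        have := isWeightedHomogeneous_X ℂ (fun i => (Λ i : ℝ)) k
        simp only [← hji] at this
        exact this.C_mul _
  have hlead := h.polyMap hΛ hP hinv (by simp) hgh (q := 0) (isWeightedHomogeneous_zero _ _ _)
    (by simp)
  rw [imPart_zero, sub_zero] at hlead
  obtain ⟨-, F, -, hFP⟩ := hlead.1.exists_graph hΛ
  have hreal := leadingPart_real hμ (isHomogeneousOne_iff.1 hlead.2) hFP
  have hline : ∀ z η : Fin n → ℂ, (∀ j, Λ j < Λ k → z j = 0) → (∀ j, Λ j < Λ k → η j = 0) →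
      (P.subst g).polar (Function.update z k 0) η = (P.subst g).polar z η := by
    intro z η hz hη
    rw [ZPoly.polar_subst, ZPoly.polar_subst]
    have e : (fun j => eval z (g j)) =
        (fun j => eval (Function.update z k 0) (g j)) + z k • c := by
      funext j
      simp only [hg, Pi.add_apply, Pi.smul_apply, smul_eq_mul, Function.update_self, mul_zero,
        add_zero]
      by_cases hj : j = i
      · rw [hj, hσi, Function.update_self, hδi]; ring
      · have h1 : σ j ≠ k := fun h => hj (by rw [← hσσ j, h, hσk])
        have h2 : δ j = 0 := by simp [δ, hj]
        rw [Function.update_of_ne h1, h2]; ring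
    rw [e]
    refine (hPc _ _ (fun j hj => ?_) (fun j hj => ?_) _).symm
    · rw [hg, Function.update_self, mul_zero, add_zero]
      by_cases h1 : σ j = k
      · rw [h1, Function.update_self]
      · rw [Function.update_of_ne h1]
        exact hz _ (by rw [hσΛ, hki]; exact hj)
    · have hcj : c j - δ j = 0 := by
        have h1 : c j = 0 := by
          by_contra h1
          exact hj.ne (hc j h1)
        have h2 : j ≠ i := fun h => hj.ne (by rw [h])
        simp [h1, δ, h2]
      rw [eval_conjPoly, hg, hcj, zero_mul, add_zero, conjv, hη _ (by rw [hσΛ, hki]; exact hj)]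
      simp
  refine false_of_degenerate hM hw hlead.2 (hinv.subst_ne_zero hP0)
    (ZPoly.forall_mixed_subst hmix hinv.symm.zero) hlead.1 k hk fun d hd hdk => ?_
  by_contra hcon
  push Not at hcon
  have hd' : ∀ j, d j ≠ 0 → Λ k ≤ Sum.elim Λ Λ j := fun j hj => by
    by_contra h1
    push Not at h1
    rcases j with j | j
    · exact hj (hcon j h1).1
    · exact hj (hcon j h1).2
  have hsplit : ∀ x : Fin n ⊕ Fin n → ℂ, x = Sum.elim (x ∘ Sum.inl) (x ∘ Sum.inr) := fun x =>
    (Sum.elim_comp_inl_inr x).symm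
  rcases hdk with hdk | hdk
  · refine mem_support_iff.1 hd (coeff_eq_zero_of_eval_update (fun j => Λ k ≤ Sum.elim Λ Λ j)
      (i := Sum.inl k) le_rfl (fun x hx => ?_) hd' hdk)
    have := hline (x ∘ Sum.inl) (x ∘ Sum.inr) (fun j hj => hx (Sum.inl j) hj.not_ge)
      fun j hj => hx (Sum.inr j) hj.not_ge
    rw [ZPoly.polar, ZPoly.polar, ← hsplit, ← Sum.update_elim_inl, ← hsplit] at this
    exact this
  · refine mem_support_iff.1 hd (coeff_eq_zero_of_eval_update (fun j => Λ k ≤ Sum.elim Λ Λ j)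
      (i := Sum.inr k) le_rfl (fun x hx => ?_) hd' hdk)
    -- Independence of the k-th conjugate variable follows by conjugation, since the leading part is
    -- real.
    have := hline (conjv (x ∘ Sum.inr)) (conjv (x ∘ Sum.inl))
      (fun j hj => by simp [conjv, hx (Sum.inr j) hj.not_ge])
      fun j hj => by simp [conjv, hx (Sum.inl j) hj.not_ge]
    have hup : Function.update (conjv (x ∘ Sum.inr)) k 0 =
        conjv (Function.update (x ∘ Sum.inr) k 0) := by
      funext j
      by_cases hj : j = k
      · subst hj; simp [conjv]
      · simp [conjv, Function.update_of_ne hj]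
    have h2 := congrArg (starRingEnd ℂ) this
    rw [hup, ← ZPoly.polar_conjSwap, ← ZPoly.polar_conjSwap, hreal, ZPoly.polar, ZPoly.polar,
      ← hsplit, ← Sum.update_elim_inr, ← hsplit] at h2
    exact h2

/-- Adapted coordinates can be normalized by a superhomogeneous transformation so that every
variable lies in the span of the derivatives of slices of the leading part. -/
theorem exists_normalization (hM : HasFiniteMultitype M p Λ) (hw : IsWeight Λ)
    (hP : IsHomogeneousOne Λ P) (hP0 : P ≠ 0) (hmix : ∀ d ∈ P.support, IsMixed d)
    (h : HasLeadingPart M p Λ Φ P) (N : ℕ) :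
    ∃ (T : Space n → Space n) (P' : ZPoly n), IsSuperhomAut Λ T ∧ IsHomogeneousOne Λ P' ∧
      P' ≠ 0 ∧ (∀ d ∈ P'.support, IsMixed d) ∧ HasLeadingPart M p Λ (T ∘ Φ) P' ∧
      ∀ m : Fin n, m.val < N → X m ∈ derivSpan (fun i => (Λ i : ℝ)) P' m := by
  classical
  have hΛ := hM.2
  have hμ : ∀ i, (0 : ℝ) < Λ i := fun i => Rat.cast_pos.2 (hΛ i)
  -- Indices increase as weights decrease. The shear for i involves only variables of weight below Λ
  -- i, so the earlier variables stay in their spans; a degenerate direction contradicts minimality.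
  induction N with
  | zero =>
    refine ⟨id, P, ?_, hP, hP0, hmix, h, fun m hm => absurd hm (Nat.not_lt_zero _)⟩
    have hinv := polyInverse_vertical (n := n) (D := 0) (by simp)
    refine (isSuperhomAut_polyMap hΛ hinv (fun i => isWeightedHomogeneous_X _ _ _)
      (isWeightedHomogeneous_zero _ _ _) (by simp)).congr hΛ (Eventually.of_forall fun y => ?_)
    exact Prod.ext (funext fun i => by simp [polyMap]) (by simp [polyMap])
  | succ N ih =>
    obtain ⟨T, P', hT, hP', hP'0, hmix', hlead, hnorm⟩ := ih
    by_cases hN : N < n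
    swap
    · exact ⟨T, P', hT, hP', hP'0, hmix', hlead, fun m _ => hnorm m (m.2.trans_le (not_lt.1 hN))⟩
    set i : Fin n := ⟨N, hN⟩
    rcases exists_shear_or_direction hμ (isHomogeneousOne_iff.1 hP') i with
      ⟨r, hr, hrL, hrV⟩ | ⟨c, hci, hc, hcV⟩
    swap
    · refine (false_of_direction hM hw hP' hP'0 hmix' hlead hci
        (fun j hj => Rat.cast_injective (α := ℝ) (hc j hj)) fun x η hx hη τ => ?_).elim
      exact polar_add_direction hcV hc (fun j hj => hx j (Rat.cast_lt.1 hj))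
        (fun j hj => hη j (Rat.cast_lt.1 hj)) τ
    have hru : ∀ z a, eval (Function.update z i a) r = eval z r := fun z a => by
      rw [eval_eq', eval_eq']
      refine Finset.sum_congr rfl fun d hd => ?_
      congr 1
      refine Finset.prod_congr rfl fun j _ => ?_
      by_cases hj : j = i
      · have : d i = 0 := by
          by_contra h0
          exact lt_irrefl _ (hrL d hd i h0)
        rw [hj, this, pow_zero, pow_zero]
      · rw [Function.update_of_ne hj]
    have hr0 : eval 0 r = 0 := by
      refine eval_eq_zero_of_forall_support fun d hd => ?_
      have hd0 : d ≠ 0 := fun h0 => by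
        have := hr (mem_support_iff.1 hd)
        rw [h0, map_zero] at this
        exact (hμ i).ne this
      obtain ⟨l, hl⟩ := Finsupp.ne_iff.1 hd0
      exact ⟨l, hl, rfl⟩
    have hsh : ∀ {s : MvPolynomial (Fin n) ℂ}, IsWeightedHomogeneous (fun i => (Λ i : ℝ)) s (Λ i) →
        ∀ j, IsWeightedHomogeneous (fun i => (Λ i : ℝ)) (shear i s j) (Λ j : ℝ) := fun {s} hs j => by
      by_cases hj : j = i
      · rw [hj, shear, Function.update_self]
        exact (isWeightedHomogeneous_X _ _ _).sub hs
      · rw [shear, Function.update_of_ne hj]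
        exact isWeightedHomogeneous_X _ _ _
    have hinv := (polyInverse_shear hru hr0).symm
    have hlead' := hlead.polyMap hΛ hP' hinv (by simp) (hsh hr) (q := 0)
      (isWeightedHomogeneous_zero _ _ _) (by simp)
    rw [imPart_zero, sub_zero] at hlead'
    have hnr : IsWeightedHomogeneous (fun i => (Λ i : ℝ)) (-r) (Λ i) := by
      have := hr.C_mul (-1)
      simpa using this
    refine ⟨polyMap (shear i (-r)) 0 ∘ T, P'.subst (shear i r), IsSuperhomAut.comp hΛ
      (isSuperhomAut_polyMap hΛ hinv (hsh hnr) (isWeightedHomogeneous_zero _ _ _) (by simp)) hT,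
      hlead'.2, hinv.subst_ne_zero hP'0, ZPoly.forall_mixed_subst hmix' hinv.symm.zero, hlead'.1,
      fun m hm => ?_⟩
    have hmi : m ≤ i := Fin.le_def.2 (Nat.lt_succ_iff.1 hm)
    have hle : (Λ i : ℝ) ≤ Λ m := Rat.cast_le.2 (hw.2.1 hmi)
    by_cases hm' : m = i
    · have h1 := aeval_shear_mem_derivSpan hμ hr hrL le_rfl hrV
      have e : aeval (shear i r) (X i + r) = X i := by
        rw [map_add, aeval_X]
        have e2 : aeval (shear i r) r = r := by
          refine MvPolynomial.funext fun x => ?_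
          change eval x (bind₁ (shear i r) r) = _
          rw [eval_bind₁, ← hru x (x i - eval x r)]
          congr 2
          funext j
          by_cases hj : j = i
          · subst hj; simp [shear]
          · simp [shear, Function.update_of_ne hj]
        rw [e2, shear, Function.update_self, sub_add_cancel]
      rw [e] at h1
      rw [hm']
      exact h1
    · have hlt : m.val < N := lt_of_le_of_ne (Nat.lt_succ_iff.1 hm) fun h0 => hm' (Fin.ext h0)
      have h1 := aeval_shear_mem_derivSpan hμ hr hrL hle (hnorm m hlt)
      rw [aeval_X, shear, Function.update_of_ne hm'] at h1
      exact h1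

end Normalization

/-! ### Monotonicity in the weights. -/

section WeightComparison

variable {n : ℕ} {μ ν : Fin n → ℝ}

theorem isBigO_wgauge_of_le {K : Type*} [NormedAddCommGroup K] (hν : ∀ i, 0 < ν i)
    (hνμ : ∀ i, ν i ≤ μ i) {X : Type*} {l : Filter X} {ρ : X → ℝ} (h0 : ∀ a, 0 ≤ ρ a)
    (hρ : Tendsto ρ l (𝓝 0)) {y : X → (Fin n → ℂ) × K}
    (hy : ∀ i, (fun a => (y a).1 i) =O[l] fun a => ρ a ^ μ i) (hy2 : (fun a => (y a).2) =O[l] ρ) :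
    (fun a => wgauge ν (y a)) =O[l] ρ :=
  isBigO_gauge hν h0 (fun i => (hy i).trans (isBigO_rpow_of_le h0 hρ (hν i) (hνμ i))) hy2

theorem weight_mono {σ : Type*} [Fintype σ] {w w' : σ → ℝ} (h : ∀ j, w j ≤ w' j) (d : σ →₀ ℕ) :
    Finsupp.weight w d ≤ Finsupp.weight w' d := by
  rw [weight_eq_sum_mul, weight_eq_sum_mul]
  exact Finset.sum_le_sum fun j _ => mul_le_mul_of_nonneg_left (h j) (Nat.cast_nonneg _)

theorem sumElim_le (h : ∀ i, ν i ≤ μ i) (j : Fin n ⊕ Fin n) : Sum.elim ν ν j ≤ Sum.elim μ μ j := by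
  rcases j with j | j <;> exact h j

end WeightComparison

/-! ### Controlling the transverse component. -/

section Transverse

variable {n : ℕ} {M : Set (Space n)} {p : Space n} {Φ T : Space n → Space n}
  {P P' : ZPoly n} {μ ν : Fin n → ℝ}

theorem isBigO_sub_prodMk_zero (hT : AnalyticAt ℂ T 0) :
    (fun y : Space n => T y - T (y.1, 0)) =O[𝓝 0] fun y => y.2 := by
  have ht : Tendsto (fun y : Space n => (y, ((y.1, 0) : Space n))) (𝓝 0) (𝓝 ((0 : Space n), 0)) :=
    tendsto_id.prodMk_nhds (tendsto_prodMk_zero.comp tendsto_fst_nhds_zero)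
  refine (hT.hasStrictFDerivAt.isBigO_sub.comp_tendsto ht).trans ?_
  refine IsBigO.of_bound 1 (Eventually.of_forall fun y => ?_)
  have : y - ((y.1, 0) : Space n) = (0, y.2) := by ext <;> simp
  simp only [Function.comp_apply]
  rw [this, Prod.norm_mk, norm_zero, max_eq_right (norm_nonneg _), one_mul]

/-- A holomorphic function whose imaginary part is of weighted order one up to a relatively small
error is of weighted order one. -/
theorem isBigO_zgauge_of_im (hμ : ∀ i, 0 < μ i) {q : (Fin n → ℂ) → ℂ} (hq : AnalyticAt ℂ q 0)
    (hq0 : q 0 = 0) {e : (Fin n → ℂ) → ℝ} (he : e =o[𝓝 0] fun z => ‖q z‖ + zgauge μ z)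
    (h : (fun z => (q z).im - e z) =O[𝓝 0] zgauge μ) : q =O[𝓝 0] zgauge μ := by
  classical
  obtain ⟨m, hm, hm1, hmμ⟩ := exists_weight_bound hμ
  obtain ⟨N, hN⟩ := exists_nat_gt (1 / m)
  rw [div_lt_iff₀ hm] at hN
  have hN0 : 0 < N := by
    by_contra hcon
    have : N = 0 := by omega
    rw [this, Nat.cast_zero, zero_mul] at hN
    linarith
  obtain ⟨Q, hQ⟩ := exists_jet hq N
  have hQ' : (fun z => q z - eval z Q) =O[𝓝 0] zgauge μ :=
    hQ.trans (isBigO_norm_pow_zgauge hμ (fun i => hN.le.trans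
      (mul_le_mul_of_nonneg_left (hmμ i) (Nat.cast_nonneg _))) hN0)
  have hQ0 : eval 0 Q = 0 := by
    have h1 : (fun z => q z - eval z Q) =O[𝓝 0] fun z : Fin n → ℂ => ‖z - 0‖ ^ N := by
      simpa using hQ
    have h2 := h1.eq_zero_of_norm_pow hN0.ne'
    rw [hq0, zero_sub, neg_eq_zero] at h2
    exact h2
  by_cases hcase : ∀ d ∈ Q.support, 1 ≤ Finsupp.weight μ d
  · have h1 := isBigO_eval zgauge_nonneg (tendsto_zgauge hμ) (fun j => (hμ j).le)
      (isBigO_coord_zgauge hμ) Q one_pos hcase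
    simp only [Real.rpow_one] at h1
    exact (hQ'.add h1).congr_left fun z => by ring
  -- Otherwise the lowest part g of the jet has weight κ < 1. At this scale Im q is negligible, so
  -- Im g = 0, and a holomorphic polynomial with zero imaginary part and g(0) = 0 vanishes.
  exfalso
  push Not at hcase
  obtain ⟨d₁, hd₁, hd₁1⟩ := hcase
  obtain ⟨d, hd, hdmin⟩ := Finset.exists_min_image Q.support (Finsupp.weight μ) ⟨d₁, hd₁⟩
  set κ := Finsupp.weight μ d with hκdef
  have hκ1 : κ < 1 := (hdmin d₁ hd₁).trans_lt hd₁1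
  have hd0 : d ≠ 0 := by
    rintro rfl
    refine mem_support_iff.1 hd ?_
    rw [← hQ0, MvPolynomial.eval_zero]
    rfl
  have hκ : 0 < κ := by
    obtain ⟨j, hj⟩ := Finsupp.ne_iff.1 hd0
    refine lt_of_lt_of_le ?_ (apply_mul_le_weight hμ d j)
    exact mul_pos (Nat.cast_pos.2 (Nat.pos_of_ne_zero hj)) (hμ j)
  set g := weightedHomogeneousComponent μ κ Q with hg
  have hgh : IsWeightedHomogeneous μ g κ := weightedHomogeneousComponent_isWeightedHomogeneous _ _
  have hρκ : zgauge μ =o[𝓝 0] fun z => zgauge μ z ^ κ := by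
    have := isLittleO_rpow_of_lt (zgauge_nonneg (μ := μ)) (tendsto_zgauge hμ) hκ hκ1
    simpa using this
  have h1 : (fun z => eval z Q - eval z g) =o[𝓝 0] fun z => zgauge μ z ^ κ := by
    have := isLittleO_eval zgauge_nonneg (tendsto_zgauge hμ) (fun j => (hμ j).le)
      (isBigO_coord_zgauge hμ) (Q - g) hκ (fun b hb => by
        rw [mem_support_iff, coeff_sub, hg, coeff_weightedHomogeneousComponent] at hb
        split_ifs at hb with h2
        · exact absurd (sub_self _) hb
        · rw [sub_zero] at hb
          exact lt_of_le_of_ne (hdmin b (mem_support_iff.2 hb)) (Ne.symm h2))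
    simpa using this
  have h2 : (fun z => q z - eval z g) =o[𝓝 0] fun z => zgauge μ z ^ κ :=
    ((hQ'.trans_isLittleO hρκ).add h1).congr_left fun z => by ring
  have hgO : (fun z => eval z g) =O[𝓝 0] fun z => zgauge μ z ^ κ :=
    isBigO_eval zgauge_nonneg (tendsto_zgauge hμ) (fun j => (hμ j).le)
      (isBigO_coord_zgauge hμ) g hκ fun b hb => (hgh (mem_support_iff.1 hb)).ge
  have hqO : q =O[𝓝 0] fun z => zgauge μ z ^ κ := (h2.isBigO.add hgO).congr_left fun z => by ring
  have h3 : (fun z => (q z).im) =o[𝓝 0] fun z => zgauge μ z ^ κ :=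
    ((h.trans_isLittleO hρκ).add (he.trans_isBigO (hqO.norm_left.add hρκ.isBigO))).congr_left
      fun z => by ring
  have h4 : (fun z => (q z - eval z g).im) =o[𝓝 0] fun z => zgauge μ z ^ κ :=
    IsBigO.trans_isLittleO (IsBigO.of_norm_le fun z => Complex.abs_im_le_norm _) h2.norm_left
  have h5 : (imPart g).value =o[𝓝 0] fun z => zgauge μ z ^ κ := by
    refine ((h3.sub h4).norm_left.congr_left fun z => ?_).of_norm_left
    rw [value_imPart, Complex.norm_real, Complex.sub_im, sub_sub_cancel]
  have h6 := ZPoly.eq_zero_of_isLittleO_value hμ (isWeightedHomogeneous_imPart hgh) h5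
  have hg0 : eval 0 g = 0 := by
    refine eval_eq_zero_of_forall_support fun b hb => ?_
    have hb0 : b ≠ 0 := fun h0 => by
      have := hgh (mem_support_iff.1 hb)
      rw [h0, map_zero] at this
      exact hκ.ne this
    obtain ⟨l, hl⟩ := Finsupp.ne_iff.1 hb0
    exact ⟨l, hl, rfl⟩
  have hg' : g = 0 := MvPolynomial.funext fun x => by
    have h7 := polar_imPart g x 0
    rw [h6, eval_conjPoly, conjv_zero, hg0, map_zero, sub_zero] at h7
    have h8 : ZPoly.polar (0 : ZPoly n) x 0 = 0 := by simp [ZPoly.polar]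
    rw [h8, eq_comm, div_eq_zero_iff] at h7
    rw [map_zero]
    refine h7.resolve_right ?_
    simp
  have h9 : coeff d g = coeff d Q := by
    rw [hg, coeff_weightedHomogeneousComponent, if_pos rfl]
  rw [hg', coeff_zero] at h9
  exact mem_support_iff.1 hd h9.symm

/-- If the tangential components of a transformation between two graphs are bounded for a gauge,
then so is the transverse component. -/
theorem isBigO_transverse (hν : ∀ i, 0 < ν i) (hνμ : ∀ i, ν i ≤ μ i)
    (hP : IsWeightedHomogeneous (Sum.elim ν ν) P 1) (hP' : IsWeightedHomogeneous (Sum.elim ν ν) P' 1)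
    {F F' : (Fin n → ℂ) × ℝ → ℝ} (hFt : Tendsto F (𝓝 0) (𝓝 0))
    (hF : (fun x => (F x : ℂ) - P.value x.1) =o[𝓝 0] wgauge ν)
    (hF' : (fun x => (F' x : ℂ) - P'.value x.1) =o[𝓝 0] wgauge ν)
    (hT : AnalyticAt ℂ T 0) (hT0 : T 0 = 0)
    (hTμ : ∀ i, (fun y => (T y).1 i) =O[𝓝 0] fun y => wgauge μ y ^ μ i)
    (hrel : ∀ᶠ x in 𝓝 0, (T (graphPt F x)).2.im =
      F' ((T (graphPt F x)).1, (T (graphPt F x)).2.re)) :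
    (fun z : Fin n → ℂ => (T (z, 0)).2) =O[𝓝 0] zgauge μ := by
  have hμ : ∀ i, 0 < μ i := fun i => (hν i).trans_le (hνμ i)
  have hFO : (fun z : Fin n → ℂ => F (z, 0)) =O[𝓝 0] zgauge μ := by
    have h1 : (fun z : Fin n → ℂ => (F (z, 0) : ℂ) - P.value z) =O[𝓝 0] zgauge μ := by
      refine ((hF.comp_tendsto tendsto_prodMk_real_zero).isBigO.trans ?_)
      exact isBigO_wgauge_of_le hν hνμ zgauge_nonneg (tendsto_zgauge hμ)
        (isBigO_coord_zgauge hμ) (isBigO_zero _ _)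
    have h2 := ZPoly.isBigO_value hμ zgauge_nonneg (tendsto_zgauge hμ) (isBigO_coord_zgauge hμ) P
      one_pos fun d hd => (hP (mem_support_iff.1 hd)).ge.trans (weight_mono (sumElim_le hνμ) d)
    simp only [Real.rpow_one] at h2
    refine ((h1.add h2).norm_left.congr_left fun z => ?_).of_norm_left
    rw [sub_add_cancel, Complex.norm_real]
  set γ : (Fin n → ℂ) → Space n := fun z => graphPt F (z, 0) with hγ
  have hγt : Tendsto γ (𝓝 0) (𝓝 0) := (tendsto_graphPt hFt).comp tendsto_prodMk_real_zero
  have hγ2 : (fun z => (γ z).2) =O[𝓝 0] zgauge μ := by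
    refine (hFO.norm_left.congr_left fun z => ?_).of_norm_left
    simp [hγ, graphPt]
  have hγO : (fun z => wgauge μ (γ z)) =O[𝓝 0] zgauge μ :=
    isBigO_gauge hμ zgauge_nonneg (isBigO_coord_zgauge hμ) hγ2
  have hTγ : ∀ i, (fun z => (T (γ z)).1 i) =O[𝓝 0] fun z => zgauge μ z ^ μ i := fun i =>
    ((hTμ i).comp_tendsto hγt).trans (hγO.rpow (hμ i).le (Eventually.of_forall zgauge_nonneg))
  set q : (Fin n → ℂ) → ℂ := fun z => (T (z, 0)).2 with hq
  have hqa : AnalyticAt ℂ q 0 := analyticAt_coord_prodMk_zero hT none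
  have hdiff : (fun z => (T (γ z)).2 - q z) =O[𝓝 0] zgauge μ := by
    have h1 := ((isBigO_sub_prodMk_zero hT).comp_tendsto hγt).trans hγ2
    exact (IsBigO.of_norm_le fun z => norm_snd_le _).trans h1.norm_left
  set σ : (Fin n → ℂ) → (Fin n → ℂ) × ℝ := fun z => ((T (γ z)).1, (T (γ z)).2.re) with hσ
  have hTt : Tendsto T (𝓝 0) (𝓝 0) := by
    have := hT.continuousAt.tendsto; rwa [hT0] at this
  have hσt : Tendsto σ (𝓝 0) (𝓝 0) :=
    (tendsto_fst_nhds_zero.comp (hTt.comp hγt)).prodMk_nhds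
      (((Complex.continuous_re.comp continuous_snd).tendsto' (0 : Space n) 0 rfl).comp
        (hTt.comp hγt))
  -- Re q enters F' through its last argument, so ‖q‖ belongs to the comparison function; the
  -- resulting error is small relative to it.
  set τ : (Fin n → ℂ) → ℝ := fun z => ‖q z‖ + zgauge μ z with hτ
  have hτ0 : ∀ z, 0 ≤ τ z := fun z => add_nonneg (norm_nonneg _) (zgauge_nonneg z)
  have hρτ : zgauge μ =O[𝓝 0] τ := IsBigO.of_norm_le fun z => by
    rw [Real.norm_of_nonneg (zgauge_nonneg _)]
    exact le_add_of_nonneg_left (norm_nonneg _)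
  have hqτ : q =O[𝓝 0] τ := IsBigO.of_norm_le fun z => le_add_of_nonneg_right (zgauge_nonneg _)
  have hσO : (fun z => wgauge ν (σ z)) =O[𝓝 0] τ := by
    refine isBigO_gauge hν hτ0 (fun i => ?_) ?_
    · exact ((hTγ i).trans (isBigO_rpow_of_le zgauge_nonneg (tendsto_zgauge hμ) (hν i)
        (hνμ i))).trans (hρτ.rpow (hν i).le (Eventually.of_forall hτ0))
    · refine (IsBigO.of_norm_le fun z => Complex.abs_re_le_norm _).trans (IsBigO.norm_left ?_)
      exact ((hdiff.trans hρτ).add hqτ).congr_left fun z => by ring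
  have he := ((hF'.comp_tendsto hσt).trans_isBigO hσO)
  have hP'O : (fun z => P'.value (σ z).1) =O[𝓝 0] zgauge μ := by
    have h2 := ZPoly.isBigO_value hμ zgauge_nonneg (tendsto_zgauge hμ) hTγ P'
      one_pos fun d hd => (hP' (mem_support_iff.1 hd)).ge.trans (weight_mono (sumElim_le hνμ) d)
    simpa using h2
  refine isBigO_zgauge_of_im hμ hqa (by simp [hq, show ((0 : Fin n → ℂ), (0 : ℂ)) = 0 from rfl, hT0])
    (e := fun z => ((F' (σ z) : ℂ) - P'.value (σ z).1).re) ?_ ?_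
  · exact IsBigO.trans_isLittleO (IsBigO.of_norm_le fun z => Complex.abs_re_le_norm _) he.norm_left
  · have h1 : (fun z => (P'.value (σ z).1).re) =O[𝓝 0] zgauge μ :=
      (IsBigO.of_norm_le fun z => Complex.abs_re_le_norm _).trans hP'O.norm_left
    have h2 : (fun z => ((T (γ z)).2 - q z).im) =O[𝓝 0] zgauge μ :=
      (IsBigO.of_norm_le fun z => Complex.abs_im_le_norm _).trans hdiff.norm_left
    refine (h1.sub h2).congr' ?_ EventuallyEq.rfl
    filter_upwards [tendsto_prodMk_real_zero.eventually hrel] with z hz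
    have hz' : (T (γ z)).2.im = F' (σ z) := hz
    rw [Complex.sub_im, hz', Complex.sub_re, Complex.ofReal_re]
    ring

end Transverse

/-! ### Chain rule for polynomial substitutions. -/

section ChainRule

theorem pderiv_bind₁ {σ τ : Type*} [Fintype σ] (j : τ) (f : σ → MvPolynomial τ ℂ)
    (p : MvPolynomial σ ℂ) :
    pderiv j (bind₁ f p) = ∑ m, bind₁ f (pderiv m p) * pderiv j (f m) := by
  classical
  induction p using MvPolynomial.induction_on with
  | C a => simp
  | add p q hp hq =>
    simp only [map_add, hp, hq, add_mul, Finset.sum_add_distrib]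
  | mul_X p i hp =>
    rw [map_mul, bind₁_X_right, pderiv_mul, hp, Finset.sum_mul]
    have : ∀ m, bind₁ f (pderiv m (p * X i)) * pderiv j (f m) =
        bind₁ f (pderiv m p) * pderiv j (f m) * f i +
          (if m = i then bind₁ f p * pderiv j (f m) else 0) := fun m => by
      rw [pderiv_mul, map_add, map_mul, bind₁_X_right, map_mul, pderiv_X]
      by_cases hm : m = i
      · subst hm; simp; ring
      · rw [Pi.single_eq_of_ne (Ne.symm hm), if_neg hm]; simp; ring
    rw [Finset.sum_congr rfl fun m _ => this m, Finset.sum_add_distrib,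
      Finset.sum_ite_eq' Finset.univ i, if_pos (Finset.mem_univ i)]

theorem pderiv_restrictVars {σ : Type*} [Fintype σ] (S : σ → Prop) [DecidablePred S] {l : σ}
    (hl : S l) (p : MvPolynomial σ ℂ) :
    pderiv l (restrictVars S p) = restrictVars S (pderiv l p) := by
  classical
  rw [restrictVars, pderiv_bind₁, Finset.sum_eq_single l]
  · rw [if_pos hl, pderiv_X_self, mul_one]; rfl
  · intro m _ hm
    split_ifs
    · rw [pderiv_X_of_ne hm, mul_zero]
    · rw [map_zero, mul_zero]
  · exact fun h => absurd (Finset.mem_univ l) h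

end ChainRule

/-! ### Separation of variables by the derivative span. -/

section VariableSeparation

variable {n : ℕ} {μ ν : Fin n → ℝ} {P : ZPoly n} {h k : Fin n → MvPolynomial (Fin n) ℂ}

theorem pderiv_eq_zero_of_weight_lt (hμ : ∀ i, 0 < μ i) {q : MvPolynomial (Fin n) ℂ} {κ : ℝ}
    (hq : IsWeightedHomogeneous μ q κ) {l : Fin n} (hl : κ < μ l) : pderiv l q = 0 := by
  refine pderiv_eq_zero_of_notMem_vars fun hv => ?_
  rw [mem_vars_iff_mem_support] at hv
  obtain ⟨d, hd, hld⟩ := hv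
  have h1 := apply_mul_le_weight hμ d l
  rw [hq (mem_support_iff.1 hd)] at h1
  have h2 : (1 : ℝ) ≤ d l :=
    Nat.one_le_cast.2 (Nat.one_le_iff_ne_zero.2 (Finsupp.mem_support_iff.1 hld))
  have := hμ l
  nlinarith

theorem isWeightedHomogeneous_pderiv {q : MvPolynomial (Fin n) ℂ} {κ : ℝ}
    (hq : IsWeightedHomogeneous μ q κ) (j : Fin n) :
    IsWeightedHomogeneous μ (pderiv j q) (κ - μ j) := by
  intro d hd
  rw [coeff_pderiv] at hd
  have h1 := hq (left_ne_zero_of_mul hd)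
  rw [map_add, Finsupp.weight_single, one_smul] at h1
  linarith

theorem pderiv_bind₁_slice_eq_zero {S : Fin n → Prop} [DecidablePred S]
    {j : Fin n} {P : ZPoly n} {h : Fin n → MvPolynomial (Fin n) ℂ} {η : Fin n → ℂ}
    (hinv : ∀ x x' : Fin n → ℂ, (∀ i, i ≠ j → x i = x' i) →
      P.polar (fun i => if S i then eval x (h i) else 0) η =
        P.polar (fun i => if S i then eval x' (h i) else 0) η) :
    pderiv j (bind₁ (fun i => if S i then h i else 0) (P.slice η)) = 0 := by
  classical
  have e : ∀ x : Fin n → ℂ, eval x (bind₁ (fun i => if S i then h i else 0) (P.slice η)) =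
      P.polar (fun i => if S i then eval x (h i) else 0) η := fun x => by
    rw [eval_bind₁, ZPoly.eval_slice]
    congr 1
    funext i
    split_ifs <;> simp
  refine pderiv_eq_zero_of_notMem_vars fun hv => ?_
  rw [mem_vars_iff_mem_support] at hv
  obtain ⟨d, hd, hjd⟩ := hv
  refine mem_support_iff.1 hd (coeff_eq_zero_of_eval_update (fun _ => True) (i := j) trivial
    (fun x _ => ?_) (fun _ _ => trivial) (Finsupp.mem_support_iff.1 hjd))
  rw [e, e]
  exact hinv _ _ fun i hi => Function.update_of_ne hi _ _

/-- If composing `P` with the components of large weight of an invertible homogeneous map does not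
bring in the variables of small weight, then neither do these components. -/
theorem pderiv_component_eq_zero (hν : ∀ i, 0 < ν i) {s : ℝ} (hμν : ∀ i, μ i = max (ν i) s)
    (hh : ∀ i, IsWeightedHomogeneous μ (h i) (μ i)) (hk : ∀ i, IsWeightedHomogeneous μ (k i) (μ i))
    (hkh : ∀ i, bind₁ k (h i) = X i) (hhk : ∀ i, bind₁ h (k i) = X i)
    (hX : ∀ m, X m ∈ derivSpan ν P m) {j : Fin n} (hj : ν j < s)
    (hinv : ∀ x x' η : Fin n → ℂ, (∀ i, i ≠ j → x i = x' i) →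
      P.polar (fun i => if s ≤ ν i then eval x (h i) else 0) (fun i => if s ≤ ν i then η i else 0) =
      P.polar (fun i => if s ≤ ν i then eval x' (h i) else 0)
        (fun i => if s ≤ ν i then η i else 0))
    {i : Fin n} (hi : s ≤ ν i) : pderiv j (h i) = 0 := by
  classical
  have hμ : ∀ i, 0 < μ i := fun i => by rw [hμν]; exact (hν i).trans_le (le_max_left _ _)
  have hμj : μ j = s := by rw [hμν, max_eq_right hj.le]
  have hμK : ∀ i, s ≤ ν i → μ i = ν i := fun i hi => by rw [hμν, max_eq_left hi]
  -- The coefficients of the push-forward of ∂/∂x_j under h, kept only for the components of weight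
  -- at least s.
  set b : Fin n → MvPolynomial (Fin n) ℂ := fun m =>
    bind₁ k (pderiv j (if s ≤ ν m then h m else 0)) with hb
  have hbK : ∀ m, s ≤ ν m → b m = bind₁ k (pderiv j (h m)) := fun m hm => by
    simp only [hb, if_pos hm]
  have hbK' : ∀ m, ¬ s ≤ ν m → b m = 0 := fun m hm => by simp only [hb, if_neg hm, map_zero]
  suffices hb0 : ∀ m, b m = 0 by
    have h1 := hb0 i
    rw [hbK i hi] at h1
    have h2 := congrArg (bind₁ h) h1
    rw [map_zero, bind₁_bind₁] at h2
    have e : (fun m => bind₁ h (k m)) = X := funext hhk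
    rw [e, bind₁_X_left] at h2
    exact h2
  by_contra hcon
  push Not at hcon
  obtain ⟨m₀, hm₀⟩ := hcon
  -- Take a of greatest weight with b_a nonzero. Each nonzero b_m has weight ν m - s < ν a, hence is
  -- constant in variables of weight at least ν a, and the vector field commutes with
  -- differentiation in them.
  obtain ⟨a, ha, hmax⟩ := Finset.exists_max_image (Finset.univ.filter fun m => b m ≠ 0) ν
    ⟨m₀, Finset.mem_filter.2 ⟨Finset.mem_univ _, hm₀⟩⟩
  rw [Finset.mem_filter] at ha
  have haK : s ≤ ν a := by
    by_contra hcon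
    exact ha.2 (hbK' a hcon)
  have hbd : ∀ l, ν a ≤ ν l → ∀ m, pderiv l (b m) = 0 := by
    intro l hl m
    by_cases hm : b m = 0
    · rw [hm, map_zero]
    have hmK : s ≤ ν m := by
      by_contra hcon
      exact hm (hbK' m hcon)
    have hma : ν m ≤ ν a := hmax m (Finset.mem_filter.2 ⟨Finset.mem_univ _, hm⟩)
    have h1 : IsWeightedHomogeneous μ (b m) (μ m - μ j) := by
      rw [hbK m hmK]
      exact IsWeightedHomogeneous.bind₁ (isWeightedHomogeneous_pderiv (hh m) j) hk
    refine pderiv_eq_zero_of_weight_lt hμ h1 ?_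
    rw [hμK m hmK, hμK l (haK.trans hl)]
    linarith [hμ j]
  have hkS : (fun i => bind₁ k (if s ≤ ν i then h i else 0)) =
      fun i => if s ≤ ν i then X i else 0 := by
    funext i
    split_ifs
    · exact hkh i
    · rw [map_zero]
  let Y : MvPolynomial (Fin n) ℂ →ₗ[ℂ] MvPolynomial (Fin n) ℂ :=
    ∑ m, (LinearMap.mulRight ℂ (b m)).comp
      ((bind₁ (fun i => if s ≤ ν i then X i else 0)).toLinearMap.comp (pderiv m).toLinearMap)
  have hY : ∀ p, Y p = ∑ m, restrictVars (fun i => s ≤ ν i) (pderiv m p) * b m := fun p => by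
    simp only [Y, LinearMap.sum_apply]
    rfl
  -- The kernel of the restricted vector field contains the admissible slices and is closed under
  -- the admissible derivatives, so it contains X_a. But Y X_a = b_a.
  have hV : IsDerivClosed ν P a (LinearMap.ker Y) := by
    constructor
    · intro η hη
      have hη' : (fun i => if s ≤ ν i then η i else 0) = η := funext fun i => by
        split_ifs with hi
        · rfl
        · exact (hη i ((not_le.1 hi).trans_le haK)).symm
      have h1 := pderiv_bind₁_slice_eq_zero (S := fun i => s ≤ ν i) (P := P) (h := h) (η := η) (j := j)
        fun x x' hx => by
          have := hinv x x' η hx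
          rwa [hη'] at this
      rw [pderiv_bind₁] at h1
      have h2 := congrArg (bind₁ k) h1
      rw [map_zero, map_sum] at h2
      rw [LinearMap.mem_ker, hY, ← h2]
      refine Finset.sum_congr rfl fun m _ => ?_
      rw [map_mul, bind₁_bind₁, hkS]
      rfl
    · intro l hl p hp
      rw [LinearMap.mem_ker, hY] at hp ⊢
      have h1 := congrArg (pderiv l) hp
      rw [map_zero, map_sum] at h1
      rw [← h1]
      refine Finset.sum_congr rfl fun m _ => ?_
      rw [pderiv_mul, hbd l hl m, mul_zero, add_zero, pderiv_pderiv_comm m l,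
        pderiv_restrictVars (fun i => s ≤ ν i) (haK.trans hl)]
  have h1 := derivSpan_le hV (hX a)
  rw [LinearMap.mem_ker, hY, Finset.sum_eq_single a] at h1
  · rw [pderiv_X_self, restrictVars, map_one, one_mul] at h1
    exact ha.2 h1
  · intro m _ hm
    rw [pderiv_X_of_ne (Ne.symm hm), restrictVars, map_zero, zero_mul]
  · exact fun h => absurd (Finset.mem_univ a) h

end VariableSeparation

/-! ### Leading parts for cut-off weights. -/

section Restriction

variable {n : ℕ} {μ ν : Fin n → ℝ} {P : ZPoly n}

/-- The part of `P` in the variables of weight at least `s`. -/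
noncomputable def ZPoly.highPart (ν : Fin n → ℝ) (s : ℝ) (P : ZPoly n) : ZPoly n :=
  restrictVars (fun j => s ≤ Sum.elim ν ν j) P

theorem ZPoly.polar_highPart (s : ℝ) (P : ZPoly n) (x η : Fin n → ℂ) :
    (P.highPart ν s).polar x η =
      P.polar (fun i => if s ≤ ν i then x i else 0) fun i => if s ≤ ν i then η i else 0 := by
  rw [ZPoly.polar, ZPoly.highPart, eval_restrictVars, ZPoly.polar]
  congr 2
  funext j
  rcases j with j | j <;> rfl

theorem ZPoly.isWeightedHomogeneous_highPart {s : ℝ} (hμν : ∀ i, μ i = max (ν i) s)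
    (hP : IsWeightedHomogeneous (Sum.elim ν ν) P 1) :
    IsWeightedHomogeneous (Sum.elim μ μ) (P.highPart ν s) 1 := by
  intro d hd
  have hdK : ∀ j, d j ≠ 0 → s ≤ Sum.elim ν ν j := fun j hj => by
    by_contra hcon
    exact hd (coeff_restrictVars_eq_zero _ _ d hj hcon)
  rw [ZPoly.highPart, coeff_restrictVars _ _ d hdK] at hd
  rw [← hP hd, weight_eq_sum_mul, weight_eq_sum_mul]
  refine Finset.sum_congr rfl fun j _ => ?_
  by_cases hj : d j = 0
  · simp [hj]
  · congr 1
    have := hdK j hj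
    rcases j with j | j <;> exact (hμν j).trans (max_eq_left this)

/-- Raising the small weights to s lifts every monomial with such a variable above weight one and
does not change the others. -/
theorem ZPoly.isLittleO_highPart (hν : ∀ i, 0 < ν i) {s : ℝ} (hμν : ∀ i, μ i = max (ν i) s)
    (hP : IsWeightedHomogeneous (Sum.elim ν ν) P 1) {F : (Fin n → ℂ) × ℝ → ℝ}
    (hF : (fun x => (F x : ℂ) - P.value x.1) =o[𝓝 0] wgauge ν) :
    (fun x => (F x : ℂ) - (P.highPart ν s).value x.1) =o[𝓝 0] wgauge μ := by
  have hνμ : ∀ i, ν i ≤ μ i := fun i => by rw [hμν]; exact le_max_left _ _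
  have hμ : ∀ i, 0 < μ i := fun i => (hν i).trans_le (hνμ i)
  have h1 : (fun x : (Fin n → ℂ) × ℝ => wgauge ν x) =O[𝓝 0] wgauge μ :=
    isBigO_wgauge_of_le hν hνμ gauge_nonneg (tendsto_gauge hμ)
      (fun i => isBigO_coord_wgauge hμ i _) (isBigO_snd_wgauge _)
  have h2 := ZPoly.isLittleO_value hμ gauge_nonneg (tendsto_gauge hμ)
    (fun i => isBigO_coord_wgauge hμ i (𝓝 (0 : (Fin n → ℂ) × ℝ))) (P - P.highPart ν s) one_pos
    fun d hd => by
      rw [mem_support_iff, coeff_sub] at hd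
      have h3 : ∃ j, d j ≠ 0 ∧ ¬ s ≤ Sum.elim ν ν j := by
        by_contra hcon
        push Not at hcon
        rw [ZPoly.highPart, coeff_restrictVars _ _ d hcon, sub_self] at hd
        exact hd rfl
      obtain ⟨j, hj, hjs⟩ := h3
      rw [ZPoly.highPart, coeff_restrictVars_eq_zero _ _ d hj hjs, sub_zero] at hd
      rw [← hP hd, weight_eq_sum_mul, weight_eq_sum_mul]
      refine Finset.sum_lt_sum (fun j _ => mul_le_mul_of_nonneg_left (sumElim_le hνμ j)
        (Nat.cast_nonneg _)) ⟨j, Finset.mem_univ j, ?_⟩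
      refine mul_lt_mul_of_pos_left ?_ (Nat.cast_pos.2 (Nat.pos_of_ne_zero hj))
      rw [not_le] at hjs
      rcases j with j | j <;>
        exact hjs.trans_le ((le_max_right _ _).trans (hμν j).ge)
  simp only [Real.rpow_one] at h2
  refine ((hF.trans_isBigO h1).add h2).congr_left fun x => ?_
  simp [ZPoly.value]

end Restriction

/-! ### Leading terms of high weight involve only variables of high weight. -/

section Separation

variable {n : ℕ} {M : Set (Space n)} {p : Space n} {Φ T S : Space n → Space n}
  {P P' : ZPoly n} {μ ν : Fin n → ℝ} {h k : Fin n → MvPolynomial (Fin n) ℂ}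

/-- The leading terms of mutually inverse maps are mutually inverse. -/
theorem bind₁_expansion (hμ : ∀ i, 0 < μ i) (hST : ∀ᶠ y in 𝓝 0, S (T y) = y)
    (hTt : Tendsto T (𝓝 0) (𝓝 0)) (hTμ : (fun y => wgauge μ (T y)) =O[𝓝 0] wgauge μ)
    (hh : ∀ i, IsWeightedHomogeneous μ (h i) (μ i)) (hk : ∀ i, IsWeightedHomogeneous μ (k i) (μ i))
    (hTh : ∀ i, (fun y : Space n => (T y).1 i - eval y.1 (h i)) =o[𝓝 0] fun y => wgauge μ y ^ μ i)
    (hSk : ∀ i, (fun y : Space n => (S y).1 i - eval y.1 (k i)) =o[𝓝 0] fun y => wgauge μ y ^ μ i)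
    (i : Fin n) : bind₁ h (k i) = X i := by
  have h1 := ((hSk i).comp_tendsto hTt).trans_isBigO
    (hTμ.rpow (hμ i).le (Eventually.of_forall gauge_nonneg))
  have h2 := isLittleO_eval_sub_eval (ρ := wgauge μ) gauge_nonneg (fun j => (hμ j).le)
    (fun j => isBigO_coord_of_isBigO_wgauge hμ gauge_nonneg hTμ (some j)) hTh (hk i)
  have h3 : (fun y : Space n => y.1 i - eval y.1 (bind₁ h (k i))) =o[𝓝 0]
      fun y => wgauge μ y ^ μ i := by
    refine (h1.add h2).congr' ?_ EventuallyEq.rfl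
    filter_upwards [hST] with y hy
    rw [Function.comp_apply, hy, eval_bind₁]
    simp only [coord_some]
    rw [sub_add_sub_cancel]
  have h4 := h3.comp_tendsto tendsto_prodMk_zero
  rw [eq_comm, ← sub_eq_zero]
  refine eq_zero_of_isLittleO_eval hμ ((isWeightedHomogeneous_X ℂ μ i).sub
    (IsWeightedHomogeneous.bind₁ (hk i) hh)) (h4.congr (fun z => ?_) fun z => ?_)
  · simp
  · simp [gauge_zero_right]

theorem eval_zero_of_isWeightedHomogeneous {q : MvPolynomial (Fin n) ℂ} {κ : ℝ} (hκ : 0 < κ)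
    (hq : IsWeightedHomogeneous μ q κ) : eval 0 q = 0 := by
  refine eval_eq_zero_of_forall_support fun d hd => ?_
  have hd0 : d ≠ 0 := fun h0 => by
    have := hq (mem_support_iff.1 hd)
    rw [h0, map_zero] at this
    exact hκ.ne this
  obtain ⟨l, hl⟩ := Finsupp.ne_iff.1 hd0
  exact ⟨l, hl, rfl⟩

/-- Suppose that the leading parts of a hypersurface in two coordinate systems are related by a
transformation which is bounded for the weights cut off below at `s`. Then the leading terms of its
components of weight at least `s` involve only variables of weight at least `s`. -/
theorem pderiv_leading_eq_zero (hν : ∀ i, 0 < ν i) {s : ℝ} (hμν : ∀ i, μ i = max (ν i) s)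
    (hμ1 : ∀ i, μ i < 1) (hP : IsWeightedHomogeneous (Sum.elim ν ν) P 1)
    (hP' : IsWeightedHomogeneous (Sum.elim ν ν) P' 1) (hmix : ∀ d ∈ P'.support, IsMixed d)
    (hX : ∀ m, X m ∈ derivSpan ν P' m)
    {F F' : (Fin n → ℂ) × ℝ → ℝ} (hFt : Tendsto F (𝓝 0) (𝓝 0))
    (hF : (fun x => (F x : ℂ) - P.value x.1) =o[𝓝 0] wgauge ν)
    (hF' : (fun x => (F' x : ℂ) - P'.value x.1) =o[𝓝 0] wgauge ν)
    (hT : IsBiholomorphicAt T 0) (hT0 : T 0 = 0) (hTt : PreservesTangent T)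
    (hTμ : (fun y => wgauge μ (T y)) =O[𝓝 0] wgauge μ)
    (hrel : ∀ᶠ x in 𝓝 0, (T (graphPt F x)).2.im =
      F' ((T (graphPt F x)).1, (T (graphPt F x)).2.re))
    (hh : ∀ i, IsWeightedHomogeneous μ (h i) (μ i))
    (hTh : ∀ i, (fun y : Space n => (T y).1 i - eval y.1 (h i)) =o[𝓝 0] fun y => wgauge μ y ^ μ i)
    {i j : Fin n} (hi : s ≤ ν i) (hj : ν j < s) : pderiv j (h i) = 0 := by
  have hμ : ∀ i, 0 < μ i := fun i => by rw [hμν]; exact (hν i).trans_le (le_max_left _ _)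
  obtain ⟨c, hc, hcT⟩ := hTt.exists_coeff hT
  obtain ⟨S, hS, hS0, hST, hTS⟩ := hT.exists_inverse hT0
  have hcS := coeff_inverse hT hS hS0 hTS hc hcT
  have hSμ : (fun y => wgauge μ (S y)) =O[𝓝 0] wgauge μ := by
    obtain ⟨ha, L, hL⟩ := hT
    have h1 := (isBigO_wgauge_image hμ ha hT0 hL hTμ).comp_tendsto (hS.tendsto hS0)
    refine h1.trans_eventuallyEq ?_
    filter_upwards [hTS] with x hx
    rw [Function.comp_apply, hx]
  obtain ⟨k, -, hk, -, hSk, -⟩ := exists_expansion hμ hμ1 hS.1 hSμ hcS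
  obtain ⟨h', D, hh', hD, hTh', hTD⟩ := exists_expansion hμ hμ1 hT.1 hTμ hcT
  have hkh := bind₁_expansion hμ hTS (hS.tendsto hS0) hSμ hk hh hSk hTh
  have hhk := bind₁_expansion hμ hST (hT.tendsto hT0) hTμ hh hk hTh hSk
  refine pderiv_component_eq_zero hν hμν hh hk hkh hhk hX hj (fun x x' η hxx' => ?_) hi
  have hPs := ZPoly.isWeightedHomogeneous_highPart hμν hP
  have hPs' := ZPoly.isWeightedHomogeneous_highPart hμν hP'
  have h1 := isLittleO_graph_transfer hμ hPs' (ZPoly.isLittleO_highPart hν hμν hP' hF') hFt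
    (hT.tendsto hT0) hc hh hD hTh hTD hrel
  have h2 := leadingPart_unique hμ hPs (IsWeightedHomogeneous.C_mul
    ((ZPoly.isWeightedHomogeneous_subst hPs' hh).sub (isWeightedHomogeneous_imPart hD)) _)
    (ZPoly.isLittleO_highPart hν hμν hP hF) h1
  -- The transformation rule for the cut-off leading parts, polarised so that x and ξ are
  -- independent.
  have hpol : ∀ x ξ : Fin n → ℂ,
      P'.polar (fun i => if s ≤ ν i then eval x (h i) else 0)
        (fun i => if s ≤ ν i then eval ξ (conjPoly (h i)) else 0) =
      (c : ℂ) * P.polar (fun i => if s ≤ ν i then x i else 0) (fun i => if s ≤ ν i then ξ i else 0)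
        + (eval x D - eval ξ (conjPoly D)) / (2 * Complex.I) := by
    intro x ξ
    have h3 := congrArg (fun Q => ZPoly.polar Q x ξ) h2
    have h4 : ∀ (a : ℂ) (A B : ZPoly n), ZPoly.polar (C a * (A - B)) x ξ =
        a * (A.polar x ξ - B.polar x ξ) := fun a A B => by simp [ZPoly.polar]
    simp only [h4, ZPoly.polar_subst, polar_imPart, ZPoly.polar_highPart] at h3
    rw [h3, mul_inv_cancel_left₀ (Complex.ofReal_ne_zero.2 hc)]
    ring
  have hconj0 : ∀ q : MvPolynomial (Fin n) ℂ, eval 0 q = 0 → eval 0 (conjPoly q) = 0 :=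
    fun q hq => by rw [eval_conjPoly, conjv_zero, hq, map_zero]
  have hif0 : (fun i => if s ≤ ν i then (0 : Fin n → ℂ) i else 0) = 0 := by
    funext i; simp
  have hmix0 := (ZPoly.forall_mixed_iff_polar.1 hmix).1
  -- At ξ = 0 the left side vanishes as P' is mixed, so D involves only the variables of weight at
  -- least s.
  have hz : ∀ x : Fin n → ℂ, eval x D / (2 * Complex.I) =
      -((c : ℂ) * P.polar (fun i => if s ≤ ν i then x i else 0) 0) := fun x => by
    have h3 := hpol x 0
    rw [hconj0 D (eval_zero_of_isWeightedHomogeneous one_pos hD), sub_zero, hif0] at h3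
    have e : (fun i => if s ≤ ν i then eval (0 : Fin n → ℂ) (conjPoly (h i)) else 0) =
        (0 : Fin n → ℂ) := by
      funext i
      rw [hconj0 _ (eval_zero_of_isWeightedHomogeneous (hμ i) (hh i)), ite_self, Pi.zero_apply]
    rw [e, hmix0] at h3
    linear_combination -h3
  have hxρ : (fun i => if s ≤ ν i then x i else 0) = fun i => if s ≤ ν i then x' i else 0 := by
    funext i
    split_ifs with hi
    · exact hxx' i (fun hij => (hj.trans_le (hij ▸ hi)).false)
    · rfl
  -- Chosen with the inverse k of h so that the conjugate argument in `hpol` becomes the prescribed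
  -- η.
  set ξ : Fin n → ℂ := conjv fun i => eval (conjv η) (k i) with hξ
  have hξη : ∀ i, eval ξ (conjPoly (h i)) = η i := fun i => by
    rw [eval_conjPoly, hξ, conjv_conjv, ← eval_bind₁, hkh, eval_X, conjv, Complex.conj_conj]
  have h5 := hpol x ξ
  have h6 := hpol x' ξ
  simp only [hξη] at h5 h6
  rw [h5, h6, hxρ, sub_div, sub_div, hz, hz, hxρ]

end Separation

/-! ### Weighted orders of components read from jets. -/

section Jets

variable {n : ℕ} {μ : Fin n → ℝ} {T : Space n → Space n}

/-- The weighted order of a component of a holomorphic map can be read off from its jet. -/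
theorem isBigO_fst_iff_jet (hμ : ∀ i, 0 < μ i) (hT : AnalyticAt ℂ T 0) {i : Fin n}
    {Q : MvPolynomial (Fin n) ℂ} {N : ℕ} (hN : 0 < N) (hNμ : ∀ i, 1 ≤ N * μ i)
    (hQ : (fun z => (T (z, 0)).1 i - eval z Q) =O[𝓝 0] fun z : Fin n → ℂ => ‖z‖ ^ N) {κ : ℝ}
    (hκ : 0 < κ) (hκ1 : κ ≤ 1) :
    (fun y => (T y).1 i) =O[𝓝 0] (fun y => wgauge μ y ^ κ) ↔
      ∀ d ∈ Q.support, κ ≤ Finsupp.weight μ d := by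
  have h1 : (fun z => (T (z, 0)).1 i - eval z Q) =O[𝓝 0] fun z => zgauge μ z ^ κ := by
    refine (hQ.trans (isBigO_norm_pow_zgauge hμ hNμ hN)).trans ?_
    simpa using isBigO_rpow_of_le (zgauge_nonneg (μ := μ)) (tendsto_zgauge hμ) hκ hκ1
  constructor
  · intro h
    refine le_weight_of_isBigO_eval hμ ?_
    have h2 : (fun z => (T (z, 0)).1 i) =O[𝓝 0] fun z => zgauge μ z ^ κ :=
      (h.comp_tendsto tendsto_prodMk_zero).congr_right fun z => by
        simp only [Function.comp_apply, gauge_zero_right]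
    exact (h2.sub h1).congr_left fun z => by ring
  · intro h
    have h2 := isBigO_eval zgauge_nonneg (tendsto_zgauge hμ) (fun j => (hμ j).le)
      (isBigO_coord_zgauge hμ) Q hκ h
    have h3 : (fun y : Space n => (T (y.1, 0)).1 i) =O[𝓝 0] fun y => wgauge μ y ^ κ :=
      (((h1.add h2).congr_left fun z => by ring).comp_tendsto tendsto_fst_nhds_zero).trans
        (isBigO_zgauge_fst_rpow hκ.le)
    have h4 : (fun y : Space n => wgauge μ y) =O[𝓝 0] fun y => wgauge μ y ^ κ := by
      simpa using isBigO_rpow_of_le (gauge_nonneg (μ := μ) (K := ℂ)) (tendsto_gauge hμ) hκ hκ1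
    have h5 : (fun y : Space n => (T y - T (y.1, 0)).1 i) =O[𝓝 0] fun y => wgauge μ y ^ κ :=
      (IsBigO.of_norm_le fun y => (norm_le_pi_norm _ i).trans (norm_fst_le _)).trans
        (((isBigO_sub_prodMk_zero hT).trans (isBigO_snd_wgauge _)).trans h4).norm_left
    exact (h5.add h3).congr_left fun y => by simp

theorem coeff_eq_of_isLittleO (hμ : ∀ i, 0 < μ i) {q : (Fin n → ℂ) → ℂ}
    {Q h : MvPolynomial (Fin n) ℂ} {κ : ℝ}
    (hQ : (fun z => q z - eval z Q) =o[𝓝 0] fun z => zgauge μ z ^ κ)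
    (hh : (fun z => q z - eval z h) =o[𝓝 0] fun z => zgauge μ z ^ κ) {d : Fin n →₀ ℕ}
    (hd : Finsupp.weight μ d ≤ κ) : coeff d Q = coeff d h := by
  have h1 : (fun z => eval z (Q - h)) =o[𝓝 0] fun z => zgauge μ z ^ κ :=
    (hh.sub hQ).congr_left fun z => by simp
  by_contra hcon
  refine (lt_weight_of_isLittleO_eval (fun z => isLittleO_comp_dil hμ h1 z) d ?_).not_ge hd
  rwa [mem_support_iff, coeff_sub, sub_ne_zero]

end Jets

/-! ### Lowering the cut-off of the weights. -/

section Descent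

variable {n : ℕ} {T : Space n → Space n} {P P' : ZPoly n} {ν : Fin n → ℝ}

/-- A transformation between two graphs whose leading parts have the same weights is bounded for
these weights, if the second leading part is in normal form. -/
theorem isBigO_wgauge_of_leadingPart (hν : ∀ i, 0 < ν i) (hν2 : ∀ i, ν i ≤ 1 / 2)
    (hP : IsWeightedHomogeneous (Sum.elim ν ν) P 1)
    (hP' : IsWeightedHomogeneous (Sum.elim ν ν) P' 1) (hmix : ∀ d ∈ P'.support, IsMixed d)
    (hX : ∀ m, X m ∈ derivSpan ν P' m)
    {F F' : (Fin n → ℂ) × ℝ → ℝ} (hFt : Tendsto F (𝓝 0) (𝓝 0))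
    (hF : (fun x => (F x : ℂ) - P.value x.1) =o[𝓝 0] wgauge ν)
    (hF' : (fun x => (F' x : ℂ) - P'.value x.1) =o[𝓝 0] wgauge ν)
    (hT : IsBiholomorphicAt T 0) (hT0 : T 0 = 0) (hTt : PreservesTangent T)
    (hrel : ∀ᶠ x in 𝓝 0, (T (graphPt F x)).2.im =
      F' ((T (graphPt F x)).1, (T (graphPt F x)).2.re)) :
    (fun y => wgauge ν (T y)) =O[𝓝 0] wgauge ν := by
  obtain ⟨m', hm', -, hmν'⟩ := exists_weight_bound hν
  obtain ⟨m, hm, hm2, hmν⟩ : ∃ m : ℝ, 0 < m ∧ m ≤ 1 / 2 ∧ ∀ i, m ≤ ν i :=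
    ⟨min m' (1 / 2), lt_min hm' (by norm_num), min_le_right _ _,
      fun i => (min_le_left _ _).trans (hmν' i)⟩
  obtain ⟨N, hN⟩ := exists_nat_gt (1 / m)
  rw [div_lt_iff₀ hm] at hN
  have hN0 : 0 < N := by
    by_contra hcon
    have : N = 0 := by omega
    rw [this, Nat.cast_zero, zero_mul] at hN
    linarith
  choose Q hQ using fun i : Fin n => exists_jet (analyticAt_coord_prodMk_zero hT.1 (some i)) N
  -- At s = 1/2 all weights equal 1/2; at s = m they are the weights ν.
  set μ : ℝ → Fin n → ℝ := fun s i => max (ν i) s with hμdef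
  have hμν : ∀ s i, ν i ≤ μ s i := fun s i => le_max_left _ _
  have hμ : ∀ s i, 0 < μ s i := fun s i => (hν i).trans_le (hμν s i)
  have hμ2 : ∀ s, s ≤ 1 / 2 → ∀ i, μ s i ≤ 1 / 2 := fun s hs i => max_le (hν2 i) hs
  have hNμ : ∀ s i, 1 ≤ N * μ s i := fun s i =>
    hN.le.trans (mul_le_mul_of_nonneg_left ((hmν i).trans (hμν s i)) (Nat.cast_nonneg _))
  -- Boundedness for the weights μ s is encoded by finitely many inequalities between continuous
  -- functions of s, so A is closed.
  set A : Set ℝ := {s | ∀ i, ∀ d ∈ (Q i).support, μ s i ≤ Finsupp.weight (μ s) d} with hA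
  have hAO : ∀ s ≤ 1 / 2, s ∈ A → (fun y => wgauge (μ s) (T y)) =O[𝓝 0] wgauge (μ s) := by
    intro s hs hsA
    have h1 : ∀ i, (fun y => (T y).1 i) =O[𝓝 0] fun y => wgauge (μ s) y ^ μ s i := fun i =>
      (isBigO_fst_iff_jet (hμ s) hT.1 hN0 (hNμ s) (hQ i) (hμ s i)
        ((hμ2 s hs i).trans (by norm_num))).2 (hsA i)
    have h2 := isBigO_transverse hν (hμν s) hP hP' hFt hF hF' hT.1 hT0 h1 hrel
    refine isBigO_gauge (hμ s) gauge_nonneg h1 ?_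
    have h3 : (fun y : Space n => (T (y.1, 0)).2) =O[𝓝 0] wgauge (μ s) := by
      refine (h2.comp_tendsto tendsto_fst_nhds_zero).trans ?_
      have := isBigO_zgauge_fst_rpow (μ := μ s) (K := ℂ) zero_le_one
      simp only [Real.rpow_one] at this
      exact this
    have h4 : (fun y : Space n => (T y - T (y.1, 0)).2) =O[𝓝 0] wgauge (μ s) :=
      (IsBigO.of_norm_le fun y => norm_snd_le _).trans
        ((isBigO_sub_prodMk_zero hT.1).trans (isBigO_snd_wgauge _)).norm_left
    exact (h4.add h3).congr_left fun y => by simp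
  have hd0 : ∀ i, ∀ d ∈ (Q i).support, ∃ j, d j ≠ 0 := by
    intro i d hd
    have h1 : (fun z => (T (z, 0)).1 i - eval z (Q i)) =O[𝓝 0]
        fun z : Fin n → ℂ => ‖z - 0‖ ^ N := by
      simpa [coord_some] using hQ i
    have h2 := h1.eq_zero_of_norm_pow hN0.ne'
    rw [show ((0 : Fin n → ℂ), (0 : ℂ)) = 0 from rfl, hT0, Prod.fst_zero, Pi.zero_apply,
      zero_sub, neg_eq_zero, MvPolynomial.eval_zero] at h2
    refine Finsupp.ne_iff.1 fun h0 : d = 0 => mem_support_iff.1 hd ?_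
    rw [h0]
    exact h2
  -- Components of cut-off weight s carry no condition, as every nonconstant monomial has weight at
  -- least s.
  have hlow : ∀ s i, ν i ≤ s → ∀ d ∈ (Q i).support, μ s i ≤ Finsupp.weight (μ s) d := by
    intro s i his d hd
    obtain ⟨j, hj⟩ := hd0 i d hd
    have h1 : (1 : ℝ) ≤ d j := Nat.one_le_cast.2 (Nat.one_le_iff_ne_zero.2 hj)
    have h2 : s ≤ μ s j := le_max_right _ _
    have h3 := apply_mul_le_weight (hμ s) d j
    have h4 : μ s i = s := max_eq_right his
    have := hμ s j
    nlinarith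
  have hcont : ∀ d : Fin n →₀ ℕ, Continuous fun s => Finsupp.weight (μ s) d := fun d => by
    simp only [weight_eq_sum_mul, hμdef]
    fun_prop
  have hcont' : ∀ i, Continuous fun s => μ s i := fun i => by
    simp only [hμdef]
    fun_prop
  have hAc : IsClosed A := by
    have : A = ⋂ i, ⋂ d ∈ (Q i).support, {s | μ s i ≤ Finsupp.weight (μ s) d} := by
      ext s; simp [hA]
    rw [this]
    exact isClosed_iInter fun i => isClosed_biInter fun d _ => isClosed_le (hcont' i) (hcont d)
  have hne : (Set.Icc m (1 / 2) ∩ A).Nonempty :=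
    ⟨1 / 2, ⟨hm2, le_rfl⟩, fun i => hlow _ i (hν2 i)⟩
  obtain ⟨s, ⟨⟨hms, hs2⟩, hsA⟩, hleast⟩ := (isCompact_Icc.inter_right hAc).exists_isLeast hne
  have hsm : s = m := by
    by_contra hcon
    have hms' : m < s := lt_of_le_of_ne hms (Ne.symm hcon)
    have hTμ := hAO s hs2 hsA
    have hμ1 : ∀ i, μ s i < 1 := fun i => (hμ2 s hs2 i).trans_lt (by norm_num)
    obtain ⟨c, hc, hcT⟩ := hTt.exists_coeff hT
    obtain ⟨h, -, hh, -, hTh, -⟩ := exists_expansion (hμ s) hμ1 hT.1 hTμ hcT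
    have hsep : ∀ i j, s ≤ ν i → ν j < s → pderiv j (h i) = 0 := fun i j hi hj =>
      pderiv_leading_eq_zero hν (fun _ => rfl) hμ1 hP hP' hmix hX hFt hF hF' hT hT0 hTt hTμ hrel
        hh hTh hi hj
    have hcoeff : ∀ i d, Finsupp.weight (μ s) d ≤ μ s i → coeff d (Q i) = coeff d (h i) := by
      intro i d hd
      refine coeff_eq_of_isLittleO (hμ s) (q := fun z => (T (z, 0)).1 i) ?_ ?_ hd
      · refine ((hQ i).trans (isBigO_norm_pow_zgauge (hμ s) (hNμ s) hN0)).trans_isLittleO ?_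
        simpa using isLittleO_rpow_of_lt (zgauge_nonneg (μ := μ s)) (tendsto_zgauge (hμ s))
          (hμ s i) (hμ1 i)
      · refine ((hTh i).comp_tendsto tendsto_prodMk_zero).congr_right fun z => ?_
        simp only [Function.comp_apply, gauge_zero_right]
    -- Strict inequalities persist by continuity. In the case of equality the monomial occurs in the
    -- leading term h_i, so its variables have weight at least s, and neither side changes when s
    -- decreases.
    have hev : ∀ᶠ s' in 𝓝[<] s, s' ∈ A := by
      simp only [hA, Set.mem_ofPred_eq, eventually_all]
      intro i
      rw [Filter.eventually_all_finset]
      intro d hd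
      rcases lt_or_ge (ν i) s with his | his
      · filter_upwards [nhdsWithin_le_nhds (lt_mem_nhds his)] with s' hs'
        exact hlow s' i (le_of_lt hs') d hd
      rcases (hsA i d hd).lt_or_eq with hlt | heq
      · exact nhdsWithin_le_nhds ((((hcont' i).tendsto s).eventually_lt
          ((hcont d).tendsto s) hlt).mono fun _ => le_of_lt)
      · have hdh : coeff d (h i) ≠ 0 := by
          rw [← hcoeff i d heq.ge]
          exact mem_support_iff.1 hd
        have hdK : ∀ j, d j ≠ 0 → s ≤ ν j := by
          intro j hj
          by_contra hjs
          have h1 := hsep i j his (not_le.1 hjs)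
          have h2 : Finsupp.single j 1 ≤ d := by
            rw [Finsupp.single_le_iff]; omega
          obtain ⟨e, rfl⟩ := exists_add_of_le h2
          have h3 := congrArg (coeff e) h1
          rw [coeff_pderiv, coeff_zero, add_comm, mul_eq_zero] at h3
          exact h3.elim hdh (Nat.cast_add_one_ne_zero _)
        filter_upwards [self_mem_nhdsWithin] with s' hs'
        have hs's : s' < s := hs'
        have h4 : μ s' i = μ s i := by
          simp only [hμdef]
          rw [max_eq_left his, max_eq_left (hs's.le.trans his)]
        have h5 : Finsupp.weight (μ s') d = Finsupp.weight (μ s) d := by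
          rw [weight_eq_sum_mul, weight_eq_sum_mul]
          refine Finset.sum_congr rfl fun j _ => ?_
          by_cases hj : d j = 0
          · simp [hj]
          · simp only [hμdef]
            rw [max_eq_left (hdK j hj), max_eq_left (hs's.le.trans (hdK j hj))]
        rw [h4, h5, heq]
    have hev' : ∀ᶠ s' in 𝓝[<] s, s' < s := self_mem_nhdsWithin
    obtain ⟨s', hs'A, hs', hs'm⟩ := (hev.and (hev'.and
      (nhdsWithin_le_nhds (lt_mem_nhds hms')))).exists
    exact (hleast ⟨⟨le_of_lt hs'm, (le_of_lt hs').trans hs2⟩, hs'A⟩).not_gt hs'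
  have hμm : μ s = ν := by
    funext i
    rw [hsm]
    exact max_eq_left (hmν i)
  have := hAO s hs2 hsA
  rwa [hμm] at this

end Descent

/-! ### Removing pluriharmonic terms of weight one. -/

section MixedPart

variable {n : ℕ} {M : Set (Space n)} {p : Space n} {Φ : Space n → Space n} {Λ : Fin n → ℚ}
  {P : ZPoly n} {μ : Fin n → ℝ}

theorem isWeightedHomogeneous_slice_zero {κ : ℝ} (hP : IsWeightedHomogeneous (Sum.elim μ μ) P κ) :
    IsWeightedHomogeneous μ (P.slice 0) κ := by
  refine IsWeightedHomogeneous.bind₁ hP fun j => ?_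
  rcases j with j | j
  · exact isWeightedHomogeneous_X _ _ _
  · simpa using isWeightedHomogeneous_zero ℂ μ (μ j)

theorem polar_zero_zero (hP : IsWeightedHomogeneous (Sum.elim μ μ) P 1) : P.polar 0 0 = 0 := by
  rw [← ZPoly.eval_slice]
  exact eval_zero_of_isWeightedHomogeneous one_pos (isWeightedHomogeneous_slice_zero hP)

theorem eval_conjPoly_zero {q : MvPolynomial (Fin n) ℂ} (hq : eval 0 q = 0) :
    eval 0 (conjPoly q) = 0 := by
  rw [eval_conjPoly, conjv_zero, hq, map_zero]

/-- By reality the pluriharmonic part is q plus its conjugate, where q is the slice at 0, and 2 Re q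
= Im (2 i q). -/
theorem mixedPart_eq_sub_imPart (hP : P.conjSwap = P) (h0 : P.polar 0 0 = 0) :
    P.mixedPart = P - imPart (C (2 * Complex.I) * P.slice 0) := by
  refine ZPoly.polar_ext fun x η => ?_
  have h1 : ZPoly.polar (P - imPart (C (2 * Complex.I) * P.slice 0)) x η =
      P.polar x η - (imPart (C (2 * Complex.I) * P.slice 0)).polar x η := by simp [ZPoly.polar]
  have h2 : (starRingEnd ℂ) (P.polar (conjv η) 0) = P.polar 0 η := by
    have := ZPoly.polar_conjSwap P 0 η
    rw [conjv_zero] at this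
    rw [← this, hP]
  have h3 : ∀ y, eval y (C (2 * Complex.I) * P.slice 0) = 2 * Complex.I * P.polar y 0 := fun y => by
    rw [map_mul (eval y), eval_C, ZPoly.eval_slice]
  rw [h1, ZPoly.polar_mixedPart, polar_imPart, h0, eval_conjPoly, h3, h3, map_mul, h2]
  simp only [map_mul, Complex.conj_I, map_ofNat]
  have := Complex.I_ne_zero
  field_simp
  ring

/-- As weights are at most 1/2, a monomial of weight one has degree at least two. -/
theorem isLittleO_eval_of_weight_le_half (hμ2 : ∀ i, μ i ≤ 1 / 2) {D : MvPolynomial (Fin n) ℂ}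
    (hD : IsWeightedHomogeneous μ D 1) :
    (fun z => eval z D) =o[𝓝 0] fun z : Fin n → ℂ => z := by
  have ht : Tendsto (fun z : Fin n → ℂ => ‖z‖) (𝓝 0) (𝓝 0) := tendsto_norm_zero
  have h1 := isLittleO_eval (X := Fin n → ℂ) (l := 𝓝 0) (ρ := fun z => ‖z‖) (w := fun _ => 1)
    (y := fun z => z) (fun z => norm_nonneg z) ht (fun _ => zero_le_one)
    (fun j => IsBigO.of_norm_le fun z => by
      simpa using norm_le_pi_norm z j) D one_pos fun d hd => by
      have h2 := hD (mem_support_iff.1 hd)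
      rw [weight_eq_sum_mul] at h2 ⊢
      have h3 : ∑ i, (d i : ℝ) * μ i ≤ ∑ i, (d i : ℝ) * (1 / 2) :=
        Finset.sum_le_sum fun i _ => mul_le_mul_of_nonneg_left (hμ2 i) (Nat.cast_nonneg _)
      rw [← Finset.sum_mul, h2] at h3
      rw [← Finset.sum_mul]
      linarith
  simp only [Real.rpow_one] at h1
  exact h1.of_norm_right

theorem IsWeight.cast_le_half (hw : IsWeight Λ) (i : Fin n) : (Λ i : ℝ) ≤ 1 / 2 := by
  have : ((Λ i : ℚ) : ℝ) ≤ ((1 / 2 : ℚ) : ℝ) := Rat.cast_le.2 (hw.1 i).2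
  simpa using this

theorem HasLeadingPart.conjSwap_eq (hΛ : ∀ i, 0 < Λ i) (hP : IsHomogeneousOne Λ P)
    (h : HasLeadingPart M p Λ Φ P) : P.conjSwap = P := by
  obtain ⟨-, F, -, hFP⟩ := h.exists_graph hΛ
  exact leadingPart_real (fun i => Rat.cast_pos.2 (hΛ i)) (isHomogeneousOne_iff.1 hP) hFP

/-- The pluriharmonic terms can be removed by a superhomogeneous transformation. -/
theorem HasLeadingPart.exists_mixedPart (hΛ : ∀ i, 0 < Λ i) (hw : IsWeight Λ)
    (hP : IsHomogeneousOne Λ P) (h : HasLeadingPart M p Λ Φ P) :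
    ∃ W : Space n → Space n, IsSuperhomAut Λ W ∧ HasLeadingPart M p Λ (W ∘ Φ) P.mixedPart ∧
      IsHomogeneousOne Λ P.mixedPart := by
  have hP' := isHomogeneousOne_iff.1 hP
  set q := C (2 * Complex.I) * P.slice 0 with hq
  have hqh : IsWeightedHomogeneous (fun i => (Λ i : ℝ)) q 1 :=
    IsWeightedHomogeneous.C_mul (isWeightedHomogeneous_slice_zero hP') _
  have hqh' : IsWeightedHomogeneous (fun i => (Λ i : ℝ)) (-q) 1 := by
    rw [← neg_one_smul ℂ q, smul_eq_C_mul]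
    exact IsWeightedHomogeneous.C_mul hqh _
  have hinv := polyInverse_vertical (D := -q)
    (eval_zero_of_isWeightedHomogeneous one_pos hqh')
  have hDo := isLittleO_eval_of_weight_le_half hw.cast_le_half hqh'
  have hX : ∀ i, IsWeightedHomogeneous (fun i => (Λ i : ℝ)) (X i : MvPolynomial (Fin n) ℂ)
      (Λ i : ℝ) := fun i => isWeightedHomogeneous_X _ _ _
  have h1 := h.polyMap hΛ hP hinv hDo hX hqh ((isLittleO_zero _ _).congr_left fun z => by simp)
  rw [ZPoly.subst_X, hq, ← mixedPart_eq_sub_imPart (h.conjSwap_eq hΛ hP)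
    (polar_zero_zero hP')] at h1
  exact ⟨_, isSuperhomAut_polyMap hΛ hinv hX hqh' hDo, h1⟩

end MixedPart

/-! ### The two equivalences. -/

section Main

variable {n : ℕ} {M : Set (Space n)} {p : Space n} {Φ T : Space n → Space n} {Λ : Fin n → ℚ}
  {P P' : ZPoly n}

theorem IsSuperhomAut.of_normalized (hΛ : ∀ i, 0 < Λ i) (hw : IsWeight Λ)
    (hP : IsHomogeneousOne Λ P) (h : HasLeadingPart M p Λ Φ P) (hP' : IsHomogeneousOne Λ P')
    (hmix : ∀ d ∈ P'.support, IsMixed d) (hX : ∀ m, X m ∈ derivSpan (fun i => (Λ i : ℝ)) P' m)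
    (hT : IsBiholomorphicAt T 0) (hT0 : T 0 = 0) (h' : HasLeadingPart M p Λ (T ∘ Φ) P') :
    IsSuperhomAut Λ T := by
  obtain ⟨hΦ, F, hF, hFP⟩ := h.exists_graph hΛ
  obtain ⟨-, F', hF', hFP'⟩ := h'.exists_graph hΛ
  have hTt := preservesTangent_of_isGraphIn hΦ hT hT0 hF hF'
  refine ⟨hT, hT0, (isSuperhomogeneous_iff hΛ hT.1).2 ⟨hTt, ?_⟩⟩
  exact isBigO_wgauge_of_leadingPart (fun i => Rat.cast_pos.2 (hΛ i)) hw.cast_le_half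
    (isHomogeneousOne_iff.1 hP) (isHomogeneousOne_iff.1 hP') hmix hX hF.tendsto hFP hFP' hT hT0 hTt
    (hF.eventually_apply hΦ hF')

/-- A transformation between adapted coordinates (up to pluriharmonic terms) is superhomogeneous. -/
theorem IsAdaptedModPluriharmonic.isSuperhomAut (hM : HasFiniteMultitype M p Λ)
    (h : IsAdaptedModPluriharmonic M p Λ Φ) (hT : IsBiholomorphicAt T 0) (hT0 : T 0 = 0)
    (h' : IsAdaptedModPluriharmonic M p Λ (T ∘ Φ)) : IsSuperhomAut Λ T := by
  have hΛ := hM.2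
  obtain ⟨hw, P, hP, -, hlead⟩ := h
  obtain ⟨-, P', hP', hmix', hlead'⟩ := h'
  -- The target coordinates are normalized by a superhomogeneous A = N ∘ W. Then A ∘ T is
  -- superhomogeneous by the descent, and so is T = A⁻¹ ∘ (A ∘ T).
  obtain ⟨W, hW, hleadW, hPW⟩ := hlead'.exists_mixedPart hΛ hw hP'
  obtain ⟨N, Q, hN, hQ, -, hmixQ, hleadQ, hX⟩ := exists_normalization hM hw hPW
    (ZPoly.exists_mixed_iff.1 hmix') (fun d hd => (ZPoly.support_mixedPart.1 hd).2) hleadW n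
  have hA := hN.comp hΛ hW
  have hb : IsBiholomorphicAt ((N ∘ W) ∘ T) 0 :=
    IsBiholomorphicAt.comp (by rw [hT0]; exact hA.biholomorphic) hT
  have hB : IsSuperhomAut Λ ((N ∘ W) ∘ T) :=
    IsSuperhomAut.of_normalized hΛ hw hP hlead hQ hmixQ (fun m => hX m m.2) hb
      (by rw [Function.comp_apply, hT0, hA.zero]) hleadQ
  obtain ⟨S, hS, hS0, hSA, hAS⟩ := hA.biholomorphic.exists_inverse hA.zero
  refine ((hA.inverse hΛ hS hS0 hAS).comp hΛ hB).congr hΛ ?_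
  filter_upwards [(hT.tendsto hT0).eventually hSA] with x hx
  exact hx

theorem IsAdapted.modPluriharmonic (h : IsAdapted M p Λ Φ) : IsAdaptedModPluriharmonic M p Λ Φ := by
  obtain ⟨hw, P, hP, hP0, hmix, hlead⟩ := h
  obtain ⟨d, hd⟩ := support_nonempty.2 hP0
  exact ⟨hw, P, hP, ⟨d, hd, hmix d hd⟩, hlead⟩

theorem ZPoly.polar_C_mul_sub (c : ℂ) (A B : ZPoly n) (x η : Fin n → ℂ) :
    ZPoly.polar (C c * (A - B)) x η = c * (A.polar x η - B.polar x η) := by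
  simp [ZPoly.polar]

theorem ZPoly.polar_C_mul (c : ℂ) (A : ZPoly n) (x η : Fin n → ℂ) :
    ZPoly.polar (C c * A) x η = c * A.polar x η := by
  simp [ZPoly.polar]

theorem ZPoly.polar_transfer (c : ℂ) (k : Fin n → MvPolynomial (Fin n) ℂ)
    (D : MvPolynomial (Fin n) ℂ) (x η : Fin n → ℂ) :
    ZPoly.polar (C c * (P.subst k - imPart D)) x η =
      c * (P.polar (fun i => eval x (k i)) (fun i => eval η (conjPoly (k i))) -
        (eval x D - eval η (conjPoly D)) / (2 * Complex.I)) := by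
  rw [ZPoly.polar_C_mul_sub, ZPoly.polar_subst, polar_imPart]

/-- Im D is pluriharmonic, and a substitution by holomorphic polynomials vanishing at 0 keeps
pluriharmonic terms pluriharmonic and mixed terms mixed. -/
theorem ZPoly.mixedPart_transfer {c : ℂ} {k : Fin n → MvPolynomial (Fin n) ℂ}
    {D : MvPolynomial (Fin n) ℂ} (hk : ∀ i, eval 0 (k i) = 0) :
    ZPoly.mixedPart (C c * (P.subst k - imPart D)) = C c * P.mixedPart.subst k := by
  have h1 : (fun i => eval 0 (k i)) = (0 : Fin n → ℂ) := funext hk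
  have h2 : (fun i => eval 0 (conjPoly (k i))) = (0 : Fin n → ℂ) :=
    funext fun i => by rw [eval_conjPoly_zero (hk i), Pi.zero_apply]
  refine ZPoly.polar_ext fun x η => ?_
  rw [ZPoly.polar_C_mul, ZPoly.polar_subst, ZPoly.polar_mixedPart, ZPoly.polar_mixedPart,
    ZPoly.polar_transfer, ZPoly.polar_transfer, ZPoly.polar_transfer, ZPoly.polar_transfer, h1, h2]
  ring

theorem ZPoly.subst_ne_zero_of_bind₁ {k h : Fin n → MvPolynomial (Fin n) ℂ}
    (hhk : ∀ i, bind₁ h (k i) = X i) (hP : P ≠ 0) : P.subst k ≠ 0 := by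
  intro h0
  refine hP (ZPoly.eq_of_value_eq fun z => ?_)
  have h1 : (P.subst k).value (fun j => eval z (h j)) = 0 := by rw [h0]; simp [ZPoly.value]
  simp only [ZPoly.value_subst, ← eval_bind₁, hhk, eval_X] at h1
  rw [h1]; simp [ZPoly.value]

/-- The leading terms of `T` are `h` in the tangential components and `c w + D` in the transverse
one. -/
structure LeadingTerms (Λ : Fin n → ℚ) (T : Space n → Space n) (c : ℝ)
    (h : Fin n → MvPolynomial (Fin n) ℂ) (D : MvPolynomial (Fin n) ℂ) : Prop where
  ne_zero : c ≠ 0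
  fst_homogeneous : ∀ i, IsWeightedHomogeneous (fun i => (Λ i : ℝ)) (h i) (Λ i : ℝ)
  snd_homogeneous : IsWeightedHomogeneous (fun i => (Λ i : ℝ)) D 1
  fst : ∀ i, (fun y : Space n => (T y).1 i - eval y.1 (h i)) =o[𝓝 0]
    fun y => wgauge (fun i => (Λ i : ℝ)) y ^ (Λ i : ℝ)
  snd : (fun y : Space n => (T y).2 - c * y.2 - eval y.1 D) =o[𝓝 0] wgauge fun i => (Λ i : ℝ)

theorem IsSuperhomAut.exists_leadingTerms (hΛ : ∀ i, 0 < Λ i) (hw : IsWeight Λ)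
    (hT : IsSuperhomAut Λ T) : ∃ c h D, LeadingTerms Λ T c h D := by
  obtain ⟨c, hc, hcT⟩ := hT.superhomogeneous.1.exists_coeff hT.biholomorphic
  obtain ⟨h, D, h1, h2, h3, h4⟩ := exists_expansion (fun i => Rat.cast_pos.2 (hΛ i))
    (fun i => (hw.cast_le_half i).trans_lt (by norm_num)) hT.biholomorphic.1 (hT.isBigO hΛ) hcT
  exact ⟨c, h, D, hc, h1, h2, h3, h4⟩

theorem LeadingTerms.eval_zero (hΛ : ∀ i, 0 < Λ i) {c : ℝ} {h : Fin n → MvPolynomial (Fin n) ℂ}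
    {D : MvPolynomial (Fin n) ℂ} (hT : LeadingTerms Λ T c h D) (i : Fin n) : eval 0 (h i) = 0 :=
  eval_zero_of_isWeightedHomogeneous (Rat.cast_pos.2 (hΛ i)) (hT.fst_homogeneous i)

theorem LeadingTerms.isLittleO_snd {c : ℝ} {h : Fin n → MvPolynomial (Fin n) ℂ}
    {D : MvPolynomial (Fin n) ℂ} (hT : LeadingTerms Λ T c h D) :
    (fun z : Fin n → ℂ => gPart T (z, 0) - eval z D) =o[𝓝 0] zgauge fun i => (Λ i : ℝ) :=
  (hT.snd.comp_tendsto tendsto_prodMk_zero).congr (fun z => by simp [gPart])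
    fun z => by simp [gauge_zero_right]

/-- The holomorphic terms of weight one vanish if and only if the leading term does. -/
theorem LeadingTerms.noHolomorphicTerms_iff (hΛ : ∀ i, 0 < Λ i) {c : ℝ}
    {h : Fin n → MvPolynomial (Fin n) ℂ} {D : MvPolynomial (Fin n) ℂ} (hT : LeadingTerms Λ T c h D)
    (hTa : IsSuperhomAut Λ T) : NoHolomorphicTermsOfWeightOne Λ T ↔ D = 0 := by
  have ha : AnalyticAt ℂ (gPart T) 0 :=
    ((LinearMap.toContinuousLinearMap (coord none : Space n →ₗ[ℂ] ℂ)).analyticAt _ |>.fun_comp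
      hTa.biholomorphic.1).sub
      ((LinearMap.toContinuousLinearMap (coord none : Space n →ₗ[ℂ] ℂ)).analyticAt _)
  constructor
  · intro h1
    have h2 := isLittleO_zgauge_of_noHolomorphicTerms hΛ ha hTa.superhomogeneous.2.2 h1
    refine eq_zero_of_isLittleO_eval (fun i => Rat.cast_pos.2 (hΛ i)) hT.snd_homogeneous ?_
    exact (h2.sub hT.isLittleO_snd).congr (fun z => by ring) fun z => by simp
  · rintro rfl
    exact noHolomorphicTerms_of_isLittleO_zgauge hΛ ha
      (hT.isLittleO_snd.congr_left fun z => by simp)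

/-- The leading term of the transverse component of the inverse vanishes if that of the
transformation does. -/
theorem LeadingTerms.inverse_snd_eq_zero (hΛ : ∀ i, 0 < Λ i) {S : Space n → Space n} {c c' : ℝ}
    {h k : Fin n → MvPolynomial (Fin n) ℂ} {D : MvPolynomial (Fin n) ℂ}
    (hT : LeadingTerms Λ T c h 0) (hS : LeadingTerms Λ S c' k D) (hTa : IsSuperhomAut Λ T)
    (hST : ∀ᶠ y in 𝓝 0, S (T y) = y) (hkh : ∀ i, bind₁ k (h i) = X i) : D = 0 := by
  have hμ : ∀ i, (0 : ℝ) < Λ i := fun i => Rat.cast_pos.2 (hΛ i)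
  have hTμ := hTa.isBigO hΛ
  have h1 := (hS.snd.comp_tendsto (hTa.biholomorphic.tendsto hTa.zero)).trans_isBigO hTμ
  have h2 := isLittleO_eval_sub_eval (ρ := wgauge fun i => (Λ i : ℝ)) gauge_nonneg
    (fun j => (hμ j).le)
    (fun j => isBigO_coord_of_isBigO_wgauge hμ gauge_nonneg hTμ (some j)) hT.fst
    hS.snd_homogeneous
  simp only [Real.rpow_one] at h2
  -- The last component of S(T(z, 0)) = (z, 0) leaves only D(h(z)) at weight one; h is invertible.
  have h3 : (fun z : Fin n → ℂ => eval z (bind₁ h D)) =o[𝓝 0] zgauge fun i => (Λ i : ℝ) := by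
    have h4 := ((h1.add h2).add (hT.snd.const_mul_left (c' : ℂ))).comp_tendsto tendsto_prodMk_zero
    refine (h4.congr' ?_ (Eventually.of_forall fun z => by simp [gauge_zero_right])).neg_left.congr_left
      fun z => neg_neg _
    filter_upwards [tendsto_prodMk_zero.eventually hST] with z hz
    simp only [Function.comp_apply, hz, eval_bind₁, coord_some, map_zero]
    ring
  have h4 : bind₁ h D = 0 := eq_zero_of_isLittleO_eval hμ
    (IsWeightedHomogeneous.bind₁ hS.snd_homogeneous hT.fst_homogeneous)
    (h3.congr_right fun z => by simp)
  have h5 := congrArg (bind₁ k) h4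
  have e : (fun i => bind₁ k (h i)) = X := funext hkh
  rwa [bind₁_bind₁, e, bind₁_X_left, map_zero] at h5

/-- The leading part in the coordinates obtained by a superhomogeneous transformation. -/
theorem HasLeadingPart.comp_isSuperhomAut (hΛ : ∀ i, 0 < Λ i) (hw : IsWeight Λ)
    (hP : IsHomogeneousOne Λ P) (hlead : HasLeadingPart M p Λ Φ P) (hT : IsSuperhomAut Λ T) :
    ∃ (c : ℝ) (k : Fin n → MvPolynomial (Fin n) ℂ) (D : MvPolynomial (Fin n) ℂ), c ≠ 0 ∧
      (∀ i, eval 0 (k i) = 0) ∧ (∀ Q : ZPoly n, Q ≠ 0 → Q.subst k ≠ 0) ∧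
      (NoHolomorphicTermsOfWeightOne Λ T → D = 0) ∧
      HasLeadingPart M p Λ (T ∘ Φ) (C (c⁻¹ : ℂ) * (P.subst k - imPart D)) ∧
      IsHomogeneousOne Λ (C (c⁻¹ : ℂ) * (P.subst k - imPart D) : ZPoly n) := by
  have hμ : ∀ i, (0 : ℝ) < Λ i := fun i => Rat.cast_pos.2 (hΛ i)
  obtain ⟨S, hSb, hS0, hST, hTS⟩ := hT.biholomorphic.exists_inverse hT.zero
  have hS := hT.inverse hΛ hSb hS0 hTS
  obtain ⟨c, k, D, hlS⟩ := hS.exists_leadingTerms hΛ hw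
  obtain ⟨c', h, D', hlT⟩ := hT.exists_leadingTerms hΛ hw
  have hkh := bind₁_expansion hμ hTS (hSb.tendsto hS0) (hS.isBigO hΛ) hlS.fst_homogeneous
    hlT.fst_homogeneous hlS.fst hlT.fst
  have hhk := bind₁_expansion hμ hST (hT.biholomorphic.tendsto hT.zero) (hT.isBigO hΛ)
    hlT.fst_homogeneous hlS.fst_homogeneous hlT.fst hlS.fst
  refine ⟨c, k, D, hlS.ne_zero, hlS.eval_zero hΛ, fun Q hQ => ZPoly.subst_ne_zero_of_bind₁ hhk hQ,
    fun hno => ?_, hlead.transfer hΛ hP hT.biholomorphic hT.zero hT.superhomogeneous.1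
      (hSb.tendsto hS0) hST hlS.ne_zero hlS.fst_homogeneous hlS.snd_homogeneous hlS.fst hlS.snd⟩
  obtain rfl := (hlT.noHolomorphicTerms_iff hΛ hT).1 hno
  exact hlT.inverse_snd_eq_zero hΛ hlS hT hST hkh

theorem IsAdaptedModPluriharmonic.comp (hΛ : ∀ i, 0 < Λ i)
    (h : IsAdaptedModPluriharmonic M p Λ Φ) (hT : IsSuperhomAut Λ T) :
    IsAdaptedModPluriharmonic M p Λ (T ∘ Φ) := by
  obtain ⟨hw, P, hP, hmix, hlead⟩ := h
  obtain ⟨c, k, D, hc, hk, hk', -, h1, h2⟩ := hlead.comp_isSuperhomAut hΛ hw hP hT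
  refine ⟨hw, _, h2, ?_, h1⟩
  rw [ZPoly.exists_mixed_iff] at hmix ⊢
  rw [ZPoly.mixedPart_transfer hk]
  refine mul_ne_zero ?_ (hk' _ hmix)
  rw [Ne, C_eq_zero]
  exact inv_ne_zero (Complex.ofReal_ne_zero.2 hc)

theorem IsAdapted.comp (hΛ : ∀ i, 0 < Λ i) (h : IsAdapted M p Λ Φ) (hT : IsSuperhomAut Λ T)
    (hno : NoHolomorphicTermsOfWeightOne Λ T) : IsAdapted M p Λ (T ∘ Φ) := by
  obtain ⟨hw, P, hP, hP0, hmix, hlead⟩ := h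
  obtain ⟨c, k, D, hc, hk, hk', hD, h1, h2⟩ := hlead.comp_isSuperhomAut hΛ hw hP hT
  have hm := ZPoly.mixedPart_transfer (P := P) (c := (c : ℂ)⁻¹) (D := D) hk
  rw [ZPoly.forall_mixed_iff.1 hmix] at hm
  rw [hD hno, imPart_zero, sub_zero] at hm h1 h2
  refine ⟨hw, _, h2, mul_ne_zero ?_ (hk' _ hP0), ZPoly.forall_mixed_iff.2 hm, h1⟩
  rw [Ne, C_eq_zero]
  exact inv_ne_zero (Complex.ofReal_ne_zero.2 hc)

/-- Both leading parts are mixed, so at η = 0 the polarised transformation rule reduces to D = 0. -/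
theorem IsAdapted.noHolomorphicTerms (hΛ : ∀ i, 0 < Λ i) (h : IsAdapted M p Λ Φ)
    (h' : IsAdapted M p Λ (T ∘ Φ)) (hT : IsSuperhomAut Λ T) :
    NoHolomorphicTermsOfWeightOne Λ T := by
  have hμ : ∀ i, (0 : ℝ) < Λ i := fun i => Rat.cast_pos.2 (hΛ i)
  obtain ⟨hw, P, hP, -, hmix, hlead⟩ := h
  obtain ⟨-, P', hP', -, hmix', hlead'⟩ := h'
  obtain ⟨c, h, D, hlT⟩ := hT.exists_leadingTerms hΛ hw
  rw [hlT.noHolomorphicTerms_iff hΛ hT]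
  obtain ⟨hΦ, F, hF, hFP⟩ := hlead.exists_graph hΛ
  obtain ⟨-, F', hF', hFP'⟩ := hlead'.exists_graph hΛ
  rw [isHomogeneousOne_iff] at hP hP'
  have h1 := isLittleO_graph_transfer hμ hP' hFP' hF.tendsto (hT.biholomorphic.tendsto hT.zero)
    hlT.ne_zero hlT.fst_homogeneous hlT.snd_homogeneous hlT.fst hlT.snd
    (hF.eventually_apply hΦ hF')
  have h2 := leadingPart_unique hμ hP (IsWeightedHomogeneous.C_mul
    ((ZPoly.isWeightedHomogeneous_subst hP' hlT.fst_homogeneous).sub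
      (isWeightedHomogeneous_imPart hlT.snd_homogeneous)) _) hFP h1
  have hconj : (fun i => eval 0 (conjPoly (h i))) = (0 : Fin n → ℂ) :=
    funext fun i => by rw [eval_conjPoly_zero (hlT.eval_zero hΛ i), Pi.zero_apply]
  refine MvPolynomial.funext fun x => ?_
  have h3 := congrArg (fun Q => ZPoly.polar Q x 0) h2
  have h4 := (ZPoly.forall_mixed_iff_polar.1 hmix).1
  have h5 := (ZPoly.forall_mixed_iff_polar.1 hmix').1
  have h6 := eval_conjPoly_zero (eval_zero_of_isWeightedHomogeneous one_pos hlT.snd_homogeneous)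
  rw [ZPoly.polar_transfer, hconj, h4, h5, h6] at h3
  rw [zero_sub, sub_zero, zero_eq_mul, neg_eq_zero, div_eq_zero_iff] at h3
  rw [map_zero]
  exact (h3.resolve_left (inv_ne_zero (Complex.ofReal_ne_zero.2 hlT.ne_zero))).resolve_right
    (mul_ne_zero two_ne_zero Complex.I_ne_zero)

end Main
end CatlinMultitype

open CatlinMultitype
theorem proposition4p1 (n : ℕ) (M : Set (Space n)) (p : Space n)
    (hM : IsSmoothHypersurfaceAt M p)
    (Λ : Fin n → ℚ) (hΛ : HasFiniteMultitype M p Λ)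
    (Φ : Space n → Space n)
    (T : Space n → Space n) (hT : IsBiholomorphicAt T 0) (hT0 : T 0 = 0) :
    (IsAdapted M p Λ Φ →
      (IsAdapted M p Λ (T ∘ Φ) ↔
        IsSuperhomogeneous Λ T ∧ NoHolomorphicTermsOfWeightOne Λ T)) ∧
    (IsAdaptedModPluriharmonic M p Λ Φ →
      (IsAdaptedModPluriharmonic M p Λ (T ∘ Φ) ↔ IsSuperhomogeneous Λ T)) := by
  refine ⟨fun h => ⟨fun h' => ?_, fun h' => h.comp hΛ.2 ⟨hT, hT0, h'.1⟩ h'.2⟩,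
    fun h => ⟨fun h' => (h.isSuperhomAut hΛ hT hT0 h').superhomogeneous,
      fun h' => h.comp hΛ.2 ⟨hT, hT0, h'⟩⟩⟩
  have hTa := h.modPluriharmonic.isSuperhomAut hΛ hT hT0 h'.modPluriharmonic
  exact ⟨hTa.superhomogeneous, h.noHolomorphicTerms hΛ.2 h' hTa⟩
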